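/- **Setting.** For $a>0$ and $p,q\in\mathbb R^3$ put $p^0=\sqrt{1+a^2|p|^2}$, $q^0=\sqrt{1+a^2|q|^2}$, $e=p^0+q^0$, and for $\omega\in S^2$ $$p'=p+b\,\omega,\qquad q'=q-b\,\omega,\qquad b=\frac{2\,p^0q^0\,e\;\omega\cdot\left(\frac{q}{q^0}-\frac{p}{p^0}\right)}{e^2-a^2\,(\omega\cdot(p+q))^2},$$ so that $p+q=p'+q'$ and $p^0+q^0=p'^0+q'^0$. Let the collision kernel $A(a,p,q,p',q')$, defined for $a>0$ and $p,q,p',q'\in\mathbb R^3$, be continuous, with $0\le A\le C_1$, $A(a,p,q,p',q')=A(a,q,p,q',p')=A(a,p',q',p,q)$, $|A(a_1,p,q,p',q')-A(a_2,p,q,p',q')|\le\gamma|a_1-a_2|$ for some constants $C_1,\gamma>0$, and $A(a,Mp,Mq,Mp',Mq')=A(a,p,q,p',q')$ for all $M\in SO_3$. The collision operator is $$Q(f,f)(p)=\int_{\mathbb R^3}\frac{a^3\,dq}{q^0}\int_{S^2}\bigl[f(p')f(q')-f(p)f(q)\bigr]A(a,p,q,p',q')\,d\omega .$$ Let $L^1_2(\mathbb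 R^3)$ be the space of $h\in L^1(\mathbb R^3)$ with $\|h\|=\int\sqrt{1+|p|^2}\,|h(p)|\,dp<\infty$. The Einstein–Boltzmann system, with cosmological constant $\Lambda$, for a scale factor $a(t)>0$ and a distribution function $f(t,p)\ge0$ on the flat Robertson–Walker space-time $g=-dt^2+a(t)^2\left((dx^1)^2+(dx^2)^2+(dx^3)^2\right)$ consists of the Einstein equations $$R_{\alpha\beta}-\tfrac12R\,g_{\alpha\beta}+\Lambda g_{\alpha\beta}=8\pi T_{\alpha\beta},\qquad T^{\alpha\beta}(t)=\int_{\mathbb R^3}\frac{p^\alpha p^\beta f(t,p)\,a(t)^3}{p^0}\,dp\qquad(0\le\alpha,\beta\le 3),$$ and of the Boltzmann equation $$\partial_tf-2\frac{\dot a}{a}\sum_{i=1}^3p^i\,\partial_{p^i}f=\frac1{p^0}Q(f,f).$$ The latter is understood along its characteristics $p(t,y)=\frac{a(0)^2}{a(t)^2}\,y$: for almost every $y\in\mathbb R^3$ and all $t\ge 0$, the integrand below is integrable on $[0,t]$ and $$f(t,p(t,y))=f_0(y)+\int_0^t\Bigl(\tfrac1{p^0}Q(f,f)\Bigr)(s,p(s,y))\,ds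 .$$ **Theorem 6.1.** Let $\Lambda>0$, $a_0\ge\frac32$, and let $f_0\in L^1_2(\mathbb R^3)$ with $f_0\ge0$ a.e. and $f_0\circ M=f_0$ a.e. for every $M\in SO_3$. Define $\dot a_0$ by the Hamiltonian constraint $$\frac{\dot a_0}{a_0}=\sqrt{\frac{8\pi}{3}\int_{\mathbb R^3}a_0^3\sqrt{1+a_0^2|p|^2}\,f_0(p)\,dp+\frac{\Lambda}{3}} .$$ Then the Einstein–Boltzmann system has a global solution $(a,f)$ on $[0,\infty)$ with $a(0)=a_0$, $\dot a(0)=\dot a_0$, $f(0)=f_0$. Here $a\in C^2([0,\infty))$ is strictly positive, and $f:[0,\infty)\to L^1_2(\mathbb R^3)$ is continuous and bounded, with $f(t)\ge0$ a.e. for every $t\ge0$. No smallness of $a_0$ or $f_0$ is assumed. -/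

import Mathlib

open MeasureTheory Set Filter Topology
open scoped Matrix

namespace EinsteinBoltzmann

noncomputable section

/-! ### Momenta and the weighted space of distribution functions -/

/-- Spatial momenta, with the Euclidean norm and Lebesgue measure. -/
abbrev Mom : Type := EuclideanSpace ℝ (Fin 3)

/-- The unit sphere of momentum space (its volume element is `volume.toSphere`, of mass `4π`). -/
abbrev Sph : Type := Metric.sphere (0 : Mom) 1

/-- The weighted norm `‖h‖ = ∫ √(1 + |p|²) |h(p)| dp`. -/
def normL12 (h : Mom → ℝ) : ℝ := ∫ p, √(1 + ‖p‖ ^ 2) * |h p|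

/-- Membership in the weighted space: `h ∈ L¹` and `∫ √(1 + |p|²) |h(p)| dp < ∞`. -/
def MemL12 (h : Mom → ℝ) : Prop :=
  Integrable h ∧ Integrable (fun p => √(1 + ‖p‖ ^ 2) * |h p|)

/-- The action of a `3 × 3` matrix on momenta. -/
def act (M : Matrix (Fin 3) (Fin 3) ℝ) (p : Mom) : Mom := WithLp.toLp 2 (M *ᵥ WithLp.ofLp p)

/-- Almost everywhere invariance of a function of the momentum under the rotation group. -/
def RotInvariant (h : Mom → ℝ) : Prop :=
  ∀ M ∈ Matrix.specialOrthogonalGroup (Fin 3) ℝ, ∀ᵐ p : Mom, h (act M p) = h p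

/-! ### Binary elastic collisions. In this part `α > 0` is the value of the expansion factor. -/

/-- The energy `p⁰ = √(1 + α² |p|²)` of a particle of unit rest mass. -/
def energy (α : ℝ) (p : Mom) : ℝ := √(1 + α ^ 2 * ‖p‖ ^ 2)

/-- The nontrivial root `b` of the energy balance
`energy α (p + b ω) + energy α (q - b ω) = energy α p + energy α q`
(see `energy_conservation` below). -/
def transfer (α : ℝ) (p q ω : Mom) : ℝ :=
  2 * energy α p * energy α q * (energy α p + energy α q) *
      inner ℝ ω ((energy α q)⁻¹ • q - (energy α p)⁻¹ • p) /
    ((energy α p + energy α q) ^ 2 - α ^ 2 * inner ℝ ω (p + q) ^ 2)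

/-- Post-collisional momentum `p' = p + b ω`. -/
def postP (α : ℝ) (p q ω : Mom) : Mom := p + transfer α p q ω • ω

/-- Post-collisional momentum `q' = q - b ω`. -/
def postQ (α : ℝ) (p q ω : Mom) : Mom := q - transfer α p q ω • ω

/-- The elementary energy is conserved in a collision. -/
theorem energy_conservation (α : ℝ) (p q ω : Mom) (hω : ‖ω‖ = 1) :
    energy α (postP α p q ω) + energy α (postQ α p q ω) = energy α p + energy α q := by
  set x := energy α p with hx
  set y := energy α q with hy
  set b := transfer α p q ω with hb
  set P : ℝ := inner ℝ ω p with hP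
  set Q : ℝ := inner ℝ ω q with hQ
  have nn (v : Mom) : 0 ≤ 1 + α ^ 2 * ‖v‖ ^ 2 := by positivity
  have hx2 : x ^ 2 = 1 + α ^ 2 * ‖p‖ ^ 2 := Real.sq_sqrt (nn p)
  have hy2 : y ^ 2 = 1 + α ^ 2 * ‖q‖ ^ 2 := Real.sq_sqrt (nn q)
  have hx0 : 0 < x := Real.sqrt_pos.2 (by positivity)
  have hy0 : 0 < y := Real.sqrt_pos.2 (by positivity)
  have hxp : |α| * ‖p‖ < x := Real.lt_sqrt_of_sq_lt (by rw [mul_pow, sq_abs]; linarith)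
  have hyq : |α| * ‖q‖ < y := Real.lt_sqrt_of_sq_lt (by rw [mul_pow, sq_abs]; linarith)
  have htot : |α| * ‖p + q‖ < x + y := by
    nlinarith [norm_add_le p q, abs_nonneg α]
  have htot2 : α ^ 2 * ‖p + q‖ ^ 2 < (x + y) ^ 2 := by
    rw [← sq_abs α, ← mul_pow]; gcongr
  have hPQ : (inner ℝ ω (p + q) : ℝ) = P + Q := inner_add_right ω p q
  have hPQ2 : (P + Q) ^ 2 ≤ ‖p + q‖ ^ 2 := by
    rw [← hPQ, ← sq_abs]
    gcongr
    simpa [hω] using abs_real_inner_le_norm ω (p + q)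
  have hD : 0 < (x + y) ^ 2 - α ^ 2 * (P + Q) ^ 2 := by
    nlinarith [mul_le_mul_of_nonneg_left hPQ2 (sq_nonneg α)]
  have hbD : b * ((x + y) ^ 2 - α ^ 2 * (P + Q) ^ 2) = 2 * (x + y) * (x * Q - y * P) := by
    rw [hb, transfer, hPQ, div_mul_cancel₀ _ hD.ne', inner_sub_right, real_inner_smul_right,
      real_inner_smul_right, ← hP, ← hQ, ← hx, ← hy]
    field_simp
  have he : 0 < x + y := by positivity
  set c : ℝ := α ^ 2 * b * (P + Q) / (x + y) with hc
  have hcm : c * (x + y) = α ^ 2 * b * (P + Q) := div_mul_cancel₀ _ he.ne'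
  have hnp : ‖postP α p q ω‖ ^ 2 = ‖p‖ ^ 2 + 2 * b * P + b ^ 2 := by
    rw [postP, ← hb, norm_add_sq_real, real_inner_smul_right, norm_smul, hω, real_inner_comm,
      ← hP, mul_one, Real.norm_eq_abs, sq_abs]
    ring
  have hnq : ‖postQ α p q ω‖ ^ 2 = ‖q‖ ^ 2 - 2 * b * Q + b ^ 2 := by
    rw [postQ, ← hb, norm_sub_sq_real, real_inner_smul_right, norm_smul, hω, real_inner_comm,
      ← hQ, mul_one, Real.norm_eq_abs, sq_abs]
    ring
  have hs : (x + c) ^ 2 = 1 + α ^ 2 * ‖postP α p q ω‖ ^ 2 := by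
    have h1 : (x + y) ^ 2 * ((x + c) ^ 2 - (1 + α ^ 2 * ‖postP α p q ω‖ ^ 2)) = 0 := by
      rw [hnp]
      linear_combination (x + y) ^ 2 * hx2 + (2 * x * (x + y) + c * (x + y) + α ^ 2 * b * (P + Q)) * hcm
        - α ^ 2 * b * hbD
    have := (mul_eq_zero.1 h1).resolve_left (by positivity)
    linarith
  have hr : (y - c) ^ 2 = 1 + α ^ 2 * ‖postQ α p q ω‖ ^ 2 := by
    have h1 : (x + y) ^ 2 * ((y - c) ^ 2 - (1 + α ^ 2 * ‖postQ α p q ω‖ ^ 2)) = 0 := by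
      rw [hnq]
      linear_combination (x + y) ^ 2 * hy2 + (-2 * y * (x + y) + c * (x + y) + α ^ 2 * b * (P + Q)) * hcm
        - α ^ 2 * b * hbD
    have := (mul_eq_zero.1 h1).resolve_left (by positivity)
    linarith
  have hsum : postP α p q ω + postQ α p q ω = p + q := by
    simp only [postP, postQ]; abel
  have hpos : 0 < (x + c) * (y - c) := by
    by_contra hneg
    push Not at hneg
    set u := |α| * ‖postP α p q ω‖ with hu
    set v := |α| * ‖postQ α p q ω‖ with hv
    have hu0 : 0 ≤ u := by positivity
    have hv0 : 0 ≤ v := by positivity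
    have hu2 : (x + c) ^ 2 = 1 + u ^ 2 := by rw [hs, hu, mul_pow, sq_abs]
    have hv2 : (y - c) ^ 2 = 1 + v ^ 2 := by rw [hr, hv, mul_pow, sq_abs]
    have h1 : (1 + u * v) ^ 2 ≤ (-((x + c) * (y - c))) ^ 2 := by
      rw [neg_sq, mul_pow, hu2, hv2]; nlinarith [sq_nonneg (u - v)]
    have h2 : 1 + u * v ≤ -((x + c) * (y - c)) := le_of_abs_le (abs_le_of_sq_le_sq h1 (by linarith))
    have h3 : (x + y) ^ 2 ≤ (u - v) ^ 2 := by
      have : (x + y) ^ 2 = (x + c) ^ 2 + (y - c) ^ 2 + 2 * ((x + c) * (y - c)) := by ring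
      rw [this, hu2, hv2]
      linarith [sub_sq u v]
    have h4 : |u - v| ≤ |α| * ‖p + q‖ := by
      rw [hu, hv, ← mul_sub, abs_mul, abs_abs, ← hsum]
      gcongr
      simpa using abs_norm_sub_norm_le (postP α p q ω) (-postQ α p q ω)
    have h5 : (u - v) ^ 2 < (x + y) ^ 2 := by
      rw [← sq_abs (u - v)]
      gcongr
      exact h4.trans_lt htot
    linarith
  have hs0 : 0 < x + c := by
    rcases pos_and_pos_or_neg_and_neg_of_mul_pos hpos with h | h
    · exact h.1
    · linarith [h.1, h.2]
  have hr0 : 0 < y - c := (pos_iff_pos_of_mul_pos hpos).1 hs0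
  have e1 : energy α (postP α p q ω) = x + c := by rw [energy, ← hs, Real.sqrt_sq hs0.le]
  have e2 : energy α (postQ α p q ω) = y - c := by rw [energy, ← hr, Real.sqrt_sq hr0.le]
  rw [e1, e2]; ring

/-- The type of collision kernels `A(a, p, q, p', q')`. -/
abbrev Kernel : Type := ℝ → Mom → Mom → Mom → Mom → ℝ

/-- The assumptions on the collision kernel; only positive values of the expansion factor
matter. -/
structure IsCollisionKernel (A : Kernel) : Prop where
  /-- regularity in all the arguments -/
  continuousOn : ContinuousOn
    (fun x : ℝ × Mom × Mom × Mom × Mom => A x.1 x.2.1 x.2.2.1 x.2.2.2.1 x.2.2.2.2)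
    {x | 0 < x.1}
  /-- non-negativity -/
  nonneg : ∀ α, 0 < α → ∀ p q p' q', 0 ≤ A α p q p' q'
  /-- boundedness -/
  bounded : ∃ C₁ : ℝ, 0 < C₁ ∧ ∀ α, 0 < α → ∀ p q p' q', A α p q p' q' ≤ C₁
  /-- symmetry under exchange of the two particles -/
  symm_exchange : ∀ α, 0 < α → ∀ p q p' q', A α p q p' q' = A α q p q' p'
  /-- symmetry under exchange of the states before and after the collision -/
  symm_reverse : ∀ α, 0 < α → ∀ p q p' q', A α p q p' q' = A α p' q' p q
  /-- Lipschitz continuity in the expansion factor -/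
  lipschitz : ∃ γ : ℝ, 0 < γ ∧ ∀ α₁ α₂, 0 < α₁ → 0 < α₂ → ∀ p q p' q',
    |A α₁ p q p' q' - A α₂ p q p' q'| ≤ γ * |α₁ - α₂|
  /-- invariance under rotations -/
  rotInvariant : ∀ α, 0 < α → ∀ M ∈ Matrix.specialOrthogonalGroup (Fin 3) ℝ,
    ∀ p q p' q', A α (act M p) (act M q) (act M p') (act M q') = A α p q p' q'

/-- Gain part of the collision operator. -/
def gain (A : Kernel) (α : ℝ) (f g : Mom → ℝ) (p : Mom) : ℝ :=
  ∫ q : Mom, α ^ 3 / energy α q *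
    ∫ ω : Sph, f (postP α p q ω) * g (postQ α p q ω) *
      A α p q (postP α p q ω) (postQ α p q ω) ∂(volume : Measure Mom).toSphere

/-- Loss part of the collision operator. -/
def loss (A : Kernel) (α : ℝ) (f g : Mom → ℝ) (p : Mom) : ℝ :=
  ∫ q : Mom, α ^ 3 / energy α q *
    ∫ ω : Sph, f p * g q *
      A α p q (postP α p q ω) (postQ α p q ω) ∂(volume : Measure Mom).toSphere

/-- The collision operator `Q(f, g) = Q⁺(f, g) - Q⁻(f, g)`. -/
def collision (A : Kernel) (α : ℝ) (f g : Mom → ℝ) (p : Mom) : ℝ :=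
  gain A α f g p - loss A α f g p

/-! ### The Boltzmann equation -/

/-- The momentum at time `t` of the free particle with momentum `y` at time `0`, i.e. the solution
of the characteristic system `dp/dt = -2 (ȧ/a) p`, `p(0) = y`. -/
def characteristic (a : ℝ → ℝ) (t : ℝ) (y : Mom) : Mom := (a 0 ^ 2 / a t ^ 2) • y

/-- `f` solves, on `[0, ∞)`, the initial value problem for the Boltzmann equation
`∂f/∂t - 2 (ȧ/a) ∑ᵢ pⁱ ∂f/∂pⁱ = (1/p⁰) Q(f, f)`, integrated along its characteristics:
for almost every starting point `y` one has `df/dt = (1/p⁰) Q(f, f)` along the characteristic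
through `y`, in integrated form. -/
def SolvesBoltzmann (A : Kernel) (a : ℝ → ℝ) (f₀ : Mom → ℝ) (f : ℝ → Mom → ℝ) : Prop :=
  ∀ᵐ y : Mom, ∀ t : ℝ, 0 ≤ t →
    IntervalIntegrable
      (fun s => collision A (a s) (f s) (f s) (characteristic a s y) /
        energy (a s) (characteristic a s y)) volume 0 t ∧
    f t (characteristic a t y) = f₀ y +
      ∫ s in (0 : ℝ)..t, collision A (a s) (f s) (f s) (characteristic a s y) /
        energy (a s) (characteristic a s y)

/-- `f` is a continuous and bounded curve on `[0, ∞)` in the weighted space, with non-negative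
values (and a jointly measurable representative is chosen). -/
structure IsDistributionCurve (f : ℝ → Mom → ℝ) : Prop where
  measurable : Measurable (Function.uncurry f)
  mem : ∀ t, 0 ≤ t → MemL12 (f t)
  nonneg : ∀ t, 0 ≤ t → ∀ᵐ p : Mom, 0 ≤ f t p
  continuous : ∀ t, 0 ≤ t →
    Tendsto (fun s => normL12 (fun p => f s p - f t p)) (𝓝[Ici 0] t) (𝓝 0)
  bounded : ∃ r : ℝ, ∀ t, 0 ≤ t → normL12 (f t) ≤ r

/-! ### The Einstein equations

All the tensor fields considered depend on the time `t = x⁰ ∈ [0, ∞)` only. -/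

/-- The partial derivative `∂_i h`, at time `t`, of a function `h` of the time alone (one-sided at
`t = 0`). -/
def pd (i : Fin 4) (h : ℝ → ℝ) (t : ℝ) : ℝ := if i = 0 then derivWithin h (Ici 0) t else 0

/-- The Robertson-Walker metric `-dt² + a(t)² ((dx¹)² + (dx²)² + (dx³)²)`. -/
def rwMetric (a : ℝ → ℝ) (t : ℝ) : Matrix (Fin 4) (Fin 4) ℝ :=
  Matrix.diagonal ![-1, a t ^ 2, a t ^ 2, a t ^ 2]

/-- Christoffel symbols
`Γ^l_{ij} = ½ g^{lm} (∂_i g_{mj} + ∂_j g_{im} - ∂_m g_{ij})`. -/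
def christoffel (g : ℝ → Matrix (Fin 4) (Fin 4) ℝ) (l i j : Fin 4) (t : ℝ) : ℝ :=
  (1 / 2) * ∑ m, (g t)⁻¹ l m *
    (pd i (fun s => g s m j) t + pd j (fun s => g s i m) t - pd m (fun s => g s i j) t)

/-- Curvature tensor
`R^l_{m,ij} = ∂_i Γ^l_{mj} - ∂_j Γ^l_{mi} + Γ^l_{ni} Γ^n_{mj} - Γ^l_{nj} Γ^n_{mi}`. -/
def riemann (g : ℝ → Matrix (Fin 4) (Fin 4) ℝ) (l m i j : Fin 4) (t : ℝ) : ℝ :=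
  pd i (christoffel g l m j) t - pd j (christoffel g l m i) t +
    ∑ n, (christoffel g l n i t * christoffel g n m j t -
      christoffel g l n j t * christoffel g n m i t)

/-- Ricci tensor `R_{ij} = R^l_{i,lj}`. -/
def ricci (g : ℝ → Matrix (Fin 4) (Fin 4) ℝ) (i j : Fin 4) (t : ℝ) : ℝ :=
  ∑ l, riemann g l i l j t

/-- Scalar curvature `R = g^{ij} R_{ij}`. -/
def scalarCurv (g : ℝ → Matrix (Fin 4) (Fin 4) ℝ) (t : ℝ) : ℝ :=
  ∑ i, ∑ j, (g t)⁻¹ i j * ricci g i j t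

/-- The 4-momentum `(p⁰, p¹, p², p³)` on the future sheet of the mass shell. -/
def fourMom (α : ℝ) (p : Mom) : Fin 4 → ℝ := ![energy α p, p 0, p 1, p 2]

/-- Stress-matter tensor `T^{ij}(t) = ∫ (p^i p^j / p⁰) f(t, p) |g|^{1/2} dp`, with
`|g|^{1/2} = a³`. -/
def stressUp (a : ℝ → ℝ) (f : ℝ → Mom → ℝ) (i j : Fin 4) (t : ℝ) : ℝ :=
  ∫ p : Mom, fourMom (a t) p i * fourMom (a t) p j * f t p * a t ^ 3 / energy (a t) p

/-- Stress-matter tensor with lowered indices. -/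
def stressDown (a : ℝ → ℝ) (f : ℝ → Mom → ℝ) (i j : Fin 4) (t : ℝ) : ℝ :=
  ∑ l, ∑ m, rwMetric a t i l * rwMetric a t j m * stressUp a f l m t

/-- All the Einstein equations
`R_{ij} - ½ R g_{ij} + Λ g_{ij} = 8 π T_{ij}` on `[0, ∞)` (gravitational constant `1`). -/
def SolvesEinstein (Λ : ℝ) (a : ℝ → ℝ) (f : ℝ → Mom → ℝ) : Prop :=
  ∀ t, 0 ≤ t → ∀ i j : Fin 4,
    ricci (rwMetric a) i j t - (1 / 2) * scalarCurv (rwMetric a) t * rwMetric a t i j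
      + Λ * rwMetric a t i j = 8 * Real.pi * stressDown a f i j t

/-- `(a, f)` is a global solution, on `[0, ∞)`, of the initial value problem for the
Einstein-Boltzmann system with initial data `(a₀, ȧ₀, f₀)`. -/
structure IsGlobalSolution (A : Kernel) (Λ a₀ adot₀ : ℝ) (f₀ : Mom → ℝ)
    (a : ℝ → ℝ) (f : ℝ → Mom → ℝ) : Prop where
  pos : ∀ t, 0 ≤ t → 0 < a t
  contDiffOn : ContDiffOn ℝ 2 a (Ici 0)
  curve : IsDistributionCurve f
  einstein : SolvesEinstein Λ a f
  boltzmann : SolvesBoltzmann A a f₀ f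
  initial_a : a 0 = a₀
  initial_adot : derivWithin a (Ici 0) 0 = adot₀
  initial_f : f 0 =ᵐ[volume] f₀

end

end EinsteinBoltzmann

namespace EinsteinBoltzmann

noncomputable section

/-! ### Geometry of a binary collision -/

/-! A free momentum decays like a⁻², so y = (a²/a₀²) p is constant along the characteristics.
Dilating momenta by c turns collisions at expansion factor α into collisions at cα
(`collision_smul`); in the variable y they therefore take place at a₀²/α, which stays in (0, a₀].
The Hamiltonian constraint expresses H = ȧ/a through α and the distribution, with H ≥ √(Λ/3) > 0.
Hence a increases and can serve as the clock. With this clock the metric drops out, and what remains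
is an evolution equation dF/dα = (α H(α, F))⁻¹ S(α, F) in the weighted L¹ space for α ≥ a₀
(`comovingRHS`).

The collision estimates rest on two facts: for a fixed ω the collision map is an involution
preserving dp dq / (p⁰q⁰) (`measurePreserving_collide`), and |p'| ≤ |p| + |q| (`norm_postP_le`).
They give the weak form of the collision operator (`pairCollision_weak`), conservation of number and
energy, a bound of S by the product of the weighted norm and the L¹ norm, and Lipschitz continuity
on bounded sets (`source_weak`, `source_sub_le`).

For global existence, the distribution on the right-hand side is replaced by its positive part cut
off at norm R. The result is bounded and globally Lipschitz, so a fixed point in an exponentially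
weighted space gives a solution for all α ≥ a₀ (`exists_isMildSolution`). It stays non-negative
because the loss term vanishes where F ≤ 0. Then the L¹ norm is conserved, so the quadratic bound on
S becomes linear with the integrable coefficient α⁻⁴, and Grönwall bounds the weighted norm
independently of R (`IsMildSolution.normL12_le`). For R above that bound the truncation has no
effect (`exists_isComovingSolution`). Uniqueness for the truncated equation transfers rotation
invariance from the data to the solution.

To return to time: F is only Lipschitz in α, but since collisions conserve energy, the energy
density ρ is differentiable with dρ/dα = -3(ρ + P)/α
(`IsComovingSolution.hasDerivWithinAt_energyDensity`). So H is a C¹ function of α along the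
solution, bounded above and away from zero, and ȧ = a H(a) is solved for all times by a C² function
(`exists_scale_factor`). The constraint is the first Friedmann equation and its derivative the
second; isotropy makes the stress tensor diagonal, so these are all the Einstein equations. The
substitution r = a(s) turns the equation for F into the Boltzmann equation
(`IsComovingSolution.solvesBoltzmann`). -/

lemma energy_sq (α : ℝ) (p : Mom) : energy α p ^ 2 = 1 + α ^ 2 * ‖p‖ ^ 2 :=
  Real.sq_sqrt (by positivity)

lemma energy_pos (α : ℝ) (p : Mom) : 0 < energy α p := Real.sqrt_pos.2 (by positivity)

lemma one_le_energy (α : ℝ) (p : Mom) : 1 ≤ energy α p :=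
  Real.one_le_sqrt.2 (by nlinarith [mul_nonneg (sq_nonneg α) (sq_nonneg ‖p‖)])

lemma abs_mul_norm_lt_energy (α : ℝ) (p : Mom) : |α| * ‖p‖ < energy α p :=
  Real.lt_sqrt_of_sq_lt (by rw [mul_pow, sq_abs]; linarith)

lemma continuous_energy : Continuous fun z : ℝ × Mom => energy z.1 z.2 := by
  unfold energy; fun_prop

@[fun_prop]
lemma measurable_energy_comp {X : Type*} [MeasurableSpace X] {α : X → ℝ} {p : X → Mom}
    (hα : Measurable α) (hp : Measurable p) : Measurable fun x => energy (α x) (p x) :=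
  continuous_energy.measurable.comp (hα.prodMk hp)

/-- For a unit vector ω, |α (ω·p + ω·q)| is at most |α|(|p| + |q|), which is strictly below p⁰ + q⁰
because the rest mass is positive. -/
lemma collision_den_pos (α : ℝ) (p q : Mom) {ω : Mom} (hω : ‖ω‖ = 1) :
    0 < (energy α p + energy α q) ^ 2 - α ^ 2 * (inner ℝ ω p + inner ℝ ω q) ^ 2 := by
  have hxp := abs_mul_norm_lt_energy α p
  have hyq := abs_mul_norm_lt_energy α q
  have h1 : |inner ℝ ω p| ≤ ‖p‖ := by simpa [hω] using abs_real_inner_le_norm ω p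
  have h2 : |inner ℝ ω q| ≤ ‖q‖ := by simpa [hω] using abs_real_inner_le_norm ω q
  have h3 : |α * (inner ℝ ω p + inner ℝ ω q)| < energy α p + energy α q := by
    rw [abs_mul]
    have := abs_add_le (inner ℝ ω p : ℝ) (inner ℝ ω q)
    nlinarith [abs_nonneg α]
  have h4 := sq_lt_sq' (abs_lt.1 h3).1 (abs_lt.1 h3).2
  rw [mul_pow] at h4
  linarith

lemma transfer_eq (α : ℝ) (p q ω : Mom) :
    transfer α p q ω = 2 * (energy α p + energy α q) *
      (energy α p * inner ℝ ω q - energy α q * inner ℝ ω p) /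
      ((energy α p + energy α q) ^ 2 - α ^ 2 * (inner ℝ ω p + inner ℝ ω q) ^ 2) := by
  have hx := (energy_pos α p).ne'
  have hy := (energy_pos α q).ne'
  rw [transfer, inner_sub_right, real_inner_smul_right, real_inner_smul_right, inner_add_right]
  congr 1
  field_simp

/-- The energy gained by the first particle in a collision. -/
def energyTransfer (α : ℝ) (p q ω : Mom) : ℝ :=
  α ^ 2 * transfer α p q ω * (inner ℝ ω p + inner ℝ ω q) / (energy α p + energy α q)

/-- The formula for b makes both candidates have the right squares, so only signs are in doubt.
Conservation of total energy settles them. -/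
lemma energy_post (α : ℝ) (p q : Mom) {ω : Mom} (hω : ‖ω‖ = 1) :
    energy α (postP α p q ω) = energy α p + energyTransfer α p q ω ∧
      energy α (postQ α p q ω) = energy α q - energyTransfer α p q ω := by
  have hsum := energy_conservation α p q ω hω
  have hP2 := energy_sq α (postP α p q ω)
  have hQ2 := energy_sq α (postQ α p q ω)
  have hP0 := energy_pos α (postP α p q ω)
  have hQ0 := energy_pos α (postQ α p q ω)
  have hnp : ‖postP α p q ω‖ ^ 2 =
      ‖p‖ ^ 2 + 2 * transfer α p q ω * inner ℝ ω p + transfer α p q ω ^ 2 := by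
    rw [postP, norm_add_sq_real, real_inner_smul_right, norm_smul, hω, real_inner_comm,
      mul_one, Real.norm_eq_abs, sq_abs]
    ring
  have hnq : ‖postQ α p q ω‖ ^ 2 =
      ‖q‖ ^ 2 - 2 * transfer α p q ω * inner ℝ ω q + transfer α p q ω ^ 2 := by
    rw [postQ, norm_sub_sq_real, real_inner_smul_right, norm_smul, hω, real_inner_comm,
      mul_one, Real.norm_eq_abs, sq_abs]
    ring
  have hD := collision_den_pos α p q hω
  have hx2 := energy_sq α p
  have hy2 := energy_sq α q
  have hx0 := energy_pos α p
  have hy0 := energy_pos α q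
  have hb := transfer_eq α p q ω
  have hc : energyTransfer α p q ω = α ^ 2 * transfer α p q ω * (inner ℝ ω p + inner ℝ ω q) /
    (energy α p + energy α q) := rfl
  generalize energy α (postP α p q ω) = x' at *
  generalize energy α (postQ α p q ω) = y' at *
  generalize transfer α p q ω = b at *
  generalize energyTransfer α p q ω = c at *
  generalize energy α p = x at *
  generalize energy α q = y at *
  generalize inner ℝ ω p = P at *
  generalize inner ℝ ω q = Q at *
  rw [hnp] at hP2
  rw [hnq] at hQ2
  have he : 0 < x + y := by positivity
  have hcm : c * (x + y) = α ^ 2 * b * (P + Q) := by rw [hc, div_mul_cancel₀ _ he.ne']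
  have hbD : b * ((x + y) ^ 2 - α ^ 2 * (P + Q) ^ 2) = 2 * (x + y) * (x * Q - y * P) := by
    rw [hb, div_mul_cancel₀ _ hD.ne']
  have h1 : (x + y) ^ 2 * ((x + c) ^ 2 - x' ^ 2) = 0 := by
    linear_combination (x + y) ^ 2 * hx2 - (x + y) ^ 2 * hP2 +
      (2 * x * (x + y) + c * (x + y) + α ^ 2 * b * (P + Q)) * hcm - α ^ 2 * b * hbD
  have h2 : (x + c) ^ 2 = x' ^ 2 := by
    have := (mul_eq_zero.1 h1).resolve_left (by positivity)
    linarith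
  rcases sq_eq_sq_iff_eq_or_eq_neg.1 h2 with h | h
  · constructor <;> linarith
  -- In the case x + c = -x' one gets y - c = x + y + x', while conservation gives y' = x + y - x'.
  -- Equal squares would force (x + y) x' = 0.
  · have h3 : (x + y) ^ 2 * ((y - c) ^ 2 - y' ^ 2) = 0 := by
      linear_combination (x + y) ^ 2 * hy2 - (x + y) ^ 2 * hQ2 +
        (-2 * y * (x + y) + c * (x + y) + α ^ 2 * b * (P + Q)) * hcm - α ^ 2 * b * hbD
    have h4 : (y - c) ^ 2 = y' ^ 2 := by
      have := (mul_eq_zero.1 h3).resolve_left (by positivity)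
      linarith
    have h5 : (x + y + x') ^ 2 = (x + y - x') ^ 2 := by
      rw [show x + y - x' = y' by linarith, ← h4]; congr 1; linarith
    nlinarith [mul_pos he hP0]

lemma inner_self_of_norm_one {ω : Mom} (hω : ‖ω‖ = 1) : inner ℝ ω ω = (1 : ℝ) := by
  rw [real_inner_self_eq_norm_sq, hω, one_pow]

/-- A collision followed by the collision with the same parameter restores the momenta. -/
lemma transfer_post (α : ℝ) (p q : Mom) {ω : Mom} (hω : ‖ω‖ = 1) :
    transfer α (postP α p q ω) (postQ α p q ω) ω = -transfer α p q ω := by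
  obtain ⟨h1, h2⟩ := energy_post α p q hω
  have hD := collision_den_pos α p q hω
  have hx0 := energy_pos α p
  have hy0 := energy_pos α q
  have i1 : inner ℝ ω (postP α p q ω) = inner ℝ ω p + transfer α p q ω := by
    rw [postP, inner_add_right, real_inner_smul_right, inner_self_of_norm_one hω, mul_one]
  have i2 : inner ℝ ω (postQ α p q ω) = inner ℝ ω q - transfer α p q ω := by
    rw [postQ, inner_sub_right, real_inner_smul_right, inner_self_of_norm_one hω, mul_one]
  rw [transfer_eq α (postP α p q ω), h1, h2, i1, i2]
  have hb := transfer_eq α p q ω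
  have hc : energyTransfer α p q ω = α ^ 2 * transfer α p q ω * (inner ℝ ω p + inner ℝ ω q) /
    (energy α p + energy α q) := rfl
  generalize transfer α p q ω = b at *
  generalize energyTransfer α p q ω = c at *
  generalize energy α p = x at *
  generalize energy α q = y at *
  generalize inner ℝ ω p = P at *
  generalize inner ℝ ω q = Q at *
  have he : x + y ≠ 0 := by positivity
  have hcm : c * (x + y) = α ^ 2 * b * (P + Q) := by rw [hc, div_mul_cancel₀ _ he]
  have hbD : b * ((x + y) ^ 2 - α ^ 2 * (P + Q) ^ 2) = 2 * (x + y) * (x * Q - y * P) := by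
    rw [hb, div_mul_cancel₀ _ hD.ne']
  -- The denominator depends only on the conserved total energy and total momentum; only the
  -- numerator changes sign.
  have e1 : x + c + (y - c) = x + y := by ring
  have e2 : P + b + (Q - b) = P + Q := by ring
  rw [e1, e2, div_eq_iff hD.ne']
  linear_combination 2 * (P + Q) * hcm - hbD

lemma postP_post (α : ℝ) (p q : Mom) {ω : Mom} (hω : ‖ω‖ = 1) :
    postP α (postP α p q ω) (postQ α p q ω) ω = p := by
  rw [postP, transfer_post α p q hω, postP]; simp

lemma postQ_post (α : ℝ) (p q : Mom) {ω : Mom} (hω : ‖ω‖ = 1) :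
    postQ α (postP α p q ω) (postQ α p q ω) ω = q := by
  rw [postQ, transfer_post α p q hω, postQ]; simp

lemma transfer_swap (α : ℝ) (p q ω : Mom) : transfer α q p ω = -transfer α p q ω := by
  rw [transfer_eq, transfer_eq, ← neg_div, add_comm (energy α q), add_comm (inner ℝ ω q)]
  congr 1
  ring

lemma postP_swap (α : ℝ) (p q ω : Mom) : postP α q p ω = postQ α p q ω := by
  rw [postP, postQ, transfer_swap, neg_smul, sub_eq_add_neg]

lemma postQ_swap (α : ℝ) (p q ω : Mom) : postQ α q p ω = postP α p q ω := by
  rw [postP, postQ, transfer_swap, neg_smul, sub_neg_eq_add]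

/-- Since q'⁰ ≥ 1, p'⁰ ≤ p⁰ + q⁰ - 1. Squaring, and using (p⁰ - 1)(q⁰ - 1) ≤ α²|p||q|, gives a bound
free of α. Keeping the rest mass of the second particle is what removes the constant. -/
lemma norm_postP_le {α : ℝ} (hα : 0 < α) (p q : Mom) {ω : Mom} (hω : ‖ω‖ = 1) :
    ‖postP α p q ω‖ ≤ ‖p‖ + ‖q‖ := by
  have hsum := energy_conservation α p q ω hω
  have h1 := one_le_energy α (postQ α p q ω)
  have h2 := energy_sq α (postP α p q ω)
  have h3 := energy_pos α (postP α p q ω)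
  have hp := one_le_energy α p
  have hq := one_le_energy α q
  have hp2 := energy_sq α p
  have hq2 := energy_sq α q
  have h4 : (energy α p - 1) * (energy α q - 1) ≤ α ^ 2 * (‖p‖ * ‖q‖) := by
    have a1 : energy α p - 1 ≤ α * ‖p‖ := by
      have : energy α p ≤ 1 + α * ‖p‖ := Real.sqrt_le_iff.2
        ⟨by positivity, by nlinarith [mul_nonneg hα.le (norm_nonneg p)]⟩
      linarith
    have a2 : energy α q - 1 ≤ α * ‖q‖ := by
      have : energy α q ≤ 1 + α * ‖q‖ := Real.sqrt_le_iff.2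
        ⟨by positivity, by nlinarith [mul_nonneg hα.le (norm_nonneg q)]⟩
      linarith
    calc _ ≤ (α * ‖p‖) * (α * ‖q‖) := mul_le_mul a1 a2 (by linarith) (by positivity)
      _ = _ := by ring
  have h5 : energy α (postP α p q ω) ^ 2 ≤ (energy α p + energy α q - 1) ^ 2 :=
    pow_le_pow_left₀ h3.le (by linarith) 2
  have h6 : α ^ 2 * ‖postP α p q ω‖ ^ 2 ≤ α ^ 2 * (‖p‖ + ‖q‖) ^ 2 := by
    nlinarith
  exact le_of_sq_le_sq (le_of_mul_le_mul_left h6 (by positivity)) (by positivity)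

/-- The weight of the space of distribution functions. -/
def wt (p : Mom) : ℝ := √(1 + ‖p‖ ^ 2)

lemma wt_sq (p : Mom) : wt p ^ 2 = 1 + ‖p‖ ^ 2 := Real.sq_sqrt (by positivity)

lemma one_le_wt (p : Mom) : 1 ≤ wt p := Real.one_le_sqrt.2 (by nlinarith [sq_nonneg ‖p‖])

lemma wt_pos (p : Mom) : 0 < wt p := one_pos.trans_le (one_le_wt p)

@[fun_prop]
lemma continuous_wt : Continuous wt := by unfold wt; fun_prop

lemma wt_le_add {p q r : Mom} (h : ‖r‖ ≤ ‖p‖ + ‖q‖) : wt r ≤ wt p + wt q := by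
  refine Real.sqrt_le_iff.2 ⟨add_nonneg (wt_pos p).le (wt_pos q).le, ?_⟩
  have h1 : ‖p‖ * ‖q‖ ≤ wt p * wt q :=
    mul_le_mul (Real.le_sqrt_of_sq_le (by linarith)) (Real.le_sqrt_of_sq_le (by linarith))
      (norm_nonneg _) (wt_pos p).le
  nlinarith [wt_sq p, wt_sq q, norm_nonneg r, norm_nonneg p, norm_nonneg q]

lemma wt_postP_le {α : ℝ} (hα : 0 < α) (p q : Mom) {ω : Mom} (hω : ‖ω‖ = 1) :
    wt (postP α p q ω) ≤ wt p + wt q := wt_le_add (norm_postP_le hα p q hω)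

/-! ### The Jacobian of the collision map -/

lemma hasDerivAt_energy_line (α : ℝ) (p : Mom) {ω : Mom} (hω : ‖ω‖ = 1) :
    HasDerivAt (fun s : ℝ => energy α (p + s • ω)) (α ^ 2 * inner ℝ ω p / energy α p) 0 := by
  have h : (fun s : ℝ => energy α (p + s • ω)) =
      fun s => √(1 + α ^ 2 * (‖p‖ ^ 2 + 2 * s * inner ℝ ω p + s ^ 2)) := by
    ext s
    rw [energy, norm_add_sq_real, real_inner_smul_right, norm_smul, hω, real_inner_comm,
      mul_one, Real.norm_eq_abs, sq_abs]
    ring_nf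
  rw [h]
  have h1 : HasDerivAt (fun s : ℝ => 1 + α ^ 2 * (‖p‖ ^ 2 + 2 * s * inner ℝ ω p + s ^ 2))
      (α ^ 2 * (2 * inner ℝ ω p)) 0 := by
    have := ((((hasDerivAt_id (0 : ℝ)).const_mul 2).mul_const (inner ℝ ω p : ℝ)).const_add
      (‖p‖ ^ 2)).add ((hasDerivAt_id (0 : ℝ)).pow 2)
    have := (this.const_mul (α ^ 2)).const_add 1
    refine this.congr_deriv ?_
    simp
  have h2 := h1.sqrt (by simp; positivity)
  refine h2.congr_deriv ?_
  have := (energy_pos α p).ne'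
  simp only [energy, mul_zero, zero_mul, add_zero, ne_eq, OfNat.ofNat_ne_zero,
    not_false_eq_true, zero_pow] at this ⊢
  field_simp

/-- The collision map displaces (p, q) along the fixed vector (ω, -ω), so this single directional
derivative determines its Jacobian. -/
lemma hasDerivAt_transfer_line (α : ℝ) (p q : Mom) {ω : Mom} (hω : ‖ω‖ = 1) :
    HasDerivAt (fun s : ℝ => transfer α (p + s • ω) (q + s • (-ω)) ω)
      (-(energy α (postP α p q ω) * energy α (postQ α p q ω)) / (energy α p * energy α q) - 1)
      0 := by
  have hω' : ‖-ω‖ = 1 := by rwa [norm_neg]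
  have hx := hasDerivAt_energy_line α p hω
  have hy := hasDerivAt_energy_line α q hω'
  have hP : HasDerivAt (fun s : ℝ => (inner ℝ ω (p + s • ω) : ℝ)) 1 0 := by
    have : (fun s : ℝ => (inner ℝ ω (p + s • ω) : ℝ)) = fun s => inner ℝ ω p + s := by
      ext s; rw [inner_add_right, real_inner_smul_right, inner_self_of_norm_one hω, mul_one]
    rw [this]; exact (hasDerivAt_id _).const_add _
  have hQ : HasDerivAt (fun s : ℝ => (inner ℝ ω (q + s • (-ω)) : ℝ)) (-1) 0 := by
    have : (fun s : ℝ => (inner ℝ ω (q + s • (-ω)) : ℝ)) = fun s => inner ℝ ω q - s := by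
      ext s
      rw [inner_add_right, real_inner_smul_right, inner_neg_right, inner_self_of_norm_one hω]
      ring
    rw [this]; exact (hasDerivAt_id _).const_sub _
  simp_rw [transfer_eq]
  have hD := collision_den_pos α p q hω
  have key := ((((hx.add hy).const_mul 2).mul ((hx.mul hQ).sub (hy.mul hP))).div
    (((hx.add hy).pow 2).sub (((hP.add hQ).pow 2).const_mul (α ^ 2)))
      (by simpa using hD.ne'))
  refine key.congr_deriv ?_
  obtain ⟨h1, h2⟩ := energy_post α p q hω
  rw [h1, h2, energyTransfer, transfer_eq]
  simp only [zero_smul, add_zero, inner_neg_left, Pi.add_apply, Pi.mul_apply, Pi.sub_apply,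
    Pi.pow_apply]
  have hx0 := (energy_pos α p).ne'
  have hy0 := (energy_pos α q).ne'
  have he : energy α p + energy α q ≠ 0 := (add_pos (energy_pos α p) (energy_pos α q)).ne'
  have hD' := hD.ne'
  generalize energy α p = x at *
  generalize energy α q = y at *
  generalize inner ℝ ω p = P at *
  generalize inner ℝ ω q = Q at *
  field_simp
  ring

lemma differentiable_energy (α : ℝ) : Differentiable ℝ (energy α) := by
  intro p
  unfold energy
  refine DifferentiableAt.sqrt ?_ (by positivity)
  exact ((differentiableAt_id.norm_sq ℝ).const_mul _).const_add _

lemma differentiableAt_transfer (α : ℝ) {ω : Mom} (hω : ‖ω‖ = 1) (z : Mom × Mom) :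
    DifferentiableAt ℝ (fun z : Mom × Mom => transfer α z.1 z.2 ω) z := by
  simp_rw [transfer_eq]
  have hx : DifferentiableAt ℝ (fun z : Mom × Mom => energy α z.1) z :=
    (differentiable_energy α z.1).comp z differentiableAt_fst
  have hy : DifferentiableAt ℝ (fun z : Mom × Mom => energy α z.2) z :=
    (differentiable_energy α z.2).comp z differentiableAt_snd
  have hP : DifferentiableAt ℝ (fun z : Mom × Mom => (inner ℝ ω z.1 : ℝ)) z :=
    (differentiableAt_const ω).inner ℝ differentiableAt_fst
  have hQ : DifferentiableAt ℝ (fun z : Mom × Mom => (inner ℝ ω z.2 : ℝ)) z :=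
    (differentiableAt_const ω).inner ℝ differentiableAt_snd
  have hn : DifferentiableAt ℝ (fun z : Mom × Mom => 2 * (energy α z.1 + energy α z.2) *
      (energy α z.1 * inner ℝ ω z.2 - energy α z.2 * inner ℝ ω z.1)) z := by fun_prop
  have hd : DifferentiableAt ℝ (fun z : Mom × Mom => (energy α z.1 + energy α z.2) ^ 2 -
      α ^ 2 * (inner ℝ ω z.1 + inner ℝ ω z.2) ^ 2) z := by fun_prop
  simp only [div_eq_mul_inv]
  exact hn.mul (DifferentiableAt.inv hd (by exact (collision_den_pos α z.1 z.2 hω).ne'))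

/-- The collision map at a fixed collision parameter. -/
def collide (α : ℝ) (ω : Mom) (z : Mom × Mom) : Mom × Mom :=
  (postP α z.1 z.2 ω, postQ α z.1 z.2 ω)

lemma collide_collide (α : ℝ) {ω : Mom} (hω : ‖ω‖ = 1) (z : Mom × Mom) :
    collide α ω (collide α ω z) = z := by
  simp [collide, postP_post α _ _ hω, postQ_post α _ _ hω]

lemma collide_eq (α : ℝ) (ω : Mom) :
    collide α ω = fun z => z + transfer α z.1 z.2 ω • ((ω, -ω) : Mom × Mom) := by
  ext z : 1
  simp [collide, postP, postQ, Prod.ext_iff, sub_eq_add_neg]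

/-- The derivative of the collision map: a rank one perturbation of the identity. -/
def collideDeriv (α : ℝ) (ω : Mom) (z : Mom × Mom) : Mom × Mom →L[ℝ] Mom × Mom :=
  ContinuousLinearMap.id ℝ _ +
    (fderiv ℝ (fun z : Mom × Mom => transfer α z.1 z.2 ω) z).smulRight ((ω, -ω) : Mom × Mom)

lemma hasFDerivAt_collide (α : ℝ) {ω : Mom} (hω : ‖ω‖ = 1) (z : Mom × Mom) :
    HasFDerivAt (collide α ω) (collideDeriv α ω z) z := by
  rw [collide_eq]
  exact (hasFDerivAt_id z).add
    ((differentiableAt_transfer α hω z).hasFDerivAt.smul_const ((ω, -ω) : Mom × Mom))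

/-- The derivative is a rank one perturbation of the identity, so its determinant is 1 + D(ω, -ω),
with D the derivative of the transfer. -/
lemma det_collideDeriv (α : ℝ) {ω : Mom} (hω : ‖ω‖ = 1) (z : Mom × Mom) :
    (collideDeriv α ω z).det =
      -(energy α (postP α z.1 z.2 ω) * energy α (postQ α z.1 z.2 ω)) /
        (energy α z.1 * energy α z.2) := by
  set D := fderiv ℝ (fun z : Mom × Mom => transfer α z.1 z.2 ω) z with hD
  have h1 : (collideDeriv α ω z : Mom × Mom →ₗ[ℝ] Mom × Mom) =
      LinearMap.transvection (D : Mom × Mom →ₗ[ℝ] ℝ) ((ω, -ω) : Mom × Mom) := by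
    ext v <;> simp [collideDeriv, LinearMap.transvection.apply, hD]
  have h2 : HasDerivAt (fun s : ℝ => transfer α (z.1 + s • ω) (z.2 + s • (-ω)) ω)
      (D (ω, -ω)) 0 := by
    have hl : HasDerivAt (fun s : ℝ => z + s • ((ω, -ω) : Mom × Mom)) (ω, -ω) 0 := by
      simpa using ((hasDerivAt_id (0 : ℝ)).smul_const ((ω, -ω) : Mom × Mom)).const_add z
    have h0 : z = z + (0 : ℝ) • ((ω, -ω) : Mom × Mom) := by simp
    have hF : HasFDerivAt (fun z : Mom × Mom => transfer α z.1 z.2 ω) D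
        (z + (0 : ℝ) • ((ω, -ω) : Mom × Mom)) := by
      rw [← h0]; exact (differentiableAt_transfer α hω z).hasFDerivAt
    exact hF.comp_hasDerivAt (0 : ℝ) hl
  have h3 := h2.unique (hasDerivAt_transfer_line α z.1 z.2 hω)
  rw [ContinuousLinearMap.det, h1, LinearMap.transvection.det]
  simp only [ContinuousLinearMap.coe_coe, h3]
  ring

@[fun_prop]
lemma measurable_transfer_comp {X : Type*} [MeasurableSpace X] {α : X → ℝ} {p q ω : X → Mom}
    (hα : Measurable α) (hp : Measurable p) (hq : Measurable q) (hω : Measurable ω) :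
    Measurable fun x => transfer (α x) (p x) (q x) (ω x) := by
  simp_rw [transfer_eq]
  fun_prop

@[fun_prop]
lemma measurable_postP_comp {X : Type*} [MeasurableSpace X] {α : X → ℝ} {p q ω : X → Mom}
    (hα : Measurable α) (hp : Measurable p) (hq : Measurable q) (hω : Measurable ω) :
    Measurable fun x => postP (α x) (p x) (q x) (ω x) := by
  unfold postP; fun_prop

@[fun_prop]
lemma measurable_postQ_comp {X : Type*} [MeasurableSpace X] {α : X → ℝ} {p q ω : X → Mom}
    (hα : Measurable α) (hp : Measurable p) (hq : Measurable q) (hω : Measurable ω) :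
    Measurable fun x => postQ (α x) (p x) (q x) (ω x) := by
  unfold postQ; fun_prop

/-- The Lorentz invariant measure `dp / p⁰`. -/
def massShell (α : ℝ) : Measure Mom :=
  volume.withDensity fun p => ENNReal.ofReal (energy α p)⁻¹

instance (α : ℝ) : SigmaFinite (massShell α) := SigmaFinite.withDensity_ofReal _

lemma measurable_ofReal_energy_inv (α : ℝ) :
    Measurable fun p : Mom => ENNReal.ofReal (energy α p)⁻¹ := by fun_prop

/-- The collision map preserves the measure `dp dq / (p⁰ q⁰)`. -/
lemma measurePreserving_collide (α : ℝ) {ω : Mom} (hω : ‖ω‖ = 1) :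
    MeasurePreserving (collide α ω) ((massShell α).prod (massShell α))
      ((massShell α).prod (massShell α)) := by
  have hm : Measurable (collide α ω) := by unfold collide; fun_prop
  refine ⟨hm, Measure.ext_of_lintegral _ fun φ hφ => ?_⟩
  rw [lintegral_map hφ hm, massShell,
    prod_withDensity (measurable_ofReal_energy_inv α) (measurable_ofReal_energy_inv α)]
  have hw : Measurable fun z : Mom × Mom =>
      ENNReal.ofReal (energy α z.1)⁻¹ * ENNReal.ofReal (energy α z.2)⁻¹ := by fun_prop
  rw [lintegral_withDensity_eq_lintegral_mul _ hw (g := fun z => φ (collide α ω z)) (hφ.comp hm),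
    lintegral_withDensity_eq_lintegral_mul _ hw hφ]
  -- Being an involution, the map is a bijection of the whole space, so the change of variables
  -- loses nothing.
  have himg : collide α ω '' univ = univ :=
    image_univ_of_surjective (Function.Involutive.surjective (collide_collide α hω))
  have key := lintegral_image_eq_lintegral_abs_det_fderiv_mul
    ((volume : Measure Mom).prod (volume : Measure Mom)) MeasurableSet.univ
    (fun z _ => (hasFDerivAt_collide α hω z).hasFDerivWithinAt)
    ((Function.Involutive.injective (collide_collide α hω)).injOn)
    (fun z => ENNReal.ofReal (energy α z.1)⁻¹ * ENNReal.ofReal (energy α z.2)⁻¹ * φ z)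
  rw [himg] at key
  simp only [Measure.restrict_univ] at key
  simp only [Pi.mul_apply]
  rw [key]
  refine lintegral_congr fun z => ?_
  rw [← mul_assoc]
  congr 1
  have hx := energy_pos α z.1
  have hy := energy_pos α z.2
  have hx' := energy_pos α (postP α z.1 z.2 ω)
  have hy' := energy_pos α (postQ α z.1 z.2 ω)
  rw [det_collideDeriv α hω, ← ENNReal.ofReal_mul (by positivity),
    ← ENNReal.ofReal_mul (by simp only [collide]; positivity), ← ENNReal.ofReal_mul (by positivity)]
  congr 1
  simp only [collide]
  -- The Jacobian is negative; its absolute value p'⁰q'⁰/(p⁰q⁰) cancels exactly against the two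
  -- densities.
  rw [neg_div, abs_neg, abs_of_pos (by positivity)]
  field_simp

/-! ### The phase space of collisions -/

/-- The surface measure of the unit sphere. -/
abbrev sphMeas : Measure Sph := (volume : Measure Mom).toSphere

/-- The parameters `(p, q, ω)` of a collision. -/
abbrev Phase : Type := Mom × Mom × Sph

/-- The measure `dp dq dω / (p⁰ q⁰)`. -/
def phaseMeas (α : ℝ) : Measure Phase := (massShell α).prod ((massShell α).prod sphMeas)

lemma norm_sph (ω : Sph) : ‖(ω : Mom)‖ = 1 := by simp

/-- Passage from the state before to the state after the collision. -/
def phaseCollide (α : ℝ) (z : Phase) : Phase :=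
  (postP α z.1 z.2.1 z.2.2, postQ α z.1 z.2.1 z.2.2, z.2.2)

/-- Exchange of the colliding particles. -/
def phaseSwap (z : Phase) : Phase := (z.2.1, z.1, z.2.2)

@[fun_prop]
lemma measurable_phaseCollide (α : ℝ) : Measurable (phaseCollide α) := by
  unfold phaseCollide; fun_prop

@[fun_prop]
lemma measurable_phaseSwap : Measurable phaseSwap := by
  unfold phaseSwap; fun_prop

lemma phaseCollide_phaseCollide (α : ℝ) (z : Phase) :
    phaseCollide α (phaseCollide α z) = z := by
  simp [phaseCollide, postP_post α _ _ (norm_sph _), postQ_post α _ _ (norm_sph _)]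

lemma phaseSwap_phaseSwap (z : Phase) : phaseSwap (phaseSwap z) = z := rfl

/-- `(p, q, ω) ↦ ((p, q), ω)` -/
lemma measurePreserving_phaseAssoc (α : ℝ) :
    MeasurePreserving (MeasurableEquiv.prodAssoc.symm : Phase ≃ᵐ (Mom × Mom) × Sph)
      (phaseMeas α) (((massShell α).prod (massShell α)).prod sphMeas) :=
  (measurePreserving_prodAssoc (massShell α) (massShell α) sphMeas).symm

/-- The collision leaves ω unchanged and preserves the measure on each slice of fixed ω. Once ω is
moved to the first place, it is a skew product over the identity. -/
lemma measurePreserving_phaseCollide (α : ℝ) :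
    MeasurePreserving (phaseCollide α) (phaseMeas α) (phaseMeas α) := by
  have h1 : MeasurePreserving (fun w : Sph × (Mom × Mom) => (w.1, collide α w.1 w.2))
      (sphMeas.prod ((massShell α).prod (massShell α)))
      (sphMeas.prod ((massShell α).prod (massShell α))) := by
    refine (MeasurePreserving.id sphMeas).skew_product (g := fun ω z => collide α ω z) ?_
      (Eventually.of_forall fun ω => (measurePreserving_collide α (norm_sph ω)).map_eq)
    unfold collide Function.uncurry
    fun_prop
  have h2 := measurePreserving_phaseAssoc α
  have h3 : MeasurePreserving Prod.swap (((massShell α).prod (massShell α)).prod sphMeas)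
      (sphMeas.prod ((massShell α).prod (massShell α))) := Measure.measurePreserving_swap
  have h4 : MeasurePreserving Prod.swap (sphMeas.prod ((massShell α).prod (massShell α)))
      (((massShell α).prod (massShell α)).prod sphMeas) := Measure.measurePreserving_swap
  exact ((h2.symm.comp h4).comp (h1.comp (h3.comp h2)))

lemma measurePreserving_phaseSwap (α : ℝ) :
    MeasurePreserving phaseSwap (phaseMeas α) (phaseMeas α) := by
  have h2 := measurePreserving_phaseAssoc α
  have h3 : MeasurePreserving Prod.swap ((massShell α).prod (massShell α))
      ((massShell α).prod (massShell α)) := Measure.measurePreserving_swap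
  exact h2.symm.comp ((h3.prod (MeasurePreserving.id sphMeas)).comp h2)

/-- An involutive measure preserving map as an equivalence. -/
def involutionEquiv {X : Type*} [MeasurableSpace X] (T : X → X) (hT : Measurable T)
    (hTT : ∀ x, T (T x) = x) : X ≃ᵐ X where
  toFun := T
  invFun := T
  left_inv := hTT
  right_inv := hTT
  measurable_toFun := hT
  measurable_invFun := hT

/-- An involution is a measurable equivalence, so no regularity or integrability of Φ is needed. -/
lemma integral_phaseCollide (α : ℝ) (Φ : Phase → ℝ) :
    ∫ z, Φ (phaseCollide α z) ∂phaseMeas α = ∫ z, Φ z ∂phaseMeas α :=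
  (measurePreserving_phaseCollide α).integral_comp'
    (f := involutionEquiv _ (measurable_phaseCollide α) (phaseCollide_phaseCollide α)) Φ

lemma integral_phaseSwap (α : ℝ) (Φ : Phase → ℝ) :
    ∫ z, Φ (phaseSwap z) ∂phaseMeas α = ∫ z, Φ z ∂phaseMeas α :=
  (measurePreserving_phaseSwap α).integral_comp'
    (f := involutionEquiv _ measurable_phaseSwap phaseSwap_phaseSwap) Φ

lemma integrable_phaseCollide {α : ℝ} {Φ : Phase → ℝ} (h : Integrable Φ (phaseMeas α)) :
    Integrable (fun z => Φ (phaseCollide α z)) (phaseMeas α) :=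
  (measurePreserving_phaseCollide α).integrable_comp_of_integrable h

/-- The properties of a collision kernel at a given value of the expansion factor. -/
structure IsCrossSection (κ : Mom → Mom → Mom → Mom → ℝ) (C : ℝ) : Prop where
  measurable : Measurable fun x : Mom × Mom × Mom × Mom => κ x.1 x.2.1 x.2.2.1 x.2.2.2
  nonneg : ∀ p q p' q', 0 ≤ κ p q p' q'
  le : ∀ p q p' q', κ p q p' q' ≤ C
  symm_exchange : ∀ p q p' q', κ p q p' q' = κ q p q' p'
  symm_reverse : ∀ p q p' q', κ p q p' q' = κ p' q' p q

/-- The cross section as a function of the parameters of the collision. -/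
def crossSection (α : ℝ) (κ : Mom → Mom → Mom → Mom → ℝ) (z : Phase) : ℝ :=
  κ z.1 z.2.1 (postP α z.1 z.2.1 z.2.2) (postQ α z.1 z.2.1 z.2.2)

/-- The collision operator acting on densities of pairs of particles. -/
def pairCollision (α : ℝ) (κ : Mom → Mom → Mom → Mom → ℝ) (Ψ : Mom × Mom → ℝ) (p : Mom) : ℝ :=
  α ^ 3 * ∫ x : Mom × Sph, (Ψ (postP α p x.1 x.2, postQ α p x.1 x.2) - Ψ (p, x.1)) *
    crossSection α κ (p, x) ∂(massShell α).prod sphMeas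

/-! ### Weak form, conservation laws and bounds for the collision operator -/

section Bounds

variable {α C : ℝ} {κ : Mom → Mom → Mom → Mom → ℝ}

lemma IsCrossSection.measurable_crossSection (hκ : IsCrossSection κ C) (α : ℝ) :
    Measurable (crossSection α κ) := by
  have : Measurable fun z : Phase => (z.1, z.2.1, postP α z.1 z.2.1 z.2.2,
    postQ α z.1 z.2.1 z.2.2) := by fun_prop
  exact hκ.measurable.comp this

/-- Microreversibility: the same ω undoes the collision, and the kernel is symmetric under reversal.
-/
lemma IsCrossSection.crossSection_collide (hκ : IsCrossSection κ C) (z : Phase) :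
    crossSection α κ (phaseCollide α z) = crossSection α κ z := by
  simp only [crossSection, phaseCollide, postP_post α _ _ (norm_sph _),
    postQ_post α _ _ (norm_sph _)]
  exact (hκ.symm_reverse _ _ _ _).symm

lemma IsCrossSection.crossSection_swap (hκ : IsCrossSection κ C) (z : Phase) :
    crossSection α κ (phaseSwap z) = crossSection α κ z := by
  simp only [crossSection, phaseSwap]
  rw [postP_swap α z.1 z.2.1, postQ_swap α z.1 z.2.1]
  exact (hκ.symm_exchange _ _ _ _).symm

lemma IsCrossSection.abs_crossSection_le (hκ : IsCrossSection κ C) (z : Phase) :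
    |crossSection α κ z| ≤ C := by
  rw [crossSection, abs_of_nonneg (hκ.nonneg _ _ _ _)]; exact hκ.le _ _ _ _

lemma IsCrossSection.const_nonneg (hκ : IsCrossSection κ C) : 0 ≤ C :=
  (hκ.nonneg 0 0 0 0).trans (hκ.le 0 0 0 0)

/-- Pair densities with finite energy. -/
def PairIntegrable (α : ℝ) (Ψ : Mom × Mom → ℝ) : Prop :=
  Integrable (fun z : Mom × Mom => (wt z.1 + wt z.2) * |Ψ z|)
    ((massShell α).prod (massShell α))

lemma integrable_phase {G : Mom × Mom → ℝ}
    (hG : Integrable G ((massShell α).prod (massShell α))) :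
    Integrable (fun z : Phase => G (z.1, z.2.1)) (phaseMeas α) := by
  have h1 : Integrable (fun w : (Mom × Mom) × Sph => G w.1)
    (((massShell α).prod (massShell α)).prod sphMeas) := hG.comp_fst _
  exact (measurePreserving_phaseAssoc α).integrable_comp_of_integrable h1

lemma integral_phase (G : Mom × Mom → ℝ) :
    ∫ z : Phase, G (z.1, z.2.1) ∂phaseMeas α =
      sphMeas.real univ * ∫ z, G z ∂(massShell α).prod (massShell α) := by
  have h1 := (measurePreserving_phaseAssoc α).integral_comp'
    (g := fun w : (Mom × Mom) × Sph => G w.1)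
  have h2 : ∫ z : Phase, G (z.1, z.2.1) ∂phaseMeas α = ∫ w : (Mom × Mom) × Sph, G w.1
    ∂((massShell α).prod (massShell α)).prod sphMeas := h1
  rw [h2]
  have := integral_prod_mul (μ := (massShell α).prod (massShell α)) (ν := sphMeas) G
    (fun _ => (1 : ℝ))
  simp only [mul_one, integral_const, smul_eq_mul] at this
  rw [this, mul_comm]

/-- Weighted pair densities are integrable over the collisions. -/
lemma integrable_weight_mul (hκ : IsCrossSection κ C) {Ψ : Mom × Mom → ℝ}
    (hΨm : Measurable Ψ) (hΨ : PairIntegrable α Ψ) {φ : Phase → ℝ} (hφm : Measurable φ)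
    {c : ℝ} (hφ : ∀ z, |φ z| ≤ c * (wt z.1 + wt z.2.1)) :
    Integrable (fun z : Phase => φ z * Ψ (z.1, z.2.1) * crossSection α κ z) (phaseMeas α) := by
  have h0 : Integrable (fun z : Phase => (wt z.1 + wt z.2.1) * |Ψ (z.1, z.2.1)|) (phaseMeas α) :=
    integrable_phase (G := fun z => (wt z.1 + wt z.2) * |Ψ z|) hΨ
  have hk := hκ.measurable_crossSection α
  refine (h0.const_mul (c * C)).mono' (by fun_prop) (Eventually.of_forall fun z => ?_)
  rw [norm_mul, norm_mul, Real.norm_eq_abs, Real.norm_eq_abs, Real.norm_eq_abs]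
  have hw : 0 ≤ c * (wt z.1 + wt z.2.1) := (abs_nonneg _).trans (hφ z)
  calc |φ z| * |Ψ (z.1, z.2.1)| * |crossSection α κ z|
      ≤ (c * (wt z.1 + wt z.2.1)) * |Ψ (z.1, z.2.1)| * C := by
        gcongr
        · exact hφ z
        · exact hκ.abs_crossSection_le z
    _ = _ := by ring

lemma abs_post_le (hα : 0 < α) {φ : Mom → ℝ} {c : ℝ} (hφ : ∀ p, |φ p| ≤ c * wt p)
    (z : Phase) : |φ (postP α z.1 z.2.1 z.2.2)| ≤ c * (wt z.1 + wt z.2.1) := by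
  have hc : 0 ≤ c := by
    have := (abs_nonneg _).trans (hφ 0)
    exact nonneg_of_mul_nonneg_left this (wt_pos 0)
  exact (hφ _).trans (mul_le_mul_of_nonneg_left (wt_postP_le hα _ _ (norm_sph _)) hc)

lemma abs_pre_le {φ : Mom → ℝ} {c : ℝ} (hφ : ∀ p, |φ p| ≤ c * wt p)
    (z : Phase) : |φ z.1| ≤ c * (wt z.1 + wt z.2.1) := by
  have hc : 0 ≤ c := by
    have := (abs_nonneg _).trans (hφ 0)
    exact nonneg_of_mul_nonneg_left this (wt_pos 0)
  exact (hφ _).trans (mul_le_mul_of_nonneg_left (by linarith [wt_pos z.2.1]) hc)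

/-- The collision involution preserves the measure and the cross section, so it moves the
post-collisional momenta from the unknown density to the test function, where `wt_postP_le` controls
them. -/
lemma integrable_gain_weight (hα : 0 < α) (hκ : IsCrossSection κ C) {Ψ : Mom × Mom → ℝ}
    (hΨm : Measurable Ψ) (hΨ : PairIntegrable α Ψ) {φ : Mom → ℝ} (hφm : Measurable φ)
    {c : ℝ} (hφ : ∀ p, |φ p| ≤ c * wt p) :
    Integrable (fun z : Phase => φ z.1 * Ψ (postP α z.1 z.2.1 z.2.2, postQ α z.1 z.2.1 z.2.2) *
      crossSection α κ z) (phaseMeas α) ∧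
    ∫ z : Phase, φ z.1 * Ψ (postP α z.1 z.2.1 z.2.2, postQ α z.1 z.2.1 z.2.2) *
      crossSection α κ z ∂phaseMeas α =
    ∫ z : Phase, φ (postP α z.1 z.2.1 z.2.2) * Ψ (z.1, z.2.1) *
      crossSection α κ z ∂phaseMeas α := by
  have h := integrable_weight_mul hκ hΨm hΨ (φ := fun z => φ (postP α z.1 z.2.1 z.2.2))
    (by fun_prop) (abs_post_le hα hφ)
  have e : (fun z : Phase => φ z.1 * Ψ (postP α z.1 z.2.1 z.2.2, postQ α z.1 z.2.1 z.2.2) *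
      crossSection α κ z) = fun z => (fun z : Phase => φ (postP α z.1 z.2.1 z.2.2) *
        Ψ (z.1, z.2.1) * crossSection α κ z) (phaseCollide α z) := by
    ext z
    simp only [hκ.crossSection_collide]
    simp only [phaseCollide, postP_post α _ _ (norm_sph _)]
  rw [e]
  exact ⟨integrable_phaseCollide h, integral_phaseCollide α (fun z : Phase =>
    φ (postP α z.1 z.2.1 z.2.2) * Ψ (z.1, z.2.1) * crossSection α κ z)⟩

lemma integrable_loss_weight (hκ : IsCrossSection κ C) {Ψ : Mom × Mom → ℝ}
    (hΨm : Measurable Ψ) (hΨ : PairIntegrable α Ψ) {φ : Mom → ℝ} (hφm : Measurable φ)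
    {c : ℝ} (hφ : ∀ p, |φ p| ≤ c * wt p) :
    Integrable (fun z : Phase => φ z.1 * Ψ (z.1, z.2.1) * crossSection α κ z) (phaseMeas α) :=
  integrable_weight_mul hκ hΨm hΨ (φ := fun z => φ z.1) (by fun_prop) (abs_pre_le hφ)

/-- The weak form of the collision operator. -/
lemma pairCollision_weak (hα : 0 < α) (hκ : IsCrossSection κ C) {Ψ : Mom × Mom → ℝ}
    (hΨm : Measurable Ψ) (hΨ : PairIntegrable α Ψ) {φ : Mom → ℝ} (hφm : Measurable φ)
    {c : ℝ} (hφ : ∀ p, |φ p| ≤ c * wt p) :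
    Integrable (fun p => φ p * pairCollision α κ Ψ p) (massShell α) ∧
    ∫ p, φ p * pairCollision α κ Ψ p ∂massShell α =
      α ^ 3 * ∫ z : Phase, (φ (postP α z.1 z.2.1 z.2.2) - φ z.1) * Ψ (z.1, z.2.1) *
        crossSection α κ z ∂phaseMeas α := by
  obtain ⟨h1, h1'⟩ := integrable_gain_weight hα hκ hΨm hΨ hφm hφ
  have h2 := integrable_loss_weight hκ hΨm hΨ hφm hφ
  have h3 := h1.sub h2
  have e : (fun p => φ p * pairCollision α κ Ψ p) = fun p => α ^ 3 * ∫ x : Mom × Sph,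
      (φ p * Ψ (postP α p x.1 x.2, postQ α p x.1 x.2) * crossSection α κ (p, x) -
        φ p * Ψ (p, x.1) * crossSection α κ (p, x)) ∂(massShell α).prod sphMeas := by
    ext p
    rw [pairCollision, mul_left_comm, ← integral_const_mul]
    congr 2
    ext x
    ring
  rw [e]
  refine ⟨h3.integral_prod_left.const_mul _, ?_⟩
  rw [integral_const_mul]
  congr 1
  have h4 := integral_prod _ h3
  simp only [Pi.sub_apply] at h4
  rw [← h4, ← phaseMeas, integral_sub h1 h2, h1', ← integral_sub
    (integrable_weight_mul hκ hΨm hΨ (φ := fun z => φ (postP α z.1 z.2.1 z.2.2))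
    (by fun_prop) (abs_post_le hα hφ)) h2]
  congr 1
  ext z
  ring

lemma one_le_wt_bound (p : Mom) : |(1 : ℝ)| ≤ 1 * wt p := by simpa using one_le_wt p

/-- Conservation of the number of particles. -/
lemma integral_pairCollision (hα : 0 < α) (hκ : IsCrossSection κ C) {Ψ : Mom × Mom → ℝ}
    (hΨm : Measurable Ψ) (hΨ : PairIntegrable α Ψ) :
    ∫ p, pairCollision α κ Ψ p ∂massShell α = 0 := by
  have := (pairCollision_weak hα hκ hΨm hΨ (φ := fun _ => 1) measurable_const
    (one_le_wt_bound)).2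
  simpa using this

lemma energy_le_wt (hα : 0 ≤ α) (p : Mom) : |energy α p| ≤ (1 + α) * wt p := by
  rw [abs_of_pos (energy_pos α p)]
  refine Real.sqrt_le_iff.2 ⟨by have := wt_pos p; positivity, ?_⟩
  rw [mul_pow, wt_sq]
  nlinarith [sq_nonneg ‖p‖, mul_nonneg hα (sq_nonneg ‖p‖), sq_nonneg α]

/-- Conservation of energy. -/
lemma integral_energy_mul_pairCollision (hα : 0 < α) (hκ : IsCrossSection κ C)
    {Ψ : Mom × Mom → ℝ} (hΨm : Measurable Ψ) (hΨ : PairIntegrable α Ψ)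
    (hsymm : ∀ p q, Ψ (p, q) = Ψ (q, p)) :
    ∫ p, energy α p * pairCollision α κ Ψ p ∂massShell α = 0 := by
  rw [(pairCollision_weak hα hκ hΨm hΨ (φ := energy α) (by fun_prop) (energy_le_wt hα.le)).2]
  set H : Phase → ℝ := fun z => (energy α (postP α z.1 z.2.1 z.2.2) - energy α z.1) *
    Ψ (z.1, z.2.1) * crossSection α κ z with hH
  -- Exchanging the particles replaces p'⁰ - p⁰ by q'⁰ - q⁰, which is its negative by energy
  -- conservation. For a symmetric density the integral thus equals its own negative.
  have h1 : ∫ z, H (phaseSwap z) ∂phaseMeas α = ∫ z, H z ∂phaseMeas α := integral_phaseSwap α H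
  have h2 : (fun z => H (phaseSwap z)) = fun z => -H z := by
    ext z
    simp only [hH, hκ.crossSection_swap]
    simp only [phaseSwap]
    rw [postP_swap α z.1 z.2.1]
    have := energy_conservation α z.1 z.2.1 z.2.2 (norm_sph _)
    rw [hsymm z.2.1 z.1]
    linear_combination (Ψ (z.1, z.2.1) * crossSection α κ z) * this
  rw [h2, integral_neg] at h1
  have : ∫ z, H z ∂phaseMeas α = 0 := by linarith
  rw [this, mul_zero]

/-- Boundedness of the collision operator. -/
lemma integral_abs_pairCollision_le (hα : 0 < α) (hκ : IsCrossSection κ C) {Ψ : Mom × Mom → ℝ}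
    (hΨm : Measurable Ψ) (hΨ : PairIntegrable α Ψ) :
    ∫ p, wt p * |pairCollision α κ Ψ p| ∂massShell α ≤
      2 * α ^ 3 * C * sphMeas.real univ *
        ∫ z : Mom × Mom, (wt z.1 + wt z.2) * |Ψ z| ∂(massShell α).prod (massShell α) := by
  have hΨa : Measurable fun z => |Ψ z| := by fun_prop
  have hΨ' : PairIntegrable α (fun z => |Ψ z|) := by simpa [PairIntegrable] using hΨ
  have hφ : ∀ p, |wt p| ≤ 1 * wt p := fun p => by rw [abs_of_pos (wt_pos p), one_mul]
  have hwm : Measurable wt := continuous_wt.measurable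
  obtain ⟨h1, h1'⟩ := integrable_gain_weight hα hκ hΨa hΨ' hwm hφ
  have h2 := integrable_loss_weight hκ hΨa hΨ' hwm hφ
  have h3 := h1.add h2
  have hpost := (integrable_weight_mul hκ hΨa hΨ' (φ := fun z => wt (postP α z.1 z.2.1 z.2.2))
    (by fun_prop) (abs_post_le hα hφ))
  have step : ∀ᵐ p ∂massShell α, wt p * |pairCollision α κ Ψ p| ≤ α ^ 3 * ∫ x : Mom × Sph,
      (wt p * |Ψ (postP α p x.1 x.2, postQ α p x.1 x.2)| * crossSection α κ (p, x) +
        wt p * |Ψ (p, x.1)| * crossSection α κ (p, x)) ∂(massShell α).prod sphMeas := by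
    filter_upwards [h3.prod_right_ae] with p hp
    rw [pairCollision, abs_mul, abs_of_pos (by positivity : (0:ℝ) < α ^ 3), mul_left_comm]
    gcongr
    rw [← abs_of_pos (wt_pos p), ← abs_mul, ← integral_const_mul, abs_of_pos (wt_pos p)]
    refine abs_integral_le_integral_abs.trans ?_
    refine integral_mono_of_nonneg (Eventually.of_forall fun _ => abs_nonneg _) hp
      (Eventually.of_forall fun x => ?_)
    have k0 : 0 ≤ crossSection α κ (p, x) := hκ.nonneg _ _ _ _
    beta_reduce
    rw [abs_mul, abs_mul, abs_of_pos (wt_pos p), abs_of_nonneg k0, ← add_mul, ← mul_add,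
      ← mul_assoc]
    gcongr
    · exact (wt_pos p).le
    · exact abs_sub _ _
  have hint : Integrable (fun p => α ^ 3 * ∫ x : Mom × Sph,
      (wt p * |Ψ (postP α p x.1 x.2, postQ α p x.1 x.2)| * crossSection α κ (p, x) +
        wt p * |Ψ (p, x.1)| * crossSection α κ (p, x)) ∂(massShell α).prod sphMeas)
      (massShell α) := h3.integral_prod_left.const_mul _
  refine (integral_mono_of_nonneg (Eventually.of_forall fun p =>
    mul_nonneg (wt_pos p).le (abs_nonneg _)) hint step).trans ?_
  have h4 := integral_prod _ h3
  simp only [Pi.add_apply] at h4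
  rw [integral_const_mul, ← h4, ← phaseMeas, integral_add h1 h2, h1', ← integral_add hpost h2]
  have h5 := integrable_phase (G := fun z => (wt z.1 + wt z.2) * |Ψ z|) hΨ
  have h6 : ∫ z : Phase, (wt (postP α z.1 z.2.1 z.2.2) * |Ψ (z.1, z.2.1)| * crossSection α κ z +
      wt z.1 * |Ψ (z.1, z.2.1)| * crossSection α κ z) ∂phaseMeas α ≤
      ∫ z : Phase, 2 * C * ((wt z.1 + wt z.2.1) * |Ψ (z.1, z.2.1)|) ∂phaseMeas α := by
    refine integral_mono (hpost.add h2) (h5.const_mul _) fun z => ?_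
    have w1 := wt_postP_le hα z.1 z.2.1 (norm_sph z.2.2)
    have w2 := wt_pos z.2.1
    have k0 : 0 ≤ crossSection α κ z := hκ.nonneg _ _ _ _
    have k1 : crossSection α κ z ≤ C := hκ.le _ _ _ _
    have C0 := hκ.const_nonneg
    have hw := wt_pos z.1
    calc _ = (wt (postP α z.1 z.2.1 z.2.2) + wt z.1) * |Ψ (z.1, z.2.1)| *
          crossSection α κ z := by ring
      -- The factor 2 accounts for the gain weight w(p') and the loss weight w(p), each at most w(p)
      -- + w(q).
      _ ≤ (2 * (wt z.1 + wt z.2.1)) * |Ψ (z.1, z.2.1)| * C := by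
          gcongr
          linarith
      _ = _ := by ring
  rw [integral_const_mul, integral_phase (G := fun z => (wt z.1 + wt z.2) * |Ψ z|)] at h6
  calc _ ≤ α ^ 3 * (2 * C * (sphMeas.real univ *
      ∫ z : Mom × Mom, (wt z.1 + wt z.2) * |Ψ z| ∂(massShell α).prod (massShell α))) := by
        gcongr
    _ = _ := by ring

/-! ### Product densities -/

lemma massShell_le (α : ℝ) : massShell α ≤ volume := by
  rw [massShell]
  conv_rhs => rw [← withDensity_one (μ := (volume : Measure Mom))]
  refine withDensity_mono (Eventually.of_forall fun p => ?_)
  rw [Pi.one_apply, ← ENNReal.ofReal_one]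
  exact ENNReal.ofReal_le_ofReal (inv_le_one_of_one_le₀ (one_le_energy α p))

lemma volume_absolutelyContinuous_massShell (α : ℝ) :
    (volume : Measure Mom) ≪ massShell α :=
  withDensity_absolutelyContinuous' (measurable_ofReal_energy_inv α).aemeasurable
    (Eventually.of_forall fun p => by
      simpa using energy_pos α p)

lemma integral_massShell (α : ℝ) (h : Mom → ℝ) :
    ∫ p, h p ∂massShell α = ∫ p, h p / energy α p := by
  rw [massShell, integral_withDensity_eq_integral_toReal_smul (measurable_ofReal_energy_inv α)
    (Eventually.of_forall fun _ => ENNReal.ofReal_lt_top)]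
  refine integral_congr_ae (Eventually.of_forall fun p => ?_)
  beta_reduce
  rw [ENNReal.toReal_ofReal (inv_nonneg.2 (energy_pos α p).le), smul_eq_mul, div_eq_inv_mul]

lemma integrable_massShell_iff (α : ℝ) (h : Mom → ℝ) :
    Integrable h (massShell α) ↔ Integrable (fun p => h p / energy α p) := by
  rw [massShell, integrable_withDensity_iff_integrable_smul' (measurable_ofReal_energy_inv α)
    (Eventually.of_forall fun _ => ENNReal.ofReal_lt_top)]
  refine integrable_congr (Eventually.of_forall fun p => ?_)
  beta_reduce
  rw [ENNReal.toReal_ofReal (inv_nonneg.2 (energy_pos α p).le), smul_eq_mul, div_eq_inv_mul]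

/-- The norm of `L¹`. -/
def normL1 (h : Mom → ℝ) : ℝ := ∫ p, |h p|

lemma normL12_def (h : Mom → ℝ) : normL12 h = ∫ p, wt p * |h p| := rfl

lemma normL1_nonneg (h : Mom → ℝ) : 0 ≤ normL1 h := integral_nonneg fun _ => abs_nonneg _

lemma normL12_nonneg (h : Mom → ℝ) : 0 ≤ normL12 h :=
  integral_nonneg fun p => mul_nonneg (wt_pos p).le (abs_nonneg _)

lemma MemL12.weighted {h : Mom → ℝ} (hh : MemL12 h) : Integrable fun p => wt p * |h p| := hh.2

lemma memL12_of_measurable {h : Mom → ℝ} (hm : Measurable h)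
    (hi : Integrable fun p => wt p * |h p|) : MemL12 h := by
  refine ⟨hi.mono' hm.aestronglyMeasurable (Eventually.of_forall fun p => ?_), hi⟩
  rw [Real.norm_eq_abs]
  exact le_mul_of_one_le_left (abs_nonneg _) (one_le_wt p)

lemma normL1_le_normL12 {h : Mom → ℝ} (hh : MemL12 h) : normL1 h ≤ normL12 h :=
  integral_mono hh.1.abs hh.2 fun p => le_mul_of_one_le_left (abs_nonneg _) (one_le_wt p)

lemma MemL12.sub {f g : Mom → ℝ} (hf : MemL12 f) (hg : MemL12 g) :
    MemL12 fun p => f p - g p := by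
  refine ⟨hf.1.sub hg.1, ?_⟩
  have hm : AEStronglyMeasurable (fun p => √(1 + ‖p‖ ^ 2) * |f p - g p|)
      (volume : Measure Mom) :=
    (continuous_wt.aestronglyMeasurable).mul (hf.1.sub hg.1).aestronglyMeasurable.norm
  refine (hf.2.add hg.2).mono' hm (Eventually.of_forall fun p => ?_)
  rw [Real.norm_eq_abs, abs_of_nonneg (by positivity), Pi.add_apply, ← mul_add]
  exact mul_le_mul_of_nonneg_left (abs_sub _ _) (by positivity)

/-- The weight is a sum, so each term falls on one factor and leaves the other in plain L¹. Keeping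
the L¹ norms separate matters: that norm is conserved, which later makes the growth estimate linear.
-/
lemma pairIntegrable_mul {f g : Mom → ℝ} (hf : MemL12 f) (hg : MemL12 g) :
    PairIntegrable α (fun z => f z.1 * g z.2) ∧
    ∫ z : Mom × Mom, (wt z.1 + wt z.2) * |f z.1 * g z.2| ∂(massShell α).prod (massShell α) ≤
      normL12 f * normL1 g + normL1 f * normL12 g := by
  have a1 := hf.weighted.mono_measure (massShell_le α)
  have a2 := hg.weighted.mono_measure (massShell_le α)
  have b1 := hf.1.abs.mono_measure (massShell_le α)
  have b2 := hg.1.abs.mono_measure (massShell_le α)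
  have e : (fun z : Mom × Mom => (wt z.1 + wt z.2) * |f z.1 * g z.2|) =
      fun z => (wt z.1 * |f z.1|) * |g z.2| + |f z.1| * (wt z.2 * |g z.2|) := by
    ext z; rw [abs_mul]; ring
  have i1 := a1.mul_prod b2
  have i2 := b1.mul_prod a2
  have m {h : Mom → ℝ} (hh : Integrable h) (h0 : ∀ p, 0 ≤ h p) :
      ∫ p, h p ∂massShell α ≤ ∫ p, h p :=
    integral_mono_measure (massShell_le α) (Eventually.of_forall h0) hh
  have n {h : Mom → ℝ} (h0 : ∀ p, 0 ≤ h p) : 0 ≤ ∫ p, h p ∂massShell α := integral_nonneg h0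
  have pw (h : Mom → ℝ) (p : Mom) : 0 ≤ wt p * |h p| := mul_nonneg (wt_pos p).le (abs_nonneg _)
  refine ⟨by rw [PairIntegrable, e]; exact i1.add i2, ?_⟩
  rw [e, integral_add i1 i2, integral_prod_mul (fun p => wt p * |f p|) (fun p => |g p|),
    integral_prod_mul (fun p => |f p|) (fun p => wt p * |g p|)]
  refine add_le_add (mul_le_mul (m hf.2 (pw f)) (m hg.1.abs fun _ => abs_nonneg _)
    (n fun _ => abs_nonneg _) (normL12_nonneg f)) (mul_le_mul (m hf.1.abs fun _ => abs_nonneg _)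
      (m hg.2 (pw g)) (n (pw g)) (normL1_nonneg f))

/-- For almost every momentum, the two parts of the collision operator are absolutely
convergent integrals. -/
lemma collision_ae_eq (hα : 0 < α) (hκ : IsCrossSection κ C) {f g : Mom → ℝ}
    (hfm : Measurable f) (hgm : Measurable g) (hf : MemL12 f) (hg : MemL12 g) :
    collision (fun _ => κ) α f g =ᵐ[volume]
      pairCollision α κ (fun z => f z.1 * g z.2) := by
  -- Fubini yields integrable slices for almost every p with respect to dp/p⁰, which has the same
  -- null sets as Lebesgue measure.
  refine volume_absolutelyContinuous_massShell α |>.ae_le ?_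
  have hΨm : Measurable fun z : Mom × Mom => f z.1 * g z.2 := by fun_prop
  have hΨ := (pairIntegrable_mul (α := α) hf hg).1
  have i1 := (integrable_gain_weight hα hκ hΨm hΨ (φ := fun _ => 1) measurable_const
    one_le_wt_bound).1
  have i2 := integrable_loss_weight hκ hΨm hΨ (φ := fun _ => 1) measurable_const
    one_le_wt_bound
  filter_upwards [i1.prod_right_ae, i2.prod_right_ae] with p h1 h2
  simp only [one_mul, crossSection] at h1 h2
  have e (G : Mom × Sph → ℝ) (hG : Integrable G ((massShell α).prod sphMeas)) :
      ∫ q : Mom, α ^ 3 / energy α q * ∫ ω : Sph, G (q, ω) ∂sphMeas =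
        α ^ 3 * ∫ x, G x ∂(massShell α).prod sphMeas := by
    rw [integral_prod _ hG, integral_massShell, ← integral_const_mul]
    congr 1
    ext q
    ring
  have e1 := e _ h1
  have e2 := e _ h2
  rw [collision, gain, loss, e1, e2, ← mul_sub, ← integral_sub h1 h2, pairCollision]
  congr 2
  ext x
  simp only [crossSection]
  ring

/-- Linearity is claimed almost everywhere only: the integral is additive at those p where both
slices are integrable. -/
lemma pairCollision_sub (hα : 0 < α) (hκ : IsCrossSection κ C) {Ψ₁ Ψ₂ : Mom × Mom → ℝ}
    (h₁m : Measurable Ψ₁) (h₂m : Measurable Ψ₂) (h₁ : PairIntegrable α Ψ₁)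
    (h₂ : PairIntegrable α Ψ₂) :
    (fun p => pairCollision α κ Ψ₁ p - pairCollision α κ Ψ₂ p) =ᵐ[volume]
      pairCollision α κ (fun z => Ψ₁ z - Ψ₂ z) := by
  refine volume_absolutelyContinuous_massShell α |>.ae_le ?_
  have i {Ψ : Mom × Mom → ℝ} (hm : Measurable Ψ) (h : PairIntegrable α Ψ) :=
    ((integrable_gain_weight hα hκ hm h (φ := fun _ => 1) measurable_const
      one_le_wt_bound).1.sub (integrable_loss_weight hκ hm h (φ := fun _ => 1) measurable_const
        one_le_wt_bound)).prod_right_ae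
  filter_upwards [i h₁m h₁, i h₂m h₂] with p i1 i2
  simp only [one_mul, Pi.sub_apply, ← sub_mul] at i1 i2
  simp only [pairCollision]
  rw [← mul_sub, ← integral_sub i1 i2]
  congr 2
  ext x
  ring

/-- The right-hand side of the Boltzmann equation. -/
def source (α : ℝ) (κ : Mom → Mom → Mom → Mom → ℝ) (f : Mom → ℝ) (p : Mom) : ℝ :=
  collision (fun _ => κ) α f f p / energy α p

/-- The factor 1/p⁰ in the Boltzmann equation turns Lebesgue measure into dp/p⁰, the measure for
which the collision operator is balanced. The bound is the one that the a priori estimate uses. -/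
lemma source_weak (hα : 0 < α) (hκ : IsCrossSection κ C) {f : Mom → ℝ}
    (hfm : Measurable f) (hf : MemL12 f) :
    (Integrable fun p => wt p * |source α κ f p|) ∧ ∫ p, source α κ f p = 0 ∧
      ∫ p, energy α p * source α κ f p = 0 ∧
      normL12 (source α κ f) ≤ 4 * α ^ 3 * C * sphMeas.real univ * (normL12 f * normL1 f) := by
  have hΨm : Measurable fun z : Mom × Mom => f z.1 * f z.2 := by fun_prop
  obtain ⟨hΨ, hle⟩ := pairIntegrable_mul (α := α) hf hf
  have hae := collision_ae_eq hα hκ hfm hfm hf hf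
  have hs : source α κ f =ᵐ[volume]
      fun p => pairCollision α κ (fun z => f z.1 * f z.2) p / energy α p := by
    filter_upwards [hae] with p hp
    rw [source, hp]
  have hw := (pairCollision_weak hα hκ hΨm hΨ (φ := wt) continuous_wt.measurable (c := 1)
    (fun p => by rw [abs_of_pos (wt_pos p), one_mul])).1.abs
  have hw' := (integrable_massShell_iff α _).1 hw
  have hsw : (fun p => wt p * |source α κ f p|) =ᵐ[volume] fun p =>
      |wt p * pairCollision α κ (fun z => f z.1 * f z.2) p| / energy α p := by
    filter_upwards [hs] with p hp
    rw [hp, abs_mul, abs_div, abs_of_pos (wt_pos p), abs_of_pos (energy_pos α p), mul_div_assoc]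
  refine ⟨hw'.congr hsw.symm, ?_, ?_, ?_⟩
  · rw [integral_congr_ae hs, ← integral_massShell, integral_pairCollision hα hκ hΨm hΨ]
  · have : (fun p => energy α p * source α κ f p) =ᵐ[volume] fun p => (energy α p *
        pairCollision α κ (fun z => f z.1 * f z.2) p) / energy α p := by
      filter_upwards [hs] with p hp
      rw [hp, mul_div_assoc]
    rw [integral_congr_ae this, ← integral_massShell,
      integral_energy_mul_pairCollision hα hκ hΨm hΨ fun p q => mul_comm _ _]
  · rw [normL12_def, integral_congr_ae hsw, ← integral_massShell]
    have := integral_abs_pairCollision_le hα hκ hΨm hΨ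
    simp only [abs_mul, abs_of_pos (wt_pos _)] at this ⊢
    have C0 := hκ.const_nonneg
    simp only [← abs_mul] at this hle
    refine this.trans ((mul_le_mul_of_nonneg_left hle (by positivity)).trans (le_of_eq ?_))
    ring

/-- Lipschitz continuity of the right-hand side of the Boltzmann equation. -/
lemma source_sub_le (hα : 0 < α) (hκ : IsCrossSection κ C) {f g : Mom → ℝ}
    (hfm : Measurable f) (hf : MemL12 f) (hgm : Measurable g) (hg : MemL12 g) :
    normL12 (fun p => source α κ f p - source α κ g p) ≤
      4 * α ^ 3 * C * sphMeas.real univ *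
        ((normL12 f + normL12 g) * normL12 fun p => f p - g p) := by
  have hfΨ : Measurable fun z : Mom × Mom => f z.1 * f z.2 := by fun_prop
  have hgΨ : Measurable fun z : Mom × Mom => g z.1 * g z.2 := by fun_prop
  have hΨm : Measurable fun z : Mom × Mom => f z.1 * f z.2 - g z.1 * g z.2 := by fun_prop
  have hff := (pairIntegrable_mul (α := α) hf hf).1
  have hgg := (pairIntegrable_mul (α := α) hg hg).1
  have hfg := hf.sub hg
  -- Bilinearity: f⊗f - g⊗g = (f - g)⊗f + g⊗(f - g).
  obtain ⟨i1, l1⟩ := pairIntegrable_mul (α := α) hfg hf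
  obtain ⟨i2, l2⟩ := pairIntegrable_mul (α := α) hg hfg
  have hpt (z : Mom × Mom) : (wt z.1 + wt z.2) * |f z.1 * f z.2 - g z.1 * g z.2| ≤
      (wt z.1 + wt z.2) * |(f z.1 - g z.1) * f z.2| +
      (wt z.1 + wt z.2) * |g z.1 * (f z.2 - g z.2)| := by
    rw [← mul_add]
    refine mul_le_mul_of_nonneg_left ?_ (add_nonneg (wt_pos _).le (wt_pos _).le)
    refine le_trans (le_of_eq ?_) (abs_add_le _ _)
    congr 1; ring
  have hΨ : PairIntegrable α (fun z : Mom × Mom => f z.1 * f z.2 - g z.1 * g z.2) := by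
    refine (i1.add i2).mono' (by fun_prop) (Eventually.of_forall fun z => ?_)
    rw [Real.norm_eq_abs, abs_of_nonneg (mul_nonneg (add_nonneg (wt_pos _).le (wt_pos _).le)
      (abs_nonneg _))]
    exact hpt z
  have hs : (fun p => wt p * |source α κ f p - source α κ g p|) =ᵐ[volume] fun p =>
      wt p * |pairCollision α κ (fun z => f z.1 * f z.2 - g z.1 * g z.2) p| / energy α p := by
    filter_upwards [collision_ae_eq hα hκ hfm hfm hf hf, collision_ae_eq hα hκ hgm hgm hg hg,
      pairCollision_sub hα hκ hfΨ hgΨ hff hgg] with p h1 h2 h3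
    rw [source, source, h1, h2, ← h3, ← sub_div, abs_div, abs_of_pos (energy_pos α p),
      mul_div_assoc]
  rw [normL12_def, integral_congr_ae hs, ← integral_massShell]
  have C0 := hκ.const_nonneg
  refine (integral_abs_pairCollision_le hα hκ hΨm hΨ).trans ?_
  have hle := (integral_mono hΨ (i1.add i2) hpt).trans_eq (integral_add i1 i2)
  have hle2 := hle.trans (add_le_add l1 l2)
  refine (mul_le_mul_of_nonneg_left hle2 (by positivity)).trans ?_
  have n1 := normL1_le_normL12 hf
  have n2 := normL1_le_normL12 hg
  have n3 := normL1_le_normL12 hfg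
  have z1 := normL12_nonneg f
  have z2 := normL12_nonneg g
  have z3 := normL12_nonneg fun p => f p - g p
  have hK : 0 ≤ 2 * α ^ 3 * C * sphMeas.real univ := by positivity
  calc _ ≤ 2 * α ^ 3 * C * sphMeas.real univ *
      ((normL12 fun p => f p - g p) * normL12 f + (normL12 fun p => f p - g p) * normL12 f +
        (normL12 g * (normL12 fun p => f p - g p) +
          normL12 g * normL12 fun p => f p - g p)) := by
        gcongr
    _ = _ := by ring

end Bounds

/-! ### Evolution equations in `L¹` with a Lipschitz right-hand side -/

section Evolution

variable {E : Type*} [MeasurableSpace E]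

/-- A bounded, Lipschitz continuous right-hand side of an evolution equation in `L¹(ν)` on
`[a₀, ∞)`. -/
structure IsLipschitzRHS (S : ℝ → (E → ℝ) → E → ℝ) (ν : Measure E) (a₀ K B : ℝ) : Prop where
  measurable : ∀ F : ℝ → E → ℝ, Measurable (Function.uncurry F) →
    Measurable (Function.uncurry fun s => S s (F s))
  integrable : ∀ s, a₀ < s → ∀ u, Measurable u → Integrable u ν → Integrable (S s u) ν
  bounded : ∀ s, a₀ < s → ∀ u, Measurable u → Integrable u ν → ∫ y, |S s u y| ∂ν ≤ B
  lipschitz : ∀ s, a₀ < s → ∀ u v, Measurable u → Integrable u ν → Measurable v →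
    Integrable v ν → ∫ y, |S s u y - S s v y| ∂ν ≤ K * ∫ y, |u y - v y| ∂ν

/-- A solution of `dF/ds = S s (F s)`, `F a₀ = u₀`, in integrated form. -/
structure IsMildSolution (S : ℝ → (E → ℝ) → E → ℝ) (ν : Measure E) (a₀ : ℝ) (u₀ : E → ℝ)
    (F : ℝ → E → ℝ) : Prop where
  measurable : Measurable (Function.uncurry F)
  integrable : ∀ s, a₀ ≤ s → Integrable (F s) ν
  eq : ∀ᵐ y ∂ν, ∀ s, a₀ ≤ s → F s y = u₀ y + ∫ r in Ioc a₀ s, S r (F r) y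

/-- One step of the Picard iteration. -/
def picardStep (S : ℝ → (E → ℝ) → E → ℝ) (a₀ : ℝ) (u₀ : E → ℝ) (F : ℝ → E → ℝ) (s : ℝ) (y : E) :
    ℝ := u₀ y + ∫ r in Ioc a₀ s, S r (F r) y

/-- The exponentially weighted measure of the half-line. -/
def expMeas (a₀ lam : ℝ) : Measure ℝ :=
  (volume.restrict (Ioi a₀)).withDensity fun s => ENNReal.ofReal (Real.exp (-lam * s))

variable {S : ℝ → (E → ℝ) → E → ℝ} {ν : Measure E} {a₀ K B lam : ℝ} {u₀ : E → ℝ}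

instance : SigmaFinite (expMeas a₀ lam) := SigmaFinite.withDensity_ofReal _

lemma measurable_expWeight (lam : ℝ) :
    Measurable fun s : ℝ => ENNReal.ofReal (Real.exp (-lam * s)) := by fun_prop

lemma ae_expMeas_iff {p : ℝ → Prop} :
    (∀ᵐ s ∂expMeas a₀ lam, p s) ↔ ∀ᵐ s ∂volume.restrict (Ioi a₀), p s := by
  constructor
  · intro h
    exact (withDensity_absolutelyContinuous' (measurable_expWeight lam).aemeasurable
      (Eventually.of_forall fun s => by simp [Real.exp_pos])).ae_le h
  · intro h
    exact (withDensity_absolutelyContinuous _ _).ae_le h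

lemma lintegral_Ici_exp (hlam : 0 < lam) (r : ℝ) :
    ∫⁻ s in Ici r, ENNReal.ofReal (Real.exp (-lam * s)) =
      ENNReal.ofReal (Real.exp (-lam * r) / lam) := by
  rw [setLIntegral_congr Ioi_ae_eq_Ici.symm,
    ← ofReal_integral_eq_lintegral_ofReal (integrableOn_exp_mul_Ioi (by linarith) r)
      (Eventually.of_forall fun _ => (Real.exp_pos _).le), integral_exp_mul_Ioi (by linarith)]
  congr 1
  field_simp

/-- By Tonelli, d(r) is weighted by the mass of [r, ∞), which is e^(-λr)/λ. Integration in time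
therefore gains a factor 1/λ on the whole half-line at once. -/
lemma lintegral_expMeas_Ioc (hlam : 0 < lam) {d : ℝ → ENNReal} (hd : Measurable d) :
    ∫⁻ s, (∫⁻ r in Ioc a₀ s, d r) ∂expMeas a₀ lam =
      ENNReal.ofReal lam⁻¹ * ∫⁻ r, d r ∂expMeas a₀ lam := by
  have hset : MeasurableSet {z : ℝ × ℝ | a₀ < z.2 ∧ z.2 ≤ z.1} :=
    (measurableSet_lt measurable_const measurable_snd).inter
      (measurableSet_le measurable_snd measurable_fst)
  have hG : Measurable fun z : ℝ × ℝ => {z : ℝ × ℝ | a₀ < z.2 ∧ z.2 ≤ z.1}.indicator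
      (fun z => d z.2) z := (hd.comp measurable_snd).indicator hset
  have e1 (s : ℝ) : ∫⁻ r in Ioc a₀ s, d r =
      ∫⁻ r, {z : ℝ × ℝ | a₀ < z.2 ∧ z.2 ≤ z.1}.indicator (fun z => d z.2) (s, r) := by
    rw [← lintegral_indicator measurableSet_Ioc]
    rfl
  simp_rw [e1]
  rw [lintegral_lintegral_swap hG.aemeasurable]
  have e2 (r : ℝ) : ∫⁻ s, {z : ℝ × ℝ | a₀ < z.2 ∧ z.2 ≤ z.1}.indicator (fun z => d z.2) (s, r)
      ∂expMeas a₀ lam = (Ioi a₀).indicator (fun r => ENNReal.ofReal lam⁻¹ *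
        (ENNReal.ofReal (Real.exp (-lam * r)) * d r)) r := by
    by_cases hr : a₀ < r
    · have : (fun s => {z : ℝ × ℝ | a₀ < z.2 ∧ z.2 ≤ z.1}.indicator (fun z => d z.2) (s, r)) =
          (Ici r).indicator fun _ => d r := by
        ext s
        by_cases hs : r ≤ s <;> simp [indicator, hr, hs]
      rw [this, lintegral_indicator_const measurableSet_Ici,
        expMeas, withDensity_apply _ measurableSet_Ici, Measure.restrict_restrict measurableSet_Ici,
        inter_eq_left.2 (Ici_subset_Ioi.2 hr), lintegral_Ici_exp hlam,
        indicator_of_mem (show r ∈ Ioi a₀ from hr), div_eq_inv_mul,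
        ENNReal.ofReal_mul (by positivity)]
      ring
    · have : (fun s => {z : ℝ × ℝ | a₀ < z.2 ∧ z.2 ≤ z.1}.indicator (fun z => d z.2) (s, r)) =
          fun _ => 0 := by
        ext s
        simp [indicator, hr]
      rw [this, lintegral_zero, indicator_of_notMem (show r ∉ Ioi a₀ from hr)]
  simp_rw [e2]
  rw [lintegral_indicator measurableSet_Ioi, lintegral_const_mul _ (by fun_prop), expMeas,
    lintegral_withDensity_eq_lintegral_mul _ (measurable_expWeight lam) hd]
  rfl

lemma isFiniteMeasure_expMeas (hlam : 0 < lam) : IsFiniteMeasure (expMeas a₀ lam) := by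
  constructor
  rw [expMeas, withDensity_apply _ MeasurableSet.univ, Measure.restrict_univ,
    setLIntegral_congr Ioi_ae_eq_Ici, lintegral_Ici_exp hlam]
  exact ENNReal.ofReal_lt_top

/-- Curves along which the right-hand side can be evaluated. -/
def IsAdmissible (ν : Measure E) (a₀ : ℝ) (F : ℝ → E → ℝ) : Prop :=
  Measurable (Function.uncurry F) ∧ ∀ᵐ s ∂volume.restrict (Ioi a₀), Integrable (F s) ν

lemma IsMildSolution.isAdmissible {F : ℝ → E → ℝ} (hF : IsMildSolution S ν a₀ u₀ F) :
    IsAdmissible ν a₀ F :=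
  ⟨hF.measurable, (ae_restrict_mem measurableSet_Ioi).mono fun s hs => hF.integrable s (le_of_lt hs)⟩

/-- The moving domain of integration is absorbed into an indicator on the product space. -/
lemma measurable_setIntegral_Ioc {G : ℝ × E → ℝ} (hG : Measurable G) (a₀ : ℝ) :
    Measurable fun z : ℝ × E => ∫ r in Ioc a₀ z.1, G (r, z.2) := by
  have e (z : ℝ × E) : ∫ r in Ioc a₀ z.1, G (r, z.2) =
      ∫ r, {w : (ℝ × E) × ℝ | a₀ < w.2 ∧ w.2 ≤ w.1.1}.indicator
        (fun w => G (w.2, w.1.2)) (z, r) := by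
    rw [← integral_indicator measurableSet_Ioc]
    rfl
  simp_rw [e]
  have hset : MeasurableSet {w : (ℝ × E) × ℝ | a₀ < w.2 ∧ w.2 ≤ w.1.1} :=
    (measurableSet_lt measurable_const measurable_snd).inter
      (measurableSet_le measurable_snd measurable_fst.fst)
  have hG' : Measurable fun w : (ℝ × E) × ℝ => G (w.2, w.1.2) := by fun_prop
  exact (hG'.indicator hset).stronglyMeasurable.integral_prod_right'.measurable

lemma measurable_picardStep (hS : IsLipschitzRHS S ν a₀ K B) (hu₀ : Measurable u₀)
    {F : ℝ → E → ℝ} (hF : Measurable (Function.uncurry F)) :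
    Measurable (Function.uncurry (picardStep S a₀ u₀ F)) := by
  have h := measurable_setIntegral_Ioc (hS.measurable F hF) a₀
  exact (hu₀.comp measurable_snd).add h

variable [SigmaFinite ν]

lemma IsAdmissible.of_integrable {G : ℝ × E → ℝ} (hm : Measurable G)
    (hG : Integrable G ((expMeas a₀ lam).prod ν)) : IsAdmissible ν a₀ fun s y => G (s, y) :=
  ⟨hm, ae_expMeas_iff.1 hG.prod_right_ae⟩

lemma IsLipschitzRHS.integrable_prod (hS : IsLipschitzRHS S ν a₀ K B) {F : ℝ → E → ℝ}
    (hF : IsAdmissible ν a₀ F) (b : ℝ) :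
    Integrable (Function.uncurry fun s => S s (F s)) ((volume.restrict (Ioc a₀ b)).prod ν) := by
  have hm := hS.measurable F hF.1
  have hae : ∀ᵐ s ∂volume.restrict (Ioc a₀ b), Integrable (F s) ν :=
    ae_restrict_of_ae_restrict_of_subset Ioc_subset_Ioi_self hF.2
  have hmem : ∀ᵐ s ∂volume.restrict (Ioc a₀ b), s ∈ Ioc a₀ b := ae_restrict_mem measurableSet_Ioc
  have hsl (s : ℝ) : Measurable (F s) := hF.1.comp measurable_prodMk_left
  rw [integrable_prod_iff hm.aestronglyMeasurable]
  constructor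
  · filter_upwards [hae, hmem] with s h1 h2
    exact hS.integrable s h2.1 _ (hsl s) h1
  · have : IsFiniteMeasure (volume.restrict (Ioc a₀ b)) := ⟨by simp⟩
    refine Integrable.of_bound (C := B)
      hm.norm.stronglyMeasurable.integral_prod_right'.aestronglyMeasurable ?_
    filter_upwards [hae, hmem] with s h1 h2
    rw [Real.norm_eq_abs, abs_of_nonneg (integral_nonneg fun _ => norm_nonneg _)]
    exact hS.bounded s h2.1 _ (hsl s) h1

/-- The exceptional null set must not depend on s; integer endpoints suffice to exhaust the
half-line. -/
lemma IsLipschitzRHS.ae_integrableOn (hS : IsLipschitzRHS S ν a₀ K B) {F : ℝ → E → ℝ}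
    (hF : IsAdmissible ν a₀ F) :
    ∀ᵐ y ∂ν, ∀ s, IntegrableOn (fun r => S r (F r) y) (Ioc a₀ s) := by
  have h : ∀ n : ℕ, ∀ᵐ y ∂ν, IntegrableOn (fun r => S r (F r) y) (Ioc a₀ n) := fun n =>
    (hS.integrable_prod hF n).prod_left_ae
  filter_upwards [ae_all_iff.2 h] with y hy s
  obtain ⟨n, hn⟩ := exists_nat_ge s
  exact (hy n).mono_set (Ioc_subset_Ioc_right hn)

/-- Integration in time is a contraction for the exponentially weighted measure. -/
lemma lintegral_setLIntegral_Ioc (hlam : 0 < lam) {D : ℝ × E → ℝ} (hD : Measurable D) :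
    ∫⁻ z, (∫⁻ r in Ioc a₀ z.1, ‖D (r, z.2)‖ₑ) ∂(expMeas a₀ lam).prod ν =
      ENNReal.ofReal lam⁻¹ * ∫⁻ r, ∫⁻ y, ‖D (r, y)‖ₑ ∂ν ∂expMeas a₀ lam := by
  have hm : Measurable fun z : ℝ × E => ∫⁻ r in Ioc a₀ z.1, ‖D (r, z.2)‖ₑ := by
    have e (z : ℝ × E) : ∫⁻ r in Ioc a₀ z.1, ‖D (r, z.2)‖ₑ =
        ∫⁻ r, {w : (ℝ × E) × ℝ | a₀ < w.2 ∧ w.2 ≤ w.1.1}.indicator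
          (fun w => ‖D (w.2, w.1.2)‖ₑ) (z, r) := by
      rw [← lintegral_indicator measurableSet_Ioc]
      rfl
    simp_rw [e]
    have hset : MeasurableSet {w : (ℝ × E) × ℝ | a₀ < w.2 ∧ w.2 ≤ w.1.1} :=
      (measurableSet_lt measurable_const measurable_snd).inter
        (measurableSet_le measurable_snd measurable_fst.fst)
    have hG' : Measurable fun w : (ℝ × E) × ℝ => ‖D (w.2, w.1.2)‖ₑ := by fun_prop
    exact (hG'.indicator hset).lintegral_prod_right'
  rw [lintegral_prod _ hm.aemeasurable, ← lintegral_expMeas_Ioc hlam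
    (hD.enorm.lintegral_prod_right')]
  refine lintegral_congr fun s => ?_
  have hsw : Measurable (Function.uncurry fun (y : E) (r : ℝ) => ‖D (r, y)‖ₑ) :=
    (hD.comp measurable_swap).enorm
  exact lintegral_lintegral_swap (μ := ν) (ν := volume.restrict (Ioc a₀ s))
    (f := fun y r => ‖D (r, y)‖ₑ) hsw.aemeasurable

lemma integrable_picardStep (hS : IsLipschitzRHS S ν a₀ K B) (hlam : 0 < lam)
    (hu₀ : Integrable u₀ ν) {F : ℝ → E → ℝ} (hF : IsAdmissible ν a₀ F) :
    Integrable (Function.uncurry (picardStep S a₀ u₀ F)) ((expMeas a₀ lam).prod ν) := by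
  have := isFiniteMeasure_expMeas (a₀ := a₀) hlam
  have hm := hS.measurable F hF.1
  refine Integrable.add (f := fun z : ℝ × E => u₀ z.2)
    (g := fun z : ℝ × E => ∫ r in Ioc a₀ z.1, S r (F r) z.2) (hu₀.comp_snd _) ?_
  refine ⟨(measurable_setIntegral_Ioc hm a₀).aestronglyMeasurable, ?_⟩
  refine (lintegral_mono fun z => enorm_integral_le_lintegral_enorm _).trans_lt ?_
  have hlin := lintegral_setLIntegral_Ioc (ν := ν) (a₀ := a₀) hlam hm
  simp only [Function.uncurry_apply_pair] at hlin
  rw [hlin]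
  refine ENNReal.mul_lt_top ENNReal.ofReal_lt_top ?_
  have hle : ∫⁻ r, ∫⁻ y, ‖S r (F r) y‖ₑ ∂ν ∂expMeas a₀ lam ≤
      ∫⁻ _, ENNReal.ofReal B ∂expMeas a₀ lam := by
    refine lintegral_mono_ae (ae_expMeas_iff.2 ?_)
    filter_upwards [hF.2, ae_restrict_mem measurableSet_Ioi] with r h1 h2
    have hsl : Measurable (F r) := hF.1.comp measurable_prodMk_left
    rw [← ofReal_integral_norm_eq_lintegral_enorm (hS.integrable r h2 _ hsl h1)]
    exact ENNReal.ofReal_le_ofReal (hS.bounded r h2 _ hsl h1)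
  refine hle.trans_lt ?_
  rw [lintegral_const]
  exact ENNReal.mul_lt_top ENNReal.ofReal_lt_top (measure_lt_top _ _)

/-- The Lipschitz constant K of the right-hand side meets the gain 1/λ of time integration, so the
Picard step is a contraction once λ > K. -/
lemma edist_picardStep_le (hS : IsLipschitzRHS S ν a₀ K B) (hK : 0 ≤ K)
    (hlam : 0 < lam) {F G : ℝ → E → ℝ}
    (hF : IsAdmissible ν a₀ F) (hG : IsAdmissible ν a₀ G) :
    ∫⁻ z, ‖picardStep S a₀ u₀ F z.1 z.2 - picardStep S a₀ u₀ G z.1 z.2‖ₑ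
      ∂(expMeas a₀ lam).prod ν ≤
      ENNReal.ofReal (lam⁻¹ * K) * ∫⁻ z, ‖F z.1 z.2 - G z.1 z.2‖ₑ ∂(expMeas a₀ lam).prod ν := by
  have hmF := hS.measurable F hF.1
  have hmG := hS.measurable G hG.1
  have hF1 := hF.1
  have hG1 := hG.1
  simp only [Function.uncurry_def] at hmF hmG hF1 hG1
  have hae : ∀ᵐ z ∂(expMeas a₀ lam).prod ν,
      (∀ s, IntegrableOn (fun r => S r (F r) z.2) (Ioc a₀ s)) ∧
      (∀ s, IntegrableOn (fun r => S r (G r) z.2) (Ioc a₀ s)) :=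
    Measure.quasiMeasurePreserving_snd.ae
      ((hS.ae_integrableOn hF).and (hS.ae_integrableOn hG))
  calc _ ≤ ∫⁻ z, (∫⁻ r in Ioc a₀ z.1, ‖S r (F r) z.2 - S r (G r) z.2‖ₑ)
        ∂(expMeas a₀ lam).prod ν := by
        refine lintegral_mono_ae ?_
        filter_upwards [hae] with z hz
        rw [picardStep, picardStep, add_sub_add_left_eq_sub, ← integral_sub (hz.1 _) (hz.2 _)]
        exact enorm_integral_le_lintegral_enorm _
    _ = ENNReal.ofReal lam⁻¹ * ∫⁻ r, ∫⁻ y, ‖S r (F r) y - S r (G r) y‖ₑ ∂ν ∂expMeas a₀ lam :=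
        lintegral_setLIntegral_Ioc (D := fun z => S z.1 (F z.1) z.2 - S z.1 (G z.1) z.2) hlam
          (hmF.sub hmG)
    _ ≤ ENNReal.ofReal lam⁻¹ * ∫⁻ r, ENNReal.ofReal K * ∫⁻ y, ‖F r y - G r y‖ₑ ∂ν
          ∂expMeas a₀ lam := by
        refine mul_le_mul_right (lintegral_mono_ae (ae_expMeas_iff.2 ?_)) _
        filter_upwards [hF.2, hG.2, ae_restrict_mem measurableSet_Ioi] with r h1 h2 h3
        have hsF : Measurable (F r) := hF.1.comp measurable_prodMk_left
        have hsG : Measurable (G r) := hG.1.comp measurable_prodMk_left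
        have e1 := ofReal_integral_norm_eq_lintegral_enorm ((hS.integrable r h3 _ hsF h1).sub
          (hS.integrable r h3 _ hsG h2))
        have e2 := ofReal_integral_norm_eq_lintegral_enorm (h1.sub h2)
        simp only [Pi.sub_apply] at e1 e2
        rw [← e1, ← e2, ← ENNReal.ofReal_mul hK]
        exact ENNReal.ofReal_le_ofReal (hS.lipschitz r h3 _ _ hsF h1 hsG h2)
    _ = _ := by
        have hmFG : Measurable fun z : ℝ × E => ‖F z.1 z.2 - G z.1 z.2‖ₑ := (hF1.sub hG1).enorm
        rw [lintegral_const_mul _ hmFG.lintegral_prod_right', lintegral_prod _ hmFG.aemeasurable,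
          ← mul_assoc, ← ENNReal.ofReal_mul (by positivity)]

/-- Curves with almost everywhere equal values have almost everywhere equal Picard steps. -/
lemma picardStep_congr (hS : IsLipschitzRHS S ν a₀ K B)
    {F G : ℝ → E → ℝ} (hF : IsAdmissible ν a₀ F) (hG : IsAdmissible ν a₀ G)
    (h : ∀ᵐ s ∂volume.restrict (Ioi a₀), F s =ᵐ[ν] G s) :
    ∀ᵐ y ∂ν, ∀ s, picardStep S a₀ u₀ F s y = picardStep S a₀ u₀ G s y := by
  have hmF := hS.measurable F hF.1
  have hmG := hS.measurable G hG.1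
  have h1 : ∀ᵐ s ∂volume.restrict (Ioi a₀), ∀ᵐ y ∂ν, S s (F s) y = S s (G s) y := by
    filter_upwards [h, hF.2, hG.2, ae_restrict_mem measurableSet_Ioi] with s h1 h2 h3 h4
    have hsF : Measurable (F s) := hF.1.comp measurable_prodMk_left
    have hsG : Measurable (G s) := hG.1.comp measurable_prodMk_left
    have hl := hS.lipschitz s h4 _ _ hsF h2 hsG h3
    have hz : ∫ y, |F s y - G s y| ∂ν = 0 := by
      rw [integral_congr_ae (g := fun _ => (0 : ℝ))
        (by filter_upwards [h1] with y hy; simp [hy])]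
      simp
    rw [hz, mul_zero] at hl
    have hi : Integrable (fun y => |S s (F s) y - S s (G s) y|) ν :=
      ((hS.integrable s h4 _ hsF h2).sub (hS.integrable s h4 _ hsG h3)).abs
    have := (integral_eq_zero_iff_of_nonneg (fun _ => abs_nonneg _) hi).1
      (le_antisymm hl (integral_nonneg fun _ => abs_nonneg _))
    filter_upwards [this] with y hy
    simpa [sub_eq_zero] using hy
  -- Fubini exchanges the quantifiers, so that for almost every y the integrands agree for almost
  -- every time and the primitives agree at every time.
  have h2 : ∀ᵐ y ∂ν, ∀ᵐ s ∂volume.restrict (Ioi a₀), S s (F s) y = S s (G s) y :=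
    (Measure.ae_ae_comm (p := fun s y => S s (F s) y = S s (G s) y)
      (measurableSet_eq_fun hmF hmG)).1 h1
  filter_upwards [h2] with y hy s
  rw [picardStep, picardStep]
  congr 1
  exact integral_congr_ae (ae_restrict_of_ae_restrict_of_subset Ioc_subset_Ioi_self hy)

lemma IsMildSolution.integrable_prod (hS : IsLipschitzRHS S ν a₀ K B) (hlam : 0 < lam)
    (hu₀ : Integrable u₀ ν) {F : ℝ → E → ℝ}
    (hF : IsMildSolution S ν a₀ u₀ F) :
    Integrable (Function.uncurry F) ((expMeas a₀ lam).prod ν) ∧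
      ∀ᵐ z ∂(expMeas a₀ lam).prod ν, F z.1 z.2 = picardStep S a₀ u₀ F z.1 z.2 := by
  have h1 : ∀ᵐ z ∂(expMeas a₀ lam).prod ν, F z.1 z.2 = picardStep S a₀ u₀ F z.1 z.2 := by
    have h2 : ∀ᵐ z ∂(expMeas a₀ lam).prod ν, ∀ s, a₀ ≤ s →
        F s z.2 = u₀ z.2 + ∫ r in Ioc a₀ s, S r (F r) z.2 :=
      Measure.quasiMeasurePreserving_snd.ae hF.eq
    have h3 : ∀ᵐ z ∂(expMeas a₀ lam).prod ν, a₀ < z.1 :=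
      Measure.quasiMeasurePreserving_fst.ae (ae_expMeas_iff.2 (ae_restrict_mem measurableSet_Ioi))
    filter_upwards [h2, h3] with z h4 h5
    exact h4 z.1 h5.le
  exact ⟨(integrable_picardStep hS hlam hu₀ hF.isAdmissible).congr
    (h1.mono fun z hz => hz.symm), h1⟩

/-- With λ = 2K + 1 the distance X of two solutions is finite and satisfies X ≤ qX with q < 1, so X
= 0. Equality at almost every time becomes equality at every time because both solutions equal their
Picard steps. -/
theorem IsMildSolution.unique (hS : IsLipschitzRHS S ν a₀ K B) (hK : 0 ≤ K)
    (hu₀ : Integrable u₀ ν) {F G : ℝ → E → ℝ}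
    (hF : IsMildSolution S ν a₀ u₀ F) (hG : IsMildSolution S ν a₀ u₀ G) :
    ∀ᵐ y ∂ν, ∀ s, a₀ ≤ s → F s y = G s y := by
  have hlam : 0 < 2 * K + 1 := by linarith
  obtain ⟨iF, eF⟩ := hF.integrable_prod hS hlam hu₀
  obtain ⟨iG, eG⟩ := hG.integrable_prod hS hlam hu₀
  have h1 := edist_picardStep_le (u₀ := u₀) hS hK hlam hF.isAdmissible hG.isAdmissible
  set X := ∫⁻ z, ‖F z.1 z.2 - G z.1 z.2‖ₑ ∂(expMeas a₀ (2 * K + 1)).prod ν with hX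
  have h2 : X ≤ ENNReal.ofReal ((2 * K + 1)⁻¹ * K) * X := by
    refine le_trans (le_of_eq ?_) h1
    refine lintegral_congr_ae ?_
    filter_upwards [eF, eG] with z h3 h4
    rw [h3, h4]
  have hfin : X ≠ ⊤ := (iF.sub iG).2.ne
  have hX0 : X = 0 := by
    by_contra hne
    have hlt : ENNReal.ofReal ((2 * K + 1)⁻¹ * K) < 1 := by
      rw [ENNReal.ofReal_lt_one, inv_mul_lt_one₀ hlam]; linarith
    have : ENNReal.ofReal ((2 * K + 1)⁻¹ * K) * X < 1 * X :=
      (ENNReal.mul_lt_mul_iff_left hne hfin).2 hlt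
    rw [one_mul] at this
    exact absurd h2 (not_le.2 this)
  have hm : Measurable fun z : ℝ × E => ‖F z.1 z.2 - G z.1 z.2‖ₑ :=
    (hF.measurable.sub hG.measurable).enorm
  have h5 : ∀ᵐ z ∂(expMeas a₀ (2 * K + 1)).prod ν, F z.1 z.2 = G z.1 z.2 := by
    filter_upwards [(lintegral_eq_zero_iff hm).1 hX0] with z hz
    simpa [sub_eq_zero] using hz
  have h6 := picardStep_congr (u₀ := u₀) hS hF.isAdmissible hG.isAdmissible
    (ae_expMeas_iff.1 (Measure.ae_ae_of_ae_prod h5))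
  filter_upwards [h6, hF.eq, hG.eq] with y h7 h8 h9 s hs
  rw [h8 s hs, h9 s hs]
  exact h7 s

/-- Banach's fixed point theorem in L¹ of the exponentially weighted half-line times ν, with λ = 2K
+ 1 and contraction factor 1/2. Boundedness of the right-hand side keeps the iteration inside this
space. -/
theorem exists_isMildSolution (hS : IsLipschitzRHS S ν a₀ K B) (hK : 0 ≤ K)
    (hu₀m : Measurable u₀) (hu₀ : Integrable u₀ ν) :
    ∃ F, IsMildSolution S ν a₀ u₀ F := by
  have hlam : 0 < 2 * K + 1 := by linarith
  set μ := (expMeas a₀ (2 * K + 1)).prod ν with hμ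
  have hadm (G : Lp ℝ 1 μ) : IsAdmissible ν a₀ fun s y => G (s, y) :=
    IsAdmissible.of_integrable (Lp.stronglyMeasurable G).measurable (L1.integrable_coeFn G)
  have hint (G : Lp ℝ 1 μ) := integrable_picardStep (u₀ := u₀) hS hlam hu₀ (hadm G)
  let T : Lp ℝ 1 μ → Lp ℝ 1 μ := fun G => (hint G).toL1 _
  have hT : ContractingWith 2⁻¹ T := by
    refine ⟨by rw [← NNReal.coe_lt_coe]; norm_num, fun G H => ?_⟩
    have h1 := edist_picardStep_le (u₀ := u₀) hS hK hlam (hadm G) (hadm H)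
    have e1 : edist (T G) (T H) = ∫⁻ z, ‖picardStep S a₀ u₀ (fun s y => G (s, y)) z.1 z.2 -
        picardStep S a₀ u₀ (fun s y => H (s, y)) z.1 z.2‖ₑ ∂μ := by
      simp only [T]
      rw [Integrable.edist_toL1_toL1]
      simp only [edist_eq_enorm_sub, Function.uncurry_def]
      rfl
    have e2 : edist G H = ∫⁻ z, ‖G z - H z‖ₑ ∂μ := by
      rw [L1.edist_def]
      simp only [edist_eq_enorm_sub]
    rw [e1, e2]
    refine h1.trans ?_
    gcongr
    rw [← ENNReal.ofReal_coe_nnreal]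
    refine ENNReal.ofReal_le_ofReal ?_
    rw [inv_mul_le_iff₀ hlam]
    push_cast
    linarith
  obtain ⟨G, hG⟩ : ∃ G, T G = G := ⟨hT.fixedPoint, hT.fixedPoint_isFixedPt⟩
  have hGae : ∀ᵐ z ∂μ, G z = picardStep S a₀ u₀ (fun s y => G (s, y)) z.1 z.2 := by
    have h1 := (hint G).coeFn_toL1
    have h2 : ((hint G).toL1 _ : Lp ℝ 1 μ) = G := hG
    rw [h2] at h1
    exact h1
  have hsl : ∀ s, a₀ ≤ s → Integrable (picardStep S a₀ u₀ (fun s y => G (s, y)) s) ν := fun s hs =>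
    hu₀.add (hS.integrable_prod (hadm G) s).integral_prod_right
  have hFa : IsAdmissible ν a₀ (picardStep S a₀ u₀ (fun s y => G (s, y))) :=
    ⟨measurable_picardStep hS hu₀m (hadm G).1,
      (ae_restrict_mem measurableSet_Ioi).mono fun s hs => hsl s (le_of_lt hs)⟩
  -- The fixed point is only a class modulo null sets. Its Picard step is the representative for
  -- which the integral equation holds at every time.
  have hc := picardStep_congr (u₀ := u₀) hS (hadm G) hFa
    (ae_expMeas_iff.1 (Measure.ae_ae_of_ae_prod hGae))
  refine ⟨picardStep S a₀ u₀ (fun s y => G (s, y)), hFa.1, hsl, ?_⟩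
  filter_upwards [hc] with y hy s _
  exact hy s

lemma IsMildSolution.increment (hS : IsLipschitzRHS S ν a₀ K B) {F : ℝ → E → ℝ}
    (hF : IsMildSolution S ν a₀ u₀ F) : ∀ᵐ y ∂ν, ∀ s t, a₀ ≤ s → s ≤ t →
      F t y - F s y = ∫ r in Ioc s t, S r (F r) y := by
  filter_upwards [hF.eq, hS.ae_integrableOn hF.isAdmissible] with y h1 h2 s t hs hst
  rw [h1 s hs, h1 t (hs.trans hst), add_sub_add_left_eq_sub, ← Ioc_union_Ioc_eq_Ioc hs hst,
    setIntegral_union (Ioc_disjoint_Ioc_of_le le_rfl) measurableSet_Ioc (h2 s)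
      ((h2 t).mono_set (Ioc_subset_Ioc_left hs)), add_sub_cancel_left]

lemma IsMildSolution.integrable_Ioc (hS : IsLipschitzRHS S ν a₀ K B) {F : ℝ → E → ℝ}
    (hF : IsMildSolution S ν a₀ u₀ F) {s : ℝ} (t : ℝ) (hs : a₀ ≤ s) :
    Integrable (Function.uncurry fun r => S r (F r)) ((volume.restrict (Ioc s t)).prod ν) := by
  refine (hS.integrable_prod hF.isAdmissible t).mono_measure ?_
  exact Measure.prod_mono (Measure.restrict_mono (Ioc_subset_Ioc_left hs) le_rfl) le_rfl

/-- The evolution of the integral against a bounded weight. -/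
lemma IsMildSolution.integral_mul_increment (hS : IsLipschitzRHS S ν a₀ K B) {F : ℝ → E → ℝ}
    (hF : IsMildSolution S ν a₀ u₀ F) {φ : E → ℝ} (hφm : Measurable φ) {c : ℝ}
    (hφ : ∀ y, |φ y| ≤ c) {s t : ℝ} (hs : a₀ ≤ s) (hst : s ≤ t) :
    ∫ y, φ y * (F t y - F s y) ∂ν = ∫ r in Ioc s t, ∫ y, φ y * S r (F r) y ∂ν := by
  have hi := (hF.integrable_Ioc hS t hs).bdd_mul (c := c)
    (f := fun z : ℝ × E => φ z.2) (hφm.comp measurable_snd).aestronglyMeasurable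
    (Eventually.of_forall fun z => hφ z.2)
  rw [integral_integral_swap hi]
  refine integral_congr_ae ?_
  filter_upwards [hF.increment hS] with y hy
  rw [hy s t hs hst, integral_const_mul]

lemma IsMildSolution.integral_abs_increment_le (hS : IsLipschitzRHS S ν a₀ K B) {F : ℝ → E → ℝ}
    (hF : IsMildSolution S ν a₀ u₀ F) {s t : ℝ} (hs : a₀ ≤ s) (hst : s ≤ t) :
    ∫ y, |F t y - F s y| ∂ν ≤ ∫ r in Ioc s t, ∫ y, |S r (F r) y| ∂ν := by
  have hi := (hF.integrable_Ioc hS t hs).abs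
  rw [integral_integral_swap hi]
  refine integral_mono_ae ((hF.integrable t (hs.trans hst)).sub (hF.integrable s hs)).abs
    hi.integral_prod_right ?_
  filter_upwards [hF.increment hS] with y hy
  rw [hy s t hs hst]
  exact abs_integral_le_integral_abs

end Evolution

/-! ### Scaling and rotation of the collision operator -/

/-- Momenta enter the kinematics only through αp, so a dilation of momenta is a change of the
expansion factor. -/
lemma energy_smul (α c : ℝ) (p : Mom) : energy α (c • p) = energy (c * α) p := by
  rw [energy, energy, norm_smul, mul_pow, mul_pow, Real.norm_eq_abs, sq_abs]
  ring_nf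

lemma transfer_smul (α c : ℝ) (p q ω : Mom) :
    transfer α (c • p) (c • q) ω = c * transfer (c * α) p q ω := by
  simp only [transfer_eq, energy_smul, real_inner_smul_right]
  rw [← mul_div_assoc]
  congr 1 <;> ring

lemma postP_smul (α c : ℝ) (p q ω : Mom) :
    postP α (c • p) (c • q) ω = c • postP (c * α) p q ω := by
  rw [postP, postP, transfer_smul, smul_add, mul_smul]

lemma postQ_smul (α c : ℝ) (p q ω : Mom) :
    postQ α (c • p) (c • q) ω = c • postQ (c * α) p q ω := by
  rw [postQ, postQ, transfer_smul, smul_sub, mul_smul]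

lemma integral_mom_smul {c : ℝ} (hc : 0 < c) (h : Mom → ℝ) :
    ∫ q, h q = c ^ 3 * ∫ q, h (c • q) := by
  rw [Measure.integral_comp_smul, finrank_euclideanSpace_fin, abs_of_pos (by positivity),
    smul_eq_mul, mul_inv_cancel_left₀ (by positivity)]

/-- The collision operator in rescaled momenta. -/
lemma collision_smul (A : Kernel) {α c : ℝ} (hc : 0 < c) (u : Mom → ℝ) (y : Mom) :
    collision A α (fun p => u (c⁻¹ • p)) (fun p => u (c⁻¹ • p)) (c • y) =
      collision (fun _ p q p' q' => A α (c • p) (c • q) (c • p') (c • q')) (c * α) u u y := by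
  have hc' := hc.ne'
  simp only [collision, gain, loss]
  refine congrArg₂ _ ((integral_mom_smul hc _).trans ?_) ((integral_mom_smul hc _).trans ?_) <;>
  · rw [← integral_const_mul]
    refine integral_congr_ae (Eventually.of_forall fun q => ?_)
    -- The Jacobian c³ of the dilation in q completes α³ to (cα)³.
    simp only [postP_smul, postQ_smul, energy_smul, inv_smul_smul₀ hc', mul_pow]
    ring

/-- The map of the sphere induced by a linear isometry. -/
def sphMap (L : Mom ≃ₗᵢ[ℝ] Mom) : Sph ≃ₜ Sph where
  toFun ω := ⟨L ω, by simp⟩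
  invFun ω := ⟨L.symm ω, by simp⟩
  left_inv ω := by simp
  right_inv ω := by simp
  continuous_toFun := by fun_prop
  continuous_invFun := by fun_prop

lemma coe_sphMap (L : Mom ≃ₗᵢ[ℝ] Mom) (ω : Sph) : (sphMap L ω : Mom) = L ω := rfl

open scoped Pointwise in
-- The surface measure is defined by the volume of the cone over a set. The cone over a preimage is
-- the preimage of the cone, and L preserves volume.
lemma measurePreserving_sphMap (L : Mom ≃ₗᵢ[ℝ] Mom) :
    MeasurePreserving (sphMap L) sphMeas sphMeas := by
  refine ⟨(sphMap L).measurable, ?_⟩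
  ext s hs
  rw [Measure.map_apply (sphMap L).measurable hs, Measure.toSphere_apply' _ hs,
    Measure.toSphere_apply' _ ((sphMap L).measurable hs)]
  congr 1
  have h : (Ioo (0 : ℝ) 1 • (Subtype.val '' (sphMap L ⁻¹' s)) : Set Mom) =
      L ⁻¹' (Ioo (0 : ℝ) 1 • (Subtype.val '' s)) := by
    ext p
    simp only [Set.mem_smul, mem_preimage, mem_image]
    constructor
    · rintro ⟨r, hr, _, ⟨ω, hω, rfl⟩, rfl⟩
      exact ⟨r, hr, _, ⟨sphMap L ω, hω, rfl⟩, by simp [sphMap]⟩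
    · rintro ⟨r, hr, _, ⟨ω, hω, rfl⟩, h⟩
      refine ⟨r, hr, _, ⟨(sphMap L).symm ω, by simpa using hω, rfl⟩, ?_⟩
      apply L.injective
      rw [← h]
      simp [sphMap]
  rw [h]
  exact L.measurePreserving.measure_preimage_emb L.toHomeomorph.measurableEmbedding _

lemma integral_sphMap (L : Mom ≃ₗᵢ[ℝ] Mom) (h : Sph → ℝ) :
    ∫ ω, h (sphMap L ω) ∂sphMeas = ∫ ω, h ω ∂sphMeas :=
  (measurePreserving_sphMap L).integral_comp (sphMap L).measurableEmbedding h

lemma integral_isometry (L : Mom ≃ₗᵢ[ℝ] Mom) (h : Mom → ℝ) :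
    ∫ q, h (L q) = ∫ q, h q :=
  L.measurePreserving.integral_comp L.toHomeomorph.measurableEmbedding h

lemma energy_isometry (α : ℝ) (L : Mom ≃ₗᵢ[ℝ] Mom) (p : Mom) : energy α (L p) = energy α p := by
  rw [energy, energy, L.norm_map]

lemma transfer_isometry (α : ℝ) (L : Mom ≃ₗᵢ[ℝ] Mom) (p q ω : Mom) :
    transfer α (L p) (L q) (L ω) = transfer α p q ω := by
  simp only [transfer_eq, energy_isometry, L.inner_map_map]

lemma postP_isometry (α : ℝ) (L : Mom ≃ₗᵢ[ℝ] Mom) (p q ω : Mom) :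
    postP α (L p) (L q) (L ω) = L (postP α p q ω) := by
  rw [postP, postP, transfer_isometry, map_add, map_smul]

lemma postQ_isometry (α : ℝ) (L : Mom ≃ₗᵢ[ℝ] Mom) (p q ω : Mom) :
    postQ α (L p) (L q) (L ω) = L (postQ α p q ω) := by
  rw [postQ, postQ, transfer_isometry, map_sub, map_smul]

/-- The collision geometry is equivariant, so rotating both integration variables q and ω absorbs L.
-/
lemma source_isometry {κ : Mom → Mom → Mom → Mom → ℝ} (L : Mom ≃ₗᵢ[ℝ] Mom)
    (hκ : ∀ p q p' q', κ (L p) (L q) (L p') (L q') = κ p q p' q') (α : ℝ) (u : Mom → ℝ)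
    (p : Mom) : source α κ (fun p => u (L p)) p = source α κ u (L p) := by
  have h1 : gain (fun _ => κ) α (fun p => u (L p)) (fun p => u (L p)) p =
      gain (fun _ => κ) α u u (L p) := by
    simp only [gain]
    conv_rhs => rw [← integral_isometry L]
    refine integral_congr_ae (Eventually.of_forall fun q => ?_)
    beta_reduce
    conv_rhs => rw [← integral_sphMap L, energy_isometry]
    simp only [coe_sphMap, postP_isometry, postQ_isometry, hκ]
  have h2 : loss (fun _ => κ) α (fun p => u (L p)) (fun p => u (L p)) p =
      loss (fun _ => κ) α u u (L p) := by
    simp only [loss]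
    conv_rhs => rw [← integral_isometry L]
    refine integral_congr_ae (Eventually.of_forall fun q => ?_)
    beta_reduce
    conv_rhs => rw [← integral_sphMap L, energy_isometry]
    simp only [coe_sphMap, postP_isometry, postQ_isometry, hκ]
  rw [source, source, collision, collision, h1, h2, energy_isometry]

/-- A rotation matrix acts on momenta as a linear isometry. -/
lemma exists_isometry_act {M : Matrix (Fin 3) (Fin 3) ℝ}
    (hM : M ∈ Matrix.specialOrthogonalGroup (Fin 3) ℝ) :
    ∃ L : Mom ≃ₗᵢ[ℝ] Mom, ∀ p, L p = act M p := by
  have hM' := (Matrix.mem_specialOrthogonalGroup_iff.1 hM).1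
  have h1 : M * Mᵀ = 1 := (Matrix.mem_orthogonalGroup_iff (Fin 3) ℝ).1 hM'
  have h2 : Mᵀ * M = 1 := (Matrix.mem_orthogonalGroup_iff' (Fin 3) ℝ).1 hM'
  let e : Mom ≃ₗ[ℝ] Mom :=
    { toFun := act M
      invFun := act Mᵀ
      map_add' := fun p q => by simp [act, Matrix.mulVec_add]
      map_smul' := fun c p => by simp [act, Matrix.mulVec_smul]
      left_inv := fun p => by simp [act, h2]
      right_inv := fun p => by simp [act, h1] }
  have hn (p : Mom) : ‖act M p‖ = ‖p‖ := by
    rw [← sq_eq_sq₀ (norm_nonneg _) (norm_nonneg _), EuclideanSpace.real_norm_sq_eq,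
      EuclideanSpace.real_norm_sq_eq]
    have := Matrix.dotProduct_mulVec (M *ᵥ WithLp.ofLp p) M (WithLp.ofLp p)
    rw [← Matrix.mulVec_transpose, Matrix.mulVec_mulVec, h2, Matrix.one_mulVec] at this
    simpa [act, dotProduct, sq] using this
  exact ⟨⟨e, hn⟩, fun p => rfl⟩

/-! ### Measurability and sign of the right-hand side -/

section Param

variable {X : Type*} [MeasurableSpace X]

lemma measurable_sphere_integral {G : X × Mom × Mom × Sph → ℝ} (hG : Measurable G) {β : X → ℝ}
    (hβ : Measurable β) :
    Measurable fun z : X × Mom => ∫ q : Mom, β z.1 ^ 3 / energy (β z.1) q *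
      ∫ ω : Sph, G (z.1, z.2, q, ω) ∂sphMeas := by
  have h1 : Measurable fun w : ((X × Mom) × Mom) × Sph => G (w.1.1.1, w.1.1.2, w.1.2, w.2) := by
    fun_prop
  have h2 : Measurable fun w : (X × Mom) × Mom =>
      ∫ ω : Sph, G (w.1.1, w.1.2, w.2, ω) ∂sphMeas :=
    h1.stronglyMeasurable.integral_prod_right'.measurable
  have h3 : Measurable fun w : (X × Mom) × Mom => β w.1.1 ^ 3 / energy (β w.1.1) w.2 *
      ∫ ω : Sph, G (w.1.1, w.1.2, w.2, ω) ∂sphMeas := by fun_prop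
  exact h3.stronglyMeasurable.integral_prod_right'.measurable

lemma measurable_source_param {β : X → ℝ} (hβ : Measurable β)
    {κ : X → Mom → Mom → Mom → Mom → ℝ}
    (hκ : Measurable fun x : X × Mom × Mom × Mom × Mom => κ x.1 x.2.1 x.2.2.1 x.2.2.2.1 x.2.2.2.2)
    {F : X → Mom → ℝ} (hF : Measurable (Function.uncurry F)) :
    Measurable (Function.uncurry fun x => source (β x) (κ x) (F x)) := by
  have hF' {Y : Type _} [MeasurableSpace Y] {f : Y → X} {g : Y → Mom} (hf : Measurable f)
      (hg : Measurable g) : Measurable fun y => F (f y) (g y) := hF.comp (hf.prodMk hg)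
  have hκ' : Measurable fun w : X × Mom × Mom × Sph =>
      κ w.1 w.2.1 w.2.2.1 (postP (β w.1) w.2.1 w.2.2.1 w.2.2.2)
        (postQ (β w.1) w.2.1 w.2.2.1 w.2.2.2) := by
    have : Measurable fun w : X × Mom × Mom × Sph =>
      (w.1, w.2.1, w.2.2.1, postP (β w.1) w.2.1 w.2.2.1 w.2.2.2,
        postQ (β w.1) w.2.1 w.2.2.1 w.2.2.2) := by fun_prop
    exact hκ.comp this
  have hP : Measurable fun w : X × Mom × Mom × Sph =>
      F w.1 (postP (β w.1) w.2.1 w.2.2.1 w.2.2.2) := hF' measurable_fst (by fun_prop)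
  have hQ : Measurable fun w : X × Mom × Mom × Sph =>
      F w.1 (postQ (β w.1) w.2.1 w.2.2.1 w.2.2.2) := hF' measurable_fst (by fun_prop)
  have hp : Measurable fun w : X × Mom × Mom × Sph => F w.1 w.2.1 :=
    hF' measurable_fst (by fun_prop)
  have hq : Measurable fun w : X × Mom × Mom × Sph => F w.1 w.2.2.1 :=
    hF' measurable_fst (by fun_prop)
  have g1 := measurable_sphere_integral ((hP.mul hQ).mul hκ') hβ
  have g2 := measurable_sphere_integral ((hp.mul hq).mul hκ') hβ
  have he : Measurable fun z : X × Mom => energy (β z.1) z.2 := by fun_prop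
  exact (g1.sub g2).div he

end Param

/-- The loss term carries the factor u(p) and disappears, leaving only the gain. This is what keeps
solutions non-negative. -/
lemma source_nonneg_of_eq_zero {α : ℝ} (hα : 0 < α) {κ : Mom → Mom → Mom → Mom → ℝ}
    (hκ : ∀ p q p' q', 0 ≤ κ p q p' q') {u : Mom → ℝ} (hu : ∀ p, 0 ≤ u p) {p : Mom}
    (hp : u p = 0) : 0 ≤ source α κ u p := by
  have hl : loss (fun _ => κ) α u u p = 0 := by simp [loss, hp]
  rw [source, collision, hl, sub_zero]
  refine div_nonneg (integral_nonneg fun q => mul_nonneg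
    (div_nonneg (by positivity) (energy_pos α q).le) (integral_nonneg fun ω => ?_))
    (energy_pos α p).le
  exact mul_nonneg (mul_nonneg (hu _) (hu _)) (hκ _ _ _ _)

lemma IsCrossSection.measurable_source {α C : ℝ} {κ : Mom → Mom → Mom → Mom → ℝ}
    (hκ : IsCrossSection κ C) {u : Mom → ℝ} (hu : Measurable u) :
    Measurable (source α κ u) := by
  have hκm : Measurable fun x : Mom × Mom × Mom × Mom × Mom =>
      κ x.2.1 x.2.2.1 x.2.2.2.1 x.2.2.2.2 := hκ.measurable.comp measurable_snd
  have h := measurable_source_param (X := Mom) (β := fun _ => α) measurable_const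
    (κ := fun _ => κ) hκm (F := fun _ => u) (hu.comp measurable_snd)
  exact h.of_uncurry_left (x := 0)

/-- The integrand evaluates u at post-collisional momenta, so insensitivity to null sets is not
immediate; it follows from the Lipschitz estimate with distance zero. -/
lemma source_congr_ae {α C : ℝ} (hα : 0 < α) {κ : Mom → Mom → Mom → Mom → ℝ}
    (hκ : IsCrossSection κ C) {f g : Mom → ℝ} (hfm : Measurable f) (hgm : Measurable g)
    (hf : MemL12 f) (hg : MemL12 g) (hfg : f =ᵐ[volume] g) :
    source α κ f =ᵐ[volume] source α κ g := by
  have h1 := source_sub_le hα hκ hfm hf hgm hg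
  have h2 : normL12 (fun p => f p - g p) = 0 := by
    rw [normL12_def, integral_congr_ae (g := fun _ => (0 : ℝ))
      (by filter_upwards [hfg] with p hp; simp [hp])]
    simp
  rw [h2, mul_zero, mul_zero] at h1
  have sf := source_weak hα hκ hfm hf
  have sg := source_weak hα hκ hgm hg
  have hi := ((memL12_of_measurable (hκ.measurable_source hfm) sf.1).sub
    (memL12_of_measurable (hκ.measurable_source hgm) sg.1)).2
  have h3 := (integral_eq_zero_iff_of_nonneg
    (fun p => mul_nonneg (wt_pos p).le (abs_nonneg _)) hi).1
    (le_antisymm h1 (normL12_nonneg _))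
  filter_upwards [h3] with p hp
  have : wt p * |source α κ f p - source α κ g p| = 0 := hp
  rcases mul_eq_zero.1 this with h | h
  · exact absurd h (wt_pos p).ne'
  · exact sub_eq_zero.1 (abs_eq_zero.1 h)

/-! ### The Boltzmann equation in comoving momenta, with the scale factor as a clock -/

/-- The collision kernel in the momenta `y = (α² / a₀²) p`, which are constant along the
characteristics. -/
def comovingKernel (A : Kernel) (a₀ α : ℝ) (p q p' q' : Mom) : ℝ :=
  if 0 < α then A α ((a₀ ^ 2 / α ^ 2) • p) ((a₀ ^ 2 / α ^ 2) • q) ((a₀ ^ 2 / α ^ 2) • p')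
    ((a₀ ^ 2 / α ^ 2) • q') else 0

/-- The kernel is constrained only for α > 0. Its extension by zero keeps every bound and symmetry
and makes measurability global in α. -/
lemma IsCollisionKernel.exists_isCrossSection {A : Kernel} (hA : IsCollisionKernel A) (a₀ : ℝ) :
    (∃ C, ∀ α, IsCrossSection (comovingKernel A a₀ α) C) ∧
    Measurable fun x : ℝ × Mom × Mom × Mom × Mom =>
      comovingKernel A a₀ x.1 x.2.1 x.2.2.1 x.2.2.2.1 x.2.2.2.2 := by
  have hset : MeasurableSet {x : ℝ × Mom × Mom × Mom × Mom | 0 < x.1} :=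
    measurableSet_lt measurable_const measurable_fst
  have hm0 : Measurable fun x : ℝ × Mom × Mom × Mom × Mom =>
      if 0 < x.1 then A x.1 x.2.1 x.2.2.1 x.2.2.2.1 x.2.2.2.2 else 0 := by
    classical
    exact hA.continuousOn.measurable_piecewise (g := fun _ => 0) continuousOn_const hset
  have hm : Measurable fun x : ℝ × Mom × Mom × Mom × Mom =>
      comovingKernel A a₀ x.1 x.2.1 x.2.2.1 x.2.2.2.1 x.2.2.2.2 := by
    have hs : Measurable fun x : ℝ × Mom × Mom × Mom × Mom =>
        (x.1, (a₀ ^ 2 / x.1 ^ 2) • x.2.1, (a₀ ^ 2 / x.1 ^ 2) • x.2.2.1,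
          (a₀ ^ 2 / x.1 ^ 2) • x.2.2.2.1, (a₀ ^ 2 / x.1 ^ 2) • x.2.2.2.2) := by fun_prop
    exact hm0.comp hs
  obtain ⟨C, hC, hle⟩ := hA.bounded
  refine ⟨⟨C, fun α => ⟨hm.of_uncurry_left (f := fun α (x : Mom × Mom × Mom × Mom) =>
    comovingKernel A a₀ α x.1 x.2.1 x.2.2.1 x.2.2.2), ?_, ?_, ?_, ?_⟩⟩, hm⟩
  all_goals
    intro p q p' q'
    unfold comovingKernel
    split_ifs with h
  · exact hA.nonneg _ h _ _ _ _
  · exact le_rfl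
  · exact hle _ h _ _ _ _
  · exact hC.le
  · exact hA.symm_exchange _ h _ _ _ _
  · rfl
  · exact hA.symm_reverse _ h _ _ _ _
  · rfl

/-- The Hubble parameter when the expansion factor is `α` and the distribution function in
comoving momenta is `u`. -/
def hubble (a₀ Λ α : ℝ) (u : Mom → ℝ) : ℝ :=
  √(8 * Real.pi / 3 * ((a₀ ^ 2 / α) ^ 3 * ∫ y, energy (a₀ ^ 2 / α) y * u y) + Λ / 3)

/-- The right-hand side of the Boltzmann equation in comoving momenta, with respect to the
clock `α`. -/
def comovingRHS (A : Kernel) (a₀ Λ α : ℝ) (u : Mom → ℝ) (y : Mom) : ℝ :=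
  (α * hubble a₀ Λ α u)⁻¹ * source (a₀ ^ 2 / α) (comovingKernel A a₀ α) u y

/-- Radial truncation of the positive part. -/
def truncation (R : ℝ) (u : Mom → ℝ) (y : Mom) : ℝ := R / max R (normL12 u) * max (u y) 0

/-- The weighted measure on momentum space. -/
def wtMeas : Measure Mom := volume.withDensity fun p => ENNReal.ofReal (wt p)

instance : SigmaFinite wtMeas := SigmaFinite.withDensity_ofReal _

lemma measurable_ofReal_wt : Measurable fun p : Mom => ENNReal.ofReal (wt p) := by fun_prop

lemma integral_wtMeas (h : Mom → ℝ) : ∫ p, h p ∂wtMeas = ∫ p, wt p * h p := by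
  rw [wtMeas, integral_withDensity_eq_integral_toReal_smul measurable_ofReal_wt
    (Eventually.of_forall fun _ => ENNReal.ofReal_lt_top)]
  refine integral_congr_ae (Eventually.of_forall fun p => ?_)
  beta_reduce
  rw [ENNReal.toReal_ofReal (wt_pos p).le, smul_eq_mul]

lemma integrable_wtMeas_iff (h : Mom → ℝ) :
    Integrable h wtMeas ↔ Integrable fun p => wt p * h p := by
  rw [wtMeas, integrable_withDensity_iff_integrable_smul' measurable_ofReal_wt
    (Eventually.of_forall fun _ => ENNReal.ofReal_lt_top)]
  refine integrable_congr (Eventually.of_forall fun p => ?_)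
  beta_reduce
  rw [ENNReal.toReal_ofReal (wt_pos p).le, smul_eq_mul]

lemma integrable_wtMeas_iff_memL12 {h : Mom → ℝ} (hm : Measurable h) :
    Integrable h wtMeas ↔ MemL12 h := by
  rw [integrable_wtMeas_iff]
  constructor
  · intro hi
    refine memL12_of_measurable hm (hi.abs.congr (Eventually.of_forall fun p => ?_))
    beta_reduce
    rw [abs_mul, abs_of_pos (wt_pos p)]
  · intro hi
    refine hi.2.mono' (by fun_prop) (Eventually.of_forall fun p => ?_)
    rw [Real.norm_eq_abs, abs_mul, abs_of_pos (wt_pos p), wt]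

lemma integral_abs_wtMeas (h : Mom → ℝ) : ∫ p, |h p| ∂wtMeas = normL12 h :=
  integral_wtMeas _

lemma ae_wtMeas_iff {p : Mom → Prop} : (∀ᵐ y ∂wtMeas, p y) ↔ ∀ᵐ y, p y :=
  ⟨fun h => (withDensity_absolutelyContinuous' measurable_ofReal_wt.aemeasurable
      (Eventually.of_forall fun s => by simpa using wt_pos s)).ae_le h,
    fun h => (withDensity_absolutelyContinuous _ _).ae_le h⟩

lemma MemL12.mono {f g : Mom → ℝ} (hg : MemL12 g) (hf : Measurable f) (h : ∀ p, |f p| ≤ |g p|) :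
    MemL12 f := by
  refine memL12_of_measurable hf (hg.2.mono' (by fun_prop) (Eventually.of_forall fun p => ?_))
  rw [Real.norm_eq_abs, abs_mul, abs_abs, abs_of_pos (wt_pos p)]
  exact mul_le_mul_of_nonneg_left (h p) (wt_pos p).le

lemma normL12_mono {f g : Mom → ℝ} (hg : MemL12 g) (hf : Measurable f) (h : ∀ p, |f p| ≤ |g p|) :
    normL12 f ≤ normL12 g :=
  integral_mono (hg.mono hf h).2 hg.2 fun p =>
    mul_le_mul_of_nonneg_left (h p) (Real.sqrt_nonneg _)

lemma normL1_mono {f g : Mom → ℝ} (hg : MemL12 g) (hf : Measurable f) (h : ∀ p, |f p| ≤ |g p|) :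
    normL1 f ≤ normL1 g :=
  integral_mono (hg.mono hf h).1.abs hg.1.abs h

lemma normL12_const_mul (c : ℝ) (f : Mom → ℝ) :
    normL12 (fun p => c * f p) = |c| * normL12 f := by
  rw [normL12_def, normL12_def, ← integral_const_mul]
  congr 1; ext p; rw [abs_mul]; ring

lemma normL12_congr {f g : Mom → ℝ} (h : f =ᵐ[volume] g) : normL12 f = normL12 g :=
  integral_congr_ae (h.mono fun p hp => by simp only [hp])

lemma MemL12.const_mul {f : Mom → ℝ} (hf : MemL12 f) (c : ℝ) : MemL12 fun p => c * f p :=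
  ⟨hf.1.const_mul c, (hf.2.const_mul |c|).congr (Eventually.of_forall fun p => by
    beta_reduce; rw [abs_mul]; ring)⟩

lemma normL12_add_le {f g h : Mom → ℝ} (hf : MemL12 f) (hg : MemL12 g) (hh : MemL12 h)
    (hle : ∀ p, |h p| ≤ |f p| + |g p|) : normL12 h ≤ normL12 f + normL12 g := by
  rw [normL12_def, normL12_def, normL12_def, ← integral_add hf.weighted hg.weighted]
  refine integral_mono hh.weighted (hf.weighted.add hg.weighted) fun p => ?_
  rw [← mul_add]
  exact mul_le_mul_of_nonneg_left (hle p) (wt_pos p).le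

/-! ### The truncation: bounds and Lipschitz continuity -/

section Truncation

variable {R : ℝ}

lemma truncation_nonneg (hR : 0 < R) (u : Mom → ℝ) (y : Mom) : 0 ≤ truncation R u y :=
  mul_nonneg (div_nonneg hR.le (le_max_of_le_left hR.le)) (le_max_right _ _)

lemma truncation_factor_le_one (hR : 0 < R) (n : ℝ) : R / max R n ≤ 1 :=
  (div_le_one (lt_max_of_lt_left hR)).2 (le_max_left _ _)

lemma abs_truncation_le (hR : 0 < R) (u : Mom → ℝ) (y : Mom) : |truncation R u y| ≤ |u y| := by
  rw [abs_of_nonneg (truncation_nonneg hR u y), truncation]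
  refine (mul_le_of_le_one_left (le_max_right _ _) (truncation_factor_le_one hR _)).trans ?_
  exact max_le (le_abs_self _) (abs_nonneg _)

lemma truncation_eq_zero {u : Mom → ℝ} {y : Mom} (h : u y ≤ 0) : truncation R u y = 0 := by
  rw [truncation, max_eq_right h, mul_zero]

lemma truncation_eq_self (hR : 0 < R) {u : Mom → ℝ} (hu : normL12 u ≤ R) {y : Mom}
    (hy : 0 ≤ u y) : truncation R u y = u y := by
  rw [truncation, max_eq_left hu, max_eq_left hy, div_self hR.ne', one_mul]

lemma measurable_truncation {u : Mom → ℝ} (hu : Measurable u) : Measurable (truncation R u) := by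
  unfold truncation; fun_prop

lemma memL12_truncation (hR : 0 < R) {u : Mom → ℝ} (hum : Measurable u) (hu : MemL12 u) :
    MemL12 (truncation R u) :=
  hu.mono (measurable_truncation hum) (abs_truncation_le hR u)

lemma normL12_truncation_le (hR : 0 < R) {u : Mom → ℝ} (hum : Measurable u) (hu : MemL12 u) :
    normL12 (truncation R u) ≤ R := by
  have hm : Measurable fun y => max (u y) 0 := by fun_prop
  have h1 : normL12 (fun y => max (u y) 0) ≤ normL12 u := normL12_mono hu hm fun p => by
    rw [abs_of_nonneg (le_max_right _ _)]; exact max_le (le_abs_self _) (abs_nonneg _)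
  have hpos : 0 < max R (normL12 u) := lt_max_of_lt_left hR
  have : normL12 (truncation R u) = R / max R (normL12 u) * normL12 (fun y => max (u y) 0) := by
    have := normL12_const_mul (R / max R (normL12 u)) (fun y => max (u y) 0)
    rwa [abs_of_pos (div_pos hR hpos)] at this
  rw [this, div_mul_eq_mul_div, div_le_iff₀ hpos]
  exact mul_le_mul_of_nonneg_left (h1.trans (le_max_right _ _)) hR.le

/-- Both the change of the positive part and the change of the scaling factor cost at most the
distance of u and v, hence the constant 2. -/
lemma normL12_truncation_sub_le (hR : 0 < R) {u v : Mom → ℝ} (hum : Measurable u) (hu : MemL12 u)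
    (hvm : Measurable v) (hv : MemL12 v) :
    normL12 (fun y => truncation R u y - truncation R v y) ≤ 2 * normL12 fun y => u y - v y := by
  set a := max R (normL12 u) with ha
  set b := max R (normL12 v) with hb
  have ha0 : 0 < a := lt_max_of_lt_left hR
  have hb0 : 0 < b := lt_max_of_lt_left hR
  have hd := hu.sub hv
  have hnorm : |normL12 u - normL12 v| ≤ normL12 fun y => u y - v y := by
    rw [abs_le]
    have h1 := normL12_add_le hv hd hu fun p => by
      have := abs_add_le (v p) (u p - v p); rwa [add_sub_cancel] at this
    have h2 := normL12_add_le hu hd hv fun p => by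
      have := abs_sub (u p) (u p - v p); rwa [sub_sub_cancel] at this
    constructor <;> linarith
  have hvp : Measurable fun y => max (v y) 0 := by fun_prop
  have hvp' : ∀ p, |max (v p) 0| ≤ |v p| := fun p => by
    rw [abs_of_nonneg (le_max_right _ _)]; exact max_le (le_abs_self _) (abs_nonneg _)
  have h1 : |R / a - R / b| * normL12 v ≤ normL12 fun y => u y - v y := by
    refine le_trans ?_ hnorm
    -- The norm of v is at most b, so the difference of the factors times that norm is at most |b -
    -- a|.
    have e : R / a - R / b = R / a * ((b - a) / b) := by field_simp
    have hab : |b - a| ≤ |normL12 u - normL12 v| := by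
      rw [ha, hb, abs_sub_comm]; exact abs_max_sub_max_le_max R _ R _ |>.trans (by simp)
    rw [e, abs_mul, abs_of_pos (div_pos hR ha0), abs_div, abs_of_pos hb0]
    calc R / a * (|b - a| / b) * normL12 v = R / a * (|b - a| * normL12 v / b) := by ring
      _ ≤ 1 * (|b - a| * 1) := by
          refine mul_le_mul (truncation_factor_le_one hR _) ?_
            (div_nonneg (mul_nonneg (abs_nonneg _) (normL12_nonneg v)) hb0.le) zero_le_one
          rw [mul_div_assoc]
          exact mul_le_mul_of_nonneg_left ((div_le_one hb0).2 (le_max_right _ _)) (abs_nonneg _)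
      _ ≤ _ := by simpa using hab
  have h2 := normL12_add_le hd (hv.const_mul (R / a - R / b))
    ((memL12_truncation hR hum hu).sub (memL12_truncation hR hvm hv)) fun p => by
      have e : truncation R u p - truncation R v p =
          R / a * (max (u p) 0 - max (v p) 0) + (R / a - R / b) * max (v p) 0 := by
        rw [truncation, truncation]; ring
      rw [e]
      refine (abs_add_le _ _).trans (add_le_add ?_ ?_)
      · rw [abs_mul, abs_of_pos (div_pos hR ha0)]
        refine (mul_le_of_le_one_left (abs_nonneg _) (truncation_factor_le_one hR _)).trans ?_
        exact abs_max_sub_max_le_max (u p) 0 (v p) 0 |>.trans (by simp)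
      · rw [abs_mul, abs_mul]
        exact mul_le_mul_of_nonneg_left (hvp' p) (abs_nonneg _)
  rw [normL12_const_mul] at h2
  linarith

end Truncation

/-! ### Bounds and Lipschitz continuity of the Hubble parameter -/

section Hubble

variable {a₀ Λ α : ℝ}

lemma MemL12.integrable_mul {u φ : Mom → ℝ} (hu : MemL12 u) (hφm : Measurable φ) {c : ℝ}
    (hφ : ∀ p, |φ p| ≤ c * wt p) :
    Integrable (fun p => φ p * u p) ∧ |∫ p, φ p * u p| ≤ c * normL12 u := by
  have hb : ∀ p, |φ p * u p| ≤ c * (wt p * |u p|) := fun p => by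
    rw [abs_mul, ← mul_assoc]; exact mul_le_mul_of_nonneg_right (hφ p) (abs_nonneg _)
  have hi : Integrable (fun p => φ p * u p) :=
    (hu.2.const_mul c).mono' (hφm.aestronglyMeasurable.mul hu.1.aestronglyMeasurable)
      (Eventually.of_forall hb)
  refine ⟨hi, abs_integral_le_integral_abs.trans ?_⟩
  rw [normL12_def, ← integral_const_mul]
  exact integral_mono hi.abs (hu.2.const_mul c) hb

/-- a₀²/α is the effective expansion factor in comoving momenta. Its upper bound makes the estimates
uniform in the clock. -/
lemma clock_param_le (ha₀ : 0 < a₀) (hα : a₀ ≤ α) : 0 < a₀ ^ 2 / α ∧ a₀ ^ 2 / α ≤ a₀ := by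
  have : 0 < α := ha₀.trans_le hα
  refine ⟨by positivity, ?_⟩
  rw [div_le_iff₀ this, sq]
  exact mul_le_mul_of_nonneg_left hα ha₀.le

/-- Matter contributes non-negative energy, so the cosmological constant alone bounds H from below.
This bound permits division by H and makes the scale factor a clock. -/
lemma sqrt_le_hubble {u : Mom → ℝ} (ha₀ : 0 < a₀) (hα : a₀ ≤ α) (hu : ∀ᵐ p, 0 ≤ u p) :
    √(Λ / 3) ≤ hubble a₀ Λ α u := by
  refine Real.sqrt_le_sqrt ?_
  have h1 := (clock_param_le ha₀ hα).1
  have h2 : 0 ≤ ∫ y, energy (a₀ ^ 2 / α) y * u y := integral_nonneg_of_ae (by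
    filter_upwards [hu] with p hp
    exact mul_nonneg (energy_pos _ _).le hp)
  have := Real.pi_pos
  have : 0 ≤ 8 * Real.pi / 3 * ((a₀ ^ 2 / α) ^ 3 * ∫ y, energy (a₀ ^ 2 / α) y * u y) := by
    positivity
  linarith

lemma abs_sqrt_sub_sqrt_le {h x y : ℝ} (hh : 0 < h) (hx : h ≤ √x) (hy : h ≤ √y) :
    |√x - √y| ≤ h⁻¹ * |x - y| := by
  have hx0 : 0 < x := Real.sqrt_pos.1 (hh.trans_le hx)
  have hy0 : 0 < y := Real.sqrt_pos.1 (hh.trans_le hy)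
  have e : x - y = (√x - √y) * (√x + √y) := by
    linear_combination Real.sq_sqrt hy0.le - Real.sq_sqrt hx0.le
  rw [e, abs_mul, abs_of_pos (by linarith : 0 < √x + √y), ← mul_assoc, mul_comm h⁻¹, mul_assoc]
  refine le_mul_of_one_le_right (abs_nonneg _) ?_
  rw [inv_mul_eq_div, one_le_div hh]
  linarith

lemma energy_le_of_param_le (ha₀ : 0 < a₀) (hα : a₀ ≤ α) (p : Mom) :
    |energy (a₀ ^ 2 / α) p| ≤ (1 + a₀) * wt p := by
  obtain ⟨h1, h2⟩ := clock_param_le ha₀ hα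
  refine (energy_le_wt h1.le p).trans ?_
  have := wt_pos p
  gcongr

lemma abs_hubble_sub_le {u v : Mom → ℝ} (hΛ : 0 < Λ) (ha₀ : 0 < a₀) (hα : a₀ ≤ α)
    (hu : MemL12 u) (hv : MemL12 v) (hu0 : ∀ᵐ p, 0 ≤ u p) (hv0 : ∀ᵐ p, 0 ≤ v p) :
    |hubble a₀ Λ α u - hubble a₀ Λ α v| ≤
      (√(Λ / 3))⁻¹ * (8 * Real.pi / 3 * (a₀ ^ 3 * (1 + a₀))) * normL12 fun p => u p - v p := by
  obtain ⟨h1, h2⟩ := clock_param_le ha₀ hα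
  have hem : Measurable (energy (a₀ ^ 2 / α)) := by fun_prop
  have iu := (hu.integrable_mul hem (energy_le_of_param_le ha₀ hα)).1
  have iv := (hv.integrable_mul hem (energy_le_of_param_le ha₀ hα)).1
  have iw := ((hu.sub hv).integrable_mul hem (energy_le_of_param_le ha₀ hα)).2
  have hh : 0 < √(Λ / 3) := Real.sqrt_pos.2 (by positivity)
  refine (abs_sqrt_sub_sqrt_le hh (sqrt_le_hubble ha₀ hα hu0)
    (sqrt_le_hubble ha₀ hα hv0)).trans ?_
  rw [mul_assoc]
  refine mul_le_mul_of_nonneg_left ?_ (inv_nonneg.2 hh.le)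
  rw [add_sub_add_right_eq_sub, ← mul_sub, ← mul_sub, ← integral_sub iu iv]
  simp_rw [← mul_sub]
  have hπ := Real.pi_pos
  rw [abs_mul, abs_mul, abs_of_pos (by positivity : 0 < 8 * Real.pi / 3),
    abs_of_pos (by positivity : 0 < (a₀ ^ 2 / α) ^ 3), mul_assoc, mul_assoc]
  gcongr

end Hubble

/-! ### The truncated evolution equation -/

section Solution

variable {A : Kernel} {a₀ Λ R C : ℝ}

lemma measurable_hubble {F : ℝ → Mom → ℝ} (hF : Measurable (Function.uncurry F)) :
    Measurable fun α => hubble a₀ Λ α (F α) := by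
  have hF' : Measurable fun z : ℝ × Mom => F z.1 z.2 := hF
  have h : Measurable fun z : ℝ × Mom => energy (a₀ ^ 2 / z.1) z.2 * F z.1 z.2 := by fun_prop
  have h2 : Measurable fun α : ℝ => ∫ y, energy (a₀ ^ 2 / α) y * F α y :=
    h.stronglyMeasurable.integral_prod_right'.measurable
  unfold hubble
  fun_prop

lemma measurable_comovingRHS (hA : IsCollisionKernel A) {F : ℝ → Mom → ℝ}
    (hF : Measurable (Function.uncurry F)) :
    Measurable (Function.uncurry fun α => comovingRHS A a₀ Λ α (F α)) := by
  have h1 := measurable_source_param (β := fun α : ℝ => a₀ ^ 2 / α) (by fun_prop)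
    (κ := comovingKernel A a₀) (hA.exists_isCrossSection a₀).2 hF
  have h2 : Measurable fun z : ℝ × Mom => hubble a₀ Λ z.1 (F z.1) :=
    (measurable_hubble hF).comp measurable_fst
  exact ((measurable_fst.mul h2).inv).mul h1

lemma measurable_truncation_param {F : ℝ → Mom → ℝ} (hF : Measurable (Function.uncurry F)) :
    Measurable (Function.uncurry fun α => truncation R (F α)) := by
  have hF' : Measurable fun z : ℝ × Mom => F z.1 z.2 := hF
  have h : Measurable fun z : ℝ × Mom => wt z.2 * |F z.1 z.2| := by fun_prop
  have h2 : Measurable fun α : ℝ => normL12 (F α) :=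
    h.stronglyMeasurable.integral_prod_right'.measurable
  have h3 : Measurable fun z : ℝ × Mom => normL12 (F z.1) := h2.comp measurable_fst
  simp only [Function.uncurry_def, truncation]
  fun_prop

lemma normL12_comovingRHS (α : ℝ) (u : Mom → ℝ) : normL12 (comovingRHS A a₀ Λ α u) =
    |(α * hubble a₀ Λ α u)⁻¹| * normL12 (source (a₀ ^ 2 / α) (comovingKernel A a₀ α) u) :=
  normL12_const_mul _ _

/-- The size of the right-hand side of the Boltzmann equation. -/
lemma comovingRHS_bounds (hκ : ∀ α, IsCrossSection (comovingKernel A a₀ α) C) (ha₀ : 0 < a₀)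
    (hΛ : 0 < Λ) {α : ℝ} (hα : a₀ ≤ α) {u : Mom → ℝ} (hum : Measurable u) (hu : MemL12 u)
    (hu0 : ∀ᵐ p, 0 ≤ u p) :
    MemL12 (comovingRHS A a₀ Λ α u) ∧ ∫ y, comovingRHS A a₀ Λ α u y = 0 ∧
    ∫ y, energy (a₀ ^ 2 / α) y * comovingRHS A a₀ Λ α u y = 0 ∧
    normL12 (comovingRHS A a₀ Λ α u) ≤ 4 * a₀ ^ 6 * C * sphMeas.real univ * (√(Λ / 3))⁻¹ *
      α ^ (-4 : ℤ) * (normL12 u * normL1 u) := by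
  have h1 := (clock_param_le ha₀ hα).1
  have hα0 := ha₀.trans_le hα
  obtain ⟨i1, i2, i3, i4⟩ := source_weak h1 (hκ α) hum hu
  have hm := (hκ α).measurable_source (α := a₀ ^ 2 / α) hum
  have hmem := (memL12_of_measurable hm i1).const_mul (α * hubble a₀ Λ α u)⁻¹
  refine ⟨hmem, ?_, ?_, ?_⟩
  · simp only [comovingRHS]
    rw [integral_const_mul, i2, mul_zero]
  · simp only [comovingRHS, mul_left_comm _ (α * hubble a₀ Λ α u)⁻¹]
    rw [integral_const_mul, i3, mul_zero]
  · have hh : 0 < √(Λ / 3) := Real.sqrt_pos.2 (by positivity)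
    have hH := sqrt_le_hubble (Λ := Λ) ha₀ hα hu0
    have hC := (hκ α).const_nonneg
    have hn1 := normL12_nonneg u
    have hn2 := normL1_nonneg u
    have hpos : 0 < α * hubble a₀ Λ α u := mul_pos hα0 (hh.trans_le hH)
    rw [normL12_comovingRHS, abs_of_pos (inv_pos.2 hpos)]
    -- The clock contributes 1/α and the collision volume (a₀²/α)³; together they give the decay
    -- α⁻⁴.
    calc (α * hubble a₀ Λ α u)⁻¹ * normL12 (source (a₀ ^ 2 / α) (comovingKernel A a₀ α) u)
        ≤ (α * √(Λ / 3))⁻¹ * (4 * (a₀ ^ 2 / α) ^ 3 * C * sphMeas.real univ *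
          (normL12 u * normL1 u)) := by
          gcongr
          exact normL12_nonneg _
      _ = _ := by
          rw [zpow_neg, zpow_ofNat]
          field_simp

/-- The truncated equation has a Lipschitz continuous right-hand side. -/
lemma exists_isLipschitzRHS (hA : IsCollisionKernel A) (ha₀ : 0 < a₀) (hΛ : 0 < Λ) (hR : 0 < R) :
    ∃ K B, 0 ≤ K ∧ IsLipschitzRHS (fun α u => comovingRHS A a₀ Λ α (truncation R u))
      wtMeas a₀ K B := by
  obtain ⟨⟨C, hκ⟩, -⟩ := hA.exists_isCrossSection a₀
  have hC := (hκ 0).const_nonneg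
  have hh : 0 < √(Λ / 3) := Real.sqrt_pos.2 (by positivity)
  set h := √(Λ / 3) with hh_def
  set K₀ := 4 * a₀ ^ 3 * C * sphMeas.real univ with hK₀
  have hK₀' : 0 ≤ K₀ := by positivity
  set L := h⁻¹ * (8 * Real.pi / 3 * (a₀ ^ 3 * (1 + a₀))) with hL
  have hL' : 0 ≤ L := by have := Real.pi_pos; positivity
  have htm {u : Mom → ℝ} (hu : Measurable u) (hi : Integrable u wtMeas) :
      Measurable (truncation R u) ∧ MemL12 (truncation R u) ∧ normL12 (truncation R u) ≤ R := by
    have hu' := (integrable_wtMeas_iff_memL12 hu).1 hi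
    exact ⟨measurable_truncation hu, memL12_truncation hR hu hu', normL12_truncation_le hR hu hu'⟩
  have ht0 (u : Mom → ℝ) : ∀ᵐ p, 0 ≤ truncation R u p :=
    Eventually.of_forall fun p => truncation_nonneg hR u p
  have hrm {α : ℝ} {u : Mom → ℝ} (hu : Measurable u) :
      Measurable (comovingRHS A a₀ Λ α (truncation R u)) :=
    ((hκ α).measurable_source (measurable_truncation hu)).const_mul _
  have hG {α : ℝ} (hα : a₀ < α) (u : Mom → ℝ) :
      0 < (α * hubble a₀ Λ α (truncation R u))⁻¹ ∧
      (α * hubble a₀ Λ α (truncation R u))⁻¹ ≤ (a₀ * h)⁻¹ := by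
    have hH := sqrt_le_hubble (Λ := Λ) ha₀ hα.le (ht0 u)
    have h0 : 0 < a₀ * h := by positivity
    have h1 : a₀ * h ≤ α * hubble a₀ Λ α (truncation R u) :=
      mul_le_mul hα.le hH hh.le (ha₀.trans hα).le
    exact ⟨inv_pos.2 (h0.trans_le h1), inv_anti₀ h0 h1⟩
  have hβ {α : ℝ} (hα : a₀ < α) : 4 * (a₀ ^ 2 / α) ^ 3 * C * sphMeas.real univ ≤ K₀ := by
    obtain ⟨b1, b2⟩ := clock_param_le ha₀ hα.le
    rw [hK₀]
    gcongr
  have hsrc {α : ℝ} (hα : a₀ < α) {u : Mom → ℝ} (hu : Measurable u) (hi : Integrable u wtMeas) :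
      MemL12 (source (a₀ ^ 2 / α) (comovingKernel A a₀ α) (truncation R u)) ∧
      normL12 (source (a₀ ^ 2 / α) (comovingKernel A a₀ α) (truncation R u)) ≤ K₀ * R ^ 2 := by
    obtain ⟨t1, t2, t3⟩ := htm hu hi
    obtain ⟨b1, b2⟩ := clock_param_le ha₀ hα.le
    obtain ⟨s1, -, -, s4⟩ := source_weak b1 (hκ α) t1 t2
    refine ⟨memL12_of_measurable ((hκ α).measurable_source t1) s1, s4.trans ?_⟩
    have n0 := normL12_nonneg (truncation R u)
    have n1 := normL1_nonneg (truncation R u)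
    have n2 := normL1_le_normL12 t2
    rw [sq R]
    exact mul_le_mul (hβ hα) (mul_le_mul t3 (n2.trans t3) n1 hR.le) (by positivity) hK₀'
  -- First summand: variation of the source at a fixed prefactor. Second: variation of the prefactor
  -- 1/(αH) against the bounded source. The last factor 2 is the Lipschitz constant of the
  -- truncation.
  refine ⟨((a₀ * h)⁻¹ * (K₀ * (R + R)) + L * (a₀ * h * h)⁻¹ * (K₀ * R ^ 2)) * 2,
    (a₀ * h)⁻¹ * (K₀ * R ^ 2), by positivity, ⟨?_, ?_, ?_, ?_⟩⟩
  · intro F hF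
    exact measurable_comovingRHS hA (measurable_truncation_param hF)
  · intro α hα u hum hu
    rw [integrable_wtMeas_iff_memL12 (hrm hum)]
    obtain ⟨t1, t2, t3⟩ := htm hum hu
    exact (comovingRHS_bounds hκ ha₀ hΛ hα.le t1 t2 (ht0 u)).1
  · intro α hα u hum hu
    have e := integral_abs_wtMeas (comovingRHS A a₀ Λ α (truncation R u))
    rw [e, normL12_comovingRHS, abs_of_pos (hG hα u).1]
    exact mul_le_mul (hG hα u).2 (hsrc hα hum hu).2 (normL12_nonneg _) (by positivity)
  · intro α hα u v hum hu hvm hv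
    have e1 := integral_abs_wtMeas fun y => comovingRHS A a₀ Λ α (truncation R u) y -
      comovingRHS A a₀ Λ α (truncation R v) y
    have e2 := integral_abs_wtMeas fun y => u y - v y
    rw [e1, e2]
    obtain ⟨t1, t2, t3⟩ := htm hum hu
    obtain ⟨t1', t2', t3'⟩ := htm hvm hv
    obtain ⟨s1, s2⟩ := hsrc hα hum hu
    obtain ⟨s1', s2'⟩ := hsrc hα hvm hv
    obtain ⟨b1, b2⟩ := clock_param_le ha₀ hα.le
    set D := normL12 fun y => truncation R u y - truncation R v y with hD
    have hD0 : 0 ≤ D := normL12_nonneg _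
    have hD2 : D ≤ 2 * normL12 fun y => u y - v y := normL12_truncation_sub_le hR hum
      ((integrable_wtMeas_iff_memL12 hum).1 hu) hvm ((integrable_wtMeas_iff_memL12 hvm).1 hv)
    set Gu := (α * hubble a₀ Λ α (truncation R u))⁻¹ with hGu
    set Gv := (α * hubble a₀ Λ α (truncation R v))⁻¹ with hGv
    have hGd : |Gu - Gv| ≤ L * (a₀ * h * h)⁻¹ * D := by
      have hHu := sqrt_le_hubble (Λ := Λ) ha₀ hα.le (ht0 u)
      have hHv := sqrt_le_hubble (Λ := Λ) ha₀ hα.le (ht0 v)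
      have hd := abs_hubble_sub_le hΛ ha₀ hα.le t2 t2' (ht0 u) (ht0 v)
      have pu := hh.trans_le hHu
      have pv := hh.trans_le hHv
      have pα := ha₀.trans hα
      have e : Gu - Gv = (hubble a₀ Λ α (truncation R v) - hubble a₀ Λ α (truncation R u)) *
          (α * hubble a₀ Λ α (truncation R u) * hubble a₀ Λ α (truncation R v))⁻¹ := by
        rw [hGu, hGv]; field_simp
      rw [e, abs_mul, abs_sub_comm, abs_of_pos (by positivity : 0 <
        (α * hubble a₀ Λ α (truncation R u) * hubble a₀ Λ α (truncation R v))⁻¹)]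
      calc _ ≤ (L * D) * (a₀ * h * h)⁻¹ := by gcongr
        _ = _ := by ring
    have hsub := source_sub_le b1 (hκ α) t1 t2 t1' t2'
    have hsub' : normL12 (fun y => source (a₀ ^ 2 / α) (comovingKernel A a₀ α) (truncation R u) y -
        source (a₀ ^ 2 / α) (comovingKernel A a₀ α) (truncation R v) y) ≤ K₀ * (R + R) * D := by
      refine hsub.trans ?_
      rw [mul_assoc K₀]
      have n0 := normL12_nonneg (truncation R u)
      have n1 := normL12_nonneg (truncation R v)
      exact mul_le_mul (hβ hα) (mul_le_mul_of_nonneg_right (add_le_add t3 t3') hD0)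
        (by positivity) hK₀'
    have key := normL12_add_le ((s1.sub s1').const_mul Gu) (s1'.const_mul (Gu - Gv))
      ((s1.const_mul Gu).sub (s1'.const_mul Gv)) fun p => by
        refine le_trans (le_of_eq ?_) (abs_add_le _ _)
        congr 1; ring
    rw [normL12_const_mul, normL12_const_mul, abs_of_pos (hG hα u).1] at key
    refine key.trans ?_
    calc _ ≤ (a₀ * h)⁻¹ * (K₀ * (R + R) * D) + L * (a₀ * h * h)⁻¹ * D * (K₀ * R ^ 2) := by
          refine add_le_add (mul_le_mul (hG hα u).2 hsub' (normL12_nonneg _) (by positivity))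
            (mul_le_mul hGd s2' (normL12_nonneg _) (by positivity))
      _ = ((a₀ * h)⁻¹ * (K₀ * (R + R)) + L * (a₀ * h * h)⁻¹ * (K₀ * R ^ 2)) * D := by ring
      _ ≤ _ := by
          rw [mul_assoc _ (2 : ℝ)]
          gcongr

end Solution

/-! ### Two facts on integral inequalities -/

/-- After the last time at which x ≥ 0 the function is negative, so its rate g is non-negative and x
cannot have decreased. -/
lemma nonneg_of_integral_eq {a₀ x₀ : ℝ} {x g : ℝ → ℝ} (hg : ∀ s, IntegrableOn g (Ioc a₀ s))
    (hx : ∀ s, a₀ ≤ s → x s = x₀ + ∫ r in Ioc a₀ s, g r) (hx₀ : 0 ≤ x₀)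
    (hsign : ∀ r, a₀ < r → x r ≤ 0 → 0 ≤ g r) {s : ℝ} (hs : a₀ ≤ s) : 0 ≤ x s := by
  by_contra hneg
  push Not at hneg
  have hcont : ContinuousOn x (Icc a₀ s) := by
    have h1 : IntegrableOn g (Icc a₀ s) := (integrableOn_Icc_iff_integrableOn_Ioc (by simp)).2 (hg s)
    exact (continuousOn_const.add (intervalIntegral.continuousOn_primitive h1)).congr
      fun r hr => hx r hr.1
  set T := Icc a₀ s ∩ x ⁻¹' Ici 0 with hT
  have hTc : IsCompact T := isCompact_Icc.of_isClosed_subset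
    (hcont.preimage_isClosed_of_isClosed isClosed_Icc isClosed_Ici) inter_subset_left
  have hne : T.Nonempty := ⟨a₀, ⟨le_rfl, hs⟩, by
    rw [mem_preimage, hx a₀ le_rfl]; simpa using hx₀⟩
  have hmem := hTc.sSup_mem hne
  set r₀ := sSup T with hr₀
  have hlt : ∀ r, r₀ < r → r ≤ s → x r < 0 := fun r h1 h2 => by
    by_contra h3
    push Not at h3
    exact absurd (le_csSup hTc.bddAbove (show r ∈ T from ⟨⟨hmem.1.1.trans h1.le, h2⟩, h3⟩))
      (not_le.2 h1)
  have hsplit : x s = x r₀ + ∫ r in Ioc r₀ s, g r := by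
    rw [hx s hs, hx r₀ hmem.1.1, ← Ioc_union_Ioc_eq_Ioc hmem.1.1 hmem.1.2,
      setIntegral_union (Ioc_disjoint_Ioc_of_le le_rfl) measurableSet_Ioc (hg r₀)
        ((hg s).mono_set (Ioc_subset_Ioc_left hmem.1.1)), add_assoc]
  have hpos : 0 ≤ ∫ r in Ioc r₀ s, g r := setIntegral_nonneg measurableSet_Ioc fun r hr =>
    hsign r (hmem.1.1.trans_lt hr.1) (hlt r hr.1 hr.2).le
  have : 0 ≤ x r₀ := hmem.2
  linarith

/-- Grönwall's inequality in integral form. -/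
lemma le_mul_exp_of_le_integral {n κ : ℝ → ℝ} (hn : Continuous n) (hκ : Continuous κ)
    (hκ0 : ∀ r, 0 ≤ κ r) {a₀ c : ℝ}
    (h : ∀ s, a₀ ≤ s → n s ≤ c + ∫ r in a₀..s, κ r * n r) {s : ℝ} (hs : a₀ ≤ s) :
    n s ≤ c * Real.exp (∫ r in a₀..s, κ r) := by
  set Φ : ℝ → ℝ := fun s => ∫ r in a₀..s, κ r with hΦ
  -- Integrating factor: by the assumed inequality the majorant c + ∫ κn times exp(-∫ κ) has
  -- non-positive derivative on [a₀, ∞).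
  set G : ℝ → ℝ := fun s => (c + ∫ r in a₀..s, κ r * n r) * Real.exp (-Φ s) with hG
  have hκn : Continuous fun r => κ r * n r := hκ.mul hn
  have hd (s : ℝ) : HasDerivAt G (κ s * n s * Real.exp (-Φ s) +
      (c + ∫ r in a₀..s, κ r * n r) * (Real.exp (-Φ s) * (-κ s))) s := by
    have h1 : HasDerivAt (fun s => ∫ r in a₀..s, κ r * n r) (κ s * n s) s :=
      intervalIntegral.integral_hasDerivAt_right (hκn.intervalIntegrable _ _)
        (hκn.stronglyMeasurableAtFilter _ _) hκn.continuousAt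
    have h2 : HasDerivAt Φ (κ s) s :=
      intervalIntegral.integral_hasDerivAt_right (hκ.intervalIntegrable _ _)
        (hκ.stronglyMeasurableAtFilter _ _) hκ.continuousAt
    exact (h1.const_add c).mul h2.neg.exp
  have hanti : AntitoneOn G (Ici a₀) := by
    refine antitoneOn_of_deriv_nonpos (convex_Ici a₀)
      (fun s _ => (hd s).continuousAt.continuousWithinAt)
      (fun s _ => (hd s).differentiableAt.differentiableWithinAt) fun s hs => ?_
    rw [interior_Ici] at hs
    rw [(hd s).deriv]
    have h1 := h s (le_of_lt hs)
    have h2 := mul_nonneg (hκ0 s) (Real.exp_pos (-Φ s)).le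
    nlinarith
  have h1 := hanti self_mem_Ici hs hs
  have h2 : G a₀ = c := by simp [hG, hΦ]
  rw [h2, hG] at h1
  have h3 : c + ∫ r in a₀..s, κ r * n r ≤ c * Real.exp (Φ s) := by
    have := mul_le_mul_of_nonneg_right h1 (Real.exp_pos (Φ s)).le
    beta_reduce at this
    rwa [mul_assoc, ← Real.exp_add, neg_add_cancel, Real.exp_zero, mul_one] at this
  exact (h s hs).trans h3

/-! ### The solution in comoving momenta -/

/-- A solution of the Boltzmann equation in comoving momenta, with the scale factor as a clock. -/
structure IsComovingSolution (A : Kernel) (a₀ Λ : ℝ) (u₀ : Mom → ℝ) (F : ℝ → Mom → ℝ) :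
    Prop where
  measurable : Measurable (Function.uncurry F)
  mem : ∀ s, a₀ ≤ s → MemL12 (F s)
  nonneg : ∀ᵐ y, ∀ s, a₀ ≤ s → 0 ≤ F s y
  bounded : ∃ r, ∀ s, a₀ ≤ s → normL12 (F s) ≤ r
  eq : ∀ᵐ y, ∀ s, a₀ ≤ s → IntegrableOn (fun r => comovingRHS A a₀ Λ r (F r) y) (Ioc a₀ s) ∧
    F s y = u₀ y + ∫ r in Ioc a₀ s, comovingRHS A a₀ Λ r (F r) y
  lipschitz : ∃ B, 0 ≤ B ∧ ∀ s t, a₀ ≤ s → s ≤ t →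
    normL12 (fun y => F t y - F s y) ≤ B * (t - s)
  weak : ∀ φ : Mom → ℝ, Measurable φ → ∀ c, (∀ y, |φ y| ≤ c * wt y) → ∀ s t, a₀ ≤ s → s ≤ t →
    ∫ y, φ y * (F t y - F s y) = ∫ r in Ioc s t, ∫ y, φ y * comovingRHS A a₀ Λ r (F r) y
  rotation : ∀ L : Mom ≃ₗᵢ[ℝ] Mom,
    (∀ α, 0 < α → ∀ p q p' q', A α (L p) (L q) (L p') (L q') = A α p q p' q') →
    (fun y => u₀ (L y)) =ᵐ[volume] u₀ → ∀ s, a₀ ≤ s → (fun y => F s (L y)) =ᵐ[volume] F s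

/-! ### A priori estimates for the truncated equation -/

section Existence

variable {A : Kernel} {a₀ Λ R C K B : ℝ} {u₀ : Mom → ℝ} {F : ℝ → Mom → ℝ}

lemma comovingRHS_truncation_nonneg (hκ : ∀ α, IsCrossSection (comovingKernel A a₀ α) C)
    (ha₀ : 0 < a₀) (hR : 0 < R) {α : ℝ} (hα : a₀ < α) {u : Mom → ℝ} {y : Mom} (hy : u y ≤ 0) :
    0 ≤ comovingRHS A a₀ Λ α (truncation R u) y := by
  refine mul_nonneg (inv_nonneg.2 (mul_nonneg (ha₀.trans hα).le (Real.sqrt_nonneg _))) ?_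
  exact source_nonneg_of_eq_zero (clock_param_le ha₀ hα.le).1 (hκ α).nonneg
    (truncation_nonneg hR u) (truncation_eq_zero hy)

/-- The truncation factor and H involve u only through isometry-invariant integrals, and the source
is equivariant. With uniqueness this yields rotation invariant solutions. -/
lemma comovingRHS_isometry (L : Mom ≃ₗᵢ[ℝ] Mom)
    (hAL : ∀ α, 0 < α → ∀ p q p' q', A α (L p) (L q) (L p') (L q') = A α p q p' q')
    (α : ℝ) (u : Mom → ℝ) (y : Mom) :
    comovingRHS A a₀ Λ α (truncation R fun y => u (L y)) y =
      comovingRHS A a₀ Λ α (truncation R u) (L y) := by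
  have h1 : truncation R (fun y => u (L y)) = fun y => truncation R u (L y) := by
    have : normL12 (fun y => u (L y)) = normL12 u := by
      rw [normL12, normL12, ← integral_isometry L fun p => √(1 + ‖p‖ ^ 2) * |u p|]
      simp only [L.norm_map]
    ext y
    rw [truncation, truncation, this]
  have h2 : hubble a₀ Λ α (fun y => truncation R u (L y)) = hubble a₀ Λ α (truncation R u) := by
    rw [hubble, hubble, ← integral_isometry L fun y => energy (a₀ ^ 2 / α) y * truncation R u y]
    simp only [energy_isometry]
  rw [h1, comovingRHS, comovingRHS, h2, source_isometry L]
  intro p q p' q'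
  unfold comovingKernel
  split_ifs with h
  · simpa only [map_smul] using (hAL α h ((a₀ ^ 2 / α ^ 2) • p) ((a₀ ^ 2 / α ^ 2) • q)
      ((a₀ ^ 2 / α ^ 2) • p') ((a₀ ^ 2 / α ^ 2) • q'))
  · rfl

variable (hS : IsLipschitzRHS (fun α u => comovingRHS A a₀ Λ α (truncation R u)) wtMeas a₀ K B)
  (hF : IsMildSolution (fun α u => comovingRHS A a₀ Λ α (truncation R u)) wtMeas a₀ u₀ F)

include hF in
lemma IsMildSolution.memL12 {s : ℝ} (hs : a₀ ≤ s) : MemL12 (F s) :=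
  (integrable_wtMeas_iff_memL12 hF.measurable.of_uncurry_left).1 (hF.integrable s hs)

include hS hF

lemma IsMildSolution.ae_nonneg (hκ : ∀ α, IsCrossSection (comovingKernel A a₀ α) C)
    (ha₀ : 0 < a₀) (hR : 0 < R) (hu₀ : ∀ y, 0 ≤ u₀ y) :
    ∀ᵐ y, ∀ s, a₀ ≤ s → 0 ≤ F s y := by
  rw [← ae_wtMeas_iff]
  filter_upwards [hF.eq, hS.ae_integrableOn hF.isAdmissible] with y h1 h2 s hs
  exact nonneg_of_integral_eq h2 h1 (hu₀ y)
    (fun r hr hy => comovingRHS_truncation_nonneg hκ ha₀ hR hr hy) hs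

lemma IsMildSolution.normL12_sub_le {s t : ℝ} (hs : a₀ ≤ s) (hst : s ≤ t) :
    normL12 (fun y => F t y - F s y) ≤ B * (t - s) := by
  have h1 := hF.integral_abs_increment_le hS hs hst
  have e := integral_abs_wtMeas fun y => F t y - F s y
  rw [e] at h1
  refine h1.trans ?_
  have h2 : ∫ r in Ioc s t, ∫ y, |comovingRHS A a₀ Λ r (truncation R (F r)) y| ∂wtMeas ≤
      ∫ _ in Ioc s t, B := by
    refine setIntegral_mono_on (hF.integrable_Ioc hS t hs).abs.integral_prod_left
      (by simp) measurableSet_Ioc fun r hr => ?_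
    exact hS.bounded r (hs.trans_lt hr.1) _ hF.measurable.of_uncurry_left
      (hF.integrable r (hs.trans hr.1.le))
  refine h2.trans (le_of_eq ?_)
  rw [setIntegral_const, Real.volume_real_Ioc_of_le hst, smul_eq_mul, mul_comm]

/-- φ may grow like the weight; with respect to the weighted measure it becomes the bounded test
function φ/w. -/
lemma IsMildSolution.weak {φ : Mom → ℝ} (hφm : Measurable φ) {c : ℝ}
    (hφ : ∀ y, |φ y| ≤ c * wt y) {s t : ℝ} (hs : a₀ ≤ s) (hst : s ≤ t) :
    ∫ y, φ y * (F t y - F s y) =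
      ∫ r in Ioc s t, ∫ y, φ y * comovingRHS A a₀ Λ r (truncation R (F r)) y := by
  have hb : ∀ y, |φ y / wt y| ≤ c := fun y => by
    rw [abs_div, abs_of_pos (wt_pos y), div_le_iff₀ (wt_pos y)]; exact hφ y
  have h := hF.integral_mul_increment hS (φ := fun y => φ y / wt y) (by fun_prop) hb hs hst
  have e (g : Mom → ℝ) : ∫ y, φ y / wt y * g y ∂wtMeas = ∫ y, φ y * g y := by
    rw [integral_wtMeas]
    refine integral_congr_ae (Eventually.of_forall fun y => ?_)
    have := (wt_pos y).ne'
    beta_reduce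
    field_simp
  rw [e fun y => F t y - F s y] at h
  simp only [e] at h
  exact h

/-- Truncation affects only the argument of the collision operator, so the number of particles is
still conserved; for non-negative functions it is the L¹ norm. -/
lemma IsMildSolution.normL1_eq (hκ : ∀ α, IsCrossSection (comovingKernel A a₀ α) C)
    (ha₀ : 0 < a₀) (hΛ : 0 < Λ) (hR : 0 < R) (hu₀ : ∀ y, 0 ≤ u₀ y) {s : ℝ} (hs : a₀ ≤ s) :
    normL1 (F s) = normL1 u₀ := by
  have h1 := hF.weak hS (φ := fun _ => 1) measurable_const (c := 1) one_le_wt_bound le_rfl hs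
  have h2 : ∫ r in Ioc a₀ s, ∫ y, 1 * comovingRHS A a₀ Λ r (truncation R (F r)) y = 0 := by
    refine setIntegral_eq_zero_of_forall_eq_zero fun r hr => ?_
    simp only [one_mul]
    have hm : Measurable (F r) := hF.measurable.of_uncurry_left
    exact (comovingRHS_bounds hκ ha₀ hΛ hr.1.le (measurable_truncation hm)
      (memL12_truncation hR hm (hF.memL12 hr.1.le))
      (Eventually.of_forall fun p => truncation_nonneg hR _ p)).2.1
  rw [h2] at h1
  simp only [one_mul] at h1
  rw [integral_sub (hF.memL12 hs).1 (hF.memL12 le_rfl).1] at h1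
  have h3 : F a₀ =ᵐ[volume] u₀ := by
    refine ae_wtMeas_iff.1 (hF.eq.mono fun y hy => ?_)
    simpa using hy a₀ le_rfl
  have h4 : normL1 (F s) = ∫ y, F s y := integral_congr_ae (by
    filter_upwards [hF.ae_nonneg hS hκ ha₀ hR hu₀] with y hy
    exact abs_of_nonneg (hy s hs))
  have h5 : normL1 u₀ = ∫ y, u₀ y :=
    integral_congr_ae (Eventually.of_forall fun y => abs_of_nonneg (hu₀ y))
  rw [h4, h5, ← integral_congr_ae h3]
  linarith

/-- The decisive estimate: the bound is independent of R and valid for all times. Truncation only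
decreases the two norms, the L¹ norm is constant, and the remaining linear inequality has the
coefficient k α⁻⁴, integrable at infinity. -/
lemma IsMildSolution.normL12_le (hκ : ∀ α, IsCrossSection (comovingKernel A a₀ α) C)
    (ha₀ : 0 < a₀) (hΛ : 0 < Λ) (hR : 0 < R) (hu₀ : ∀ y, 0 ≤ u₀ y) {k : ℝ}
    (hk : k = 4 * a₀ ^ 6 * C * sphMeas.real univ * (√(Λ / 3))⁻¹ * normL1 u₀) {s : ℝ}
    (hs : a₀ ≤ s) : normL12 (F s) ≤ normL12 u₀ * Real.exp (k * (a₀ ^ (-3 : ℤ) / 3)) := by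
  have hC := (hκ 0).const_nonneg
  have hk0 : 0 ≤ k := by
    rw [hk]
    have := normL1_nonneg u₀
    positivity
  have hF0 : normL12 (F a₀) = normL12 u₀ := normL12_congr (ae_wtMeas_iff.1 (hF.eq.mono
    fun y hy => by simpa using hy a₀ le_rfl))
  -- Freezing time below a₀ extends norm and coefficient continuously to the whole line, as
  -- Grönwall's lemma requires.
  set m : ℝ → ℝ := fun r => max a₀ r with hm
  have hmc : Continuous m := continuous_const.max continuous_id
  have hm0 (r : ℝ) : a₀ ≤ m r := le_max_left _ _
  set n : ℝ → ℝ := fun r => normL12 (F (m r)) with hn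
  have hmem {r : ℝ} (hr : a₀ ≤ r) := hF.memL12 hr
  have hLip {r t : ℝ} (hr : a₀ ≤ r) (hrt : r ≤ t) :
      |normL12 (F t) - normL12 (F r)| ≤ B * (t - r) := by
    have hd := (hmem (hr.trans hrt)).sub (hmem hr)
    have h1 := normL12_add_le (hmem hr) hd (hmem (hr.trans hrt)) fun p => by
      have := abs_add_le (F r p) (F t p - F r p); rwa [add_sub_cancel] at this
    have h2 := normL12_add_le (hmem (hr.trans hrt)) hd (hmem hr) fun p => by
      have := abs_sub (F t p) (F t p - F r p); rwa [sub_sub_cancel] at this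
    have h3 := hF.normL12_sub_le hS hr hrt
    rw [abs_le]; constructor <;> linarith
  have hB : 0 ≤ B := by
    have h1 := hF.normL12_sub_le hS le_rfl (show a₀ ≤ a₀ + 1 by linarith)
    have h2 := normL12_nonneg fun y => F (a₀ + 1) y - F a₀ y
    linarith
  have hnc : Continuous n := by
    have hl : LipschitzWith (Real.toNNReal B) n := LipschitzWith.of_dist_le_mul fun x y => by
      have hxy : |m x - m y| ≤ |x - y| := (abs_max_sub_max_le_max a₀ x a₀ y).trans (by simp)
      rw [Real.dist_eq, Real.dist_eq, Real.coe_toNNReal B hB]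
      refine le_trans ?_ (mul_le_mul_of_nonneg_left hxy hB)
      rcases le_total (m x) (m y) with h | h
      · rw [abs_sub_comm, abs_sub_comm (m x), abs_of_nonneg (sub_nonneg.2 h)]
        exact hLip (hm0 x) h
      · rw [abs_of_nonneg (sub_nonneg.2 h)]
        exact hLip (hm0 y) h
    exact hl.continuous
  set κ : ℝ → ℝ := fun r => k * (m r) ^ (-4 : ℤ) with hκd
  have hκc : Continuous κ := continuous_const.mul
    (hmc.zpow₀ _ fun r => Or.inl (ha₀.trans_le (hm0 r)).ne')
  have hκ0 (r : ℝ) : 0 ≤ κ r := mul_nonneg hk0 (zpow_nonneg (ha₀.le.trans (hm0 r)) _)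
  have hint (s : ℝ) (hs : a₀ ≤ s) : n s ≤ normL12 u₀ + ∫ r in a₀..s, κ r * n r := by
    have h1 := hF.integral_abs_increment_le hS le_rfl hs
    have e := integral_abs_wtMeas fun y => F s y - F a₀ y
    rw [e] at h1
    have h2 := normL12_add_le (hmem le_rfl) ((hmem hs).sub (hmem le_rfl)) (hmem hs) fun p => by
      have := abs_add_le (F a₀ p) (F s p - F a₀ p); rwa [add_sub_cancel] at this
    have h3 : ∫ r in Ioc a₀ s, ∫ y, |comovingRHS A a₀ Λ r (truncation R (F r)) y| ∂wtMeas ≤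
        ∫ r in Ioc a₀ s, κ r * n r := by
      refine setIntegral_mono_on (hF.integrable_Ioc hS s le_rfl).abs.integral_prod_left
        ((hκc.mul hnc).integrableOn_Ioc) measurableSet_Ioc fun r hr => ?_
      have e := integral_abs_wtMeas (comovingRHS A a₀ Λ r (truncation R (F r)))
      rw [e]
      have hFm : Measurable (F r) := hF.measurable.of_uncurry_left
      have ht := memL12_truncation hR hFm (hmem hr.1.le)
      have hb := (comovingRHS_bounds hκ ha₀ hΛ hr.1.le (measurable_truncation hFm) ht
        (Eventually.of_forall fun p => truncation_nonneg hR _ p)).2.2.2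
      refine hb.trans ?_
      have hmr : m r = r := max_eq_right hr.1.le
      simp only [hκd, hn, hmr]
      have b1 := normL12_mono (hmem hr.1.le) (measurable_truncation hFm) (abs_truncation_le hR (F r))
      have b2 := normL1_mono (hmem hr.1.le) (measurable_truncation hFm) (abs_truncation_le hR (F r))
      rw [hF.normL1_eq hS hκ ha₀ hΛ hR hu₀ hr.1.le] at b2
      have hr0 : 0 < r := ha₀.trans hr.1
      calc _ ≤ 4 * a₀ ^ 6 * C * sphMeas.real univ * (√(Λ / 3))⁻¹ * r ^ (-4 : ℤ) *
            (normL12 (F r) * normL1 u₀) := by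
            refine mul_le_mul_of_nonneg_left (mul_le_mul b1 b2 (normL1_nonneg _)
              (normL12_nonneg _)) (by positivity)
        _ = _ := by rw [hk]; ring
    rw [intervalIntegral.integral_of_le hs]
    have hms : m s = s := max_eq_right hs
    simp only [hn, hms]
    simp only [hn] at h3
    linarith
  have hgr := le_mul_exp_of_le_integral hnc hκc hκ0 hint hs
  have hms : m s = s := max_eq_right hs
  simp only [hn, hms] at hgr
  refine hgr.trans (mul_le_mul_of_nonneg_left (Real.exp_le_exp.2 ?_) (normL12_nonneg _))
  have h0 : (0 : ℝ) ∉ uIcc a₀ s := by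
    rw [uIcc_of_le hs]; exact fun h => absurd h.1 (not_le.2 ha₀)
  have h1 : ∫ r in a₀..s, κ r = k * ((s ^ (-3 : ℤ) - a₀ ^ (-3 : ℤ)) / (-3)) := by
    have : ∫ r in a₀..s, κ r = ∫ r in a₀..s, k * r ^ (-4 : ℤ) :=
      intervalIntegral.integral_congr fun r hr => by
        rw [uIcc_of_le hs] at hr
        simp only [hκd, hm, max_eq_right hr.1]
    rw [this, intervalIntegral.integral_const_mul, integral_zpow (Or.inr ⟨by norm_num, h0⟩)]
    norm_num
  rw [h1]
  refine mul_le_mul_of_nonneg_left ?_ hk0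
  -- The integral of r⁻⁴ over [a₀, s] is (a₀⁻³ - s⁻³)/3, and the second term is dropped.
  have h2 : 0 < s ^ (-3 : ℤ) := zpow_pos (ha₀.trans_le hs) _
  linarith

end Existence

/-- Global existence for the Boltzmann equation in comoving momenta. -/
theorem exists_isComovingSolution {A : Kernel} {a₀ Λ : ℝ} {u₀ : Mom → ℝ}
    (hA : IsCollisionKernel A) (ha₀ : 0 < a₀) (hΛ : 0 < Λ) (hu₀m : Measurable u₀)
    (hu₀ : MemL12 u₀) (hu₀0 : ∀ y, 0 ≤ u₀ y) :
    ∃ F, IsComovingSolution A a₀ Λ u₀ F := by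
  obtain ⟨⟨C, hκ⟩, -⟩ := hA.exists_isCrossSection a₀
  set k := 4 * a₀ ^ 6 * C * sphMeas.real univ * (√(Λ / 3))⁻¹ * normL1 u₀ with hk
  -- R exceeds the a priori bound, which does not involve R; the added 1 makes it positive for zero
  -- data too.
  set R := normL12 u₀ * Real.exp (k * (a₀ ^ (-3 : ℤ) / 3)) + 1 with hRd
  have hR : 0 < R := by
    have := normL12_nonneg u₀
    positivity
  obtain ⟨K, B, hK, hS⟩ := exists_isLipschitzRHS (R := R) hA ha₀ hΛ hR
  have hu₀i := (integrable_wtMeas_iff_memL12 hu₀m).2 hu₀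
  obtain ⟨F, hF⟩ := exists_isMildSolution hS hK hu₀m hu₀i
  have hbd {s : ℝ} (hs : a₀ ≤ s) : normL12 (F s) ≤ R :=
    (hF.normL12_le hS hκ ha₀ hΛ hR hu₀0 hk hs).trans (by linarith)
  have hpos := hF.ae_nonneg hS hκ ha₀ hR hu₀0
  have hFm (s : ℝ) : Measurable (F s) := hF.measurable.of_uncurry_left
  have htr {s : ℝ} (hs : a₀ ≤ s) : truncation R (F s) =ᵐ[volume] F s := by
    filter_upwards [hpos] with y hy
    exact truncation_eq_self hR (hbd hs) (hy s hs)
  have hrhs {s : ℝ} (hs : a₀ ≤ s) : comovingRHS A a₀ Λ s (truncation R (F s)) =ᵐ[volume]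
      comovingRHS A a₀ Λ s (F s) := by
    have h1 : hubble a₀ Λ s (truncation R (F s)) = hubble a₀ Λ s (F s) := by
      rw [hubble, hubble, integral_congr_ae]
      filter_upwards [htr hs] with y hy
      rw [hy]
    have h2 := source_congr_ae (clock_param_le ha₀ hs).1 (hκ s) (measurable_truncation (hFm s))
      (hFm s) (memL12_truncation hR (hFm s) (hF.memL12 hs)) (hF.memL12 hs) (htr hs)
    filter_upwards [h2] with y hy
    rw [comovingRHS, comovingRHS, h1, hy]
  have hB : 0 ≤ B := by
    have h1 := hF.normL12_sub_le hS le_rfl (show a₀ ≤ a₀ + 1 by linarith)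
    have h2 := normL12_nonneg fun y => F (a₀ + 1) y - F a₀ y
    linarith
  refine ⟨F, hF.measurable, fun s hs => hF.memL12 hs, hpos, ⟨R, fun s hs => hbd hs⟩, ?_,
    ⟨B, hB, fun s t hs hst => hF.normL12_sub_le hS hs hst⟩, ?_, ?_⟩
  · have h1 : ∀ᵐ s ∂volume.restrict (Ioi a₀), ∀ᵐ y : Mom,
        comovingRHS A a₀ Λ s (truncation R (F s)) y = comovingRHS A a₀ Λ s (F s) y :=
      (ae_restrict_mem measurableSet_Ioi).mono fun s hs => hrhs (le_of_lt hs)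
    have h2 := (Measure.ae_ae_comm
      (p := fun s y => comovingRHS A a₀ Λ s (truncation R (F s)) y = comovingRHS A a₀ Λ s (F s) y)
      (measurableSet_eq_fun (hS.measurable F hF.measurable)
        (measurable_comovingRHS hA hF.measurable))).1 h1
    filter_upwards [h2, ae_wtMeas_iff.1 hF.eq, ae_wtMeas_iff.1 (hS.ae_integrableOn hF.isAdmissible)]
      with y h3 h4 h5 s hs
    have h6 := ae_restrict_of_ae_restrict_of_subset (Ioc_subset_Ioi_self : Ioc a₀ s ⊆ Ioi a₀) h3
    exact ⟨(h5 s).congr h6, by rw [h4 s hs, integral_congr_ae h6]⟩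
  · intro φ hφm c hφ s t hs hst
    rw [hF.weak hS hφm hφ hs hst]
    refine setIntegral_congr_fun measurableSet_Ioc fun r hr => ?_
    refine integral_congr_ae ?_
    filter_upwards [hrhs (hs.trans hr.1.le)] with y hy
    rw [hy]
  · intro L hAL hL s hs
    have hLm : MeasurePreserving L volume volume := L.measurePreserving
    -- The rotated solution solves the same truncated equation with the same data, so uniqueness
    -- identifies the two.
    have hG : IsMildSolution (fun α u => comovingRHS A a₀ Λ α (truncation R u)) wtMeas a₀ u₀
        fun s y => F s (L y) := by
      refine ⟨hF.measurable.comp (measurable_fst.prodMk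
        (L.continuous.measurable.comp measurable_snd)), fun s hs => ?_, ?_⟩
      · have hm : Measurable fun y => F s (L y) := (hFm s).comp L.continuous.measurable
        refine (integrable_wtMeas_iff_memL12 hm).2 (memL12_of_measurable hm ?_)
        have := hLm.integrable_comp_of_integrable (hF.memL12 hs).2
        refine this.congr (Eventually.of_forall fun y => ?_)
        simp only [Function.comp_apply, L.norm_map, wt]
      · rw [ae_wtMeas_iff]
        filter_upwards [hL, hLm.quasiMeasurePreserving.ae (ae_wtMeas_iff.1 hF.eq)] with y h1 h2 s hs
        rw [h2 s hs, h1]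
        simp only [comovingRHS_isometry L hAL]
    have := hG.unique hS hK hu₀i hF
    exact (ae_wtMeas_iff.1 this).mono fun y hy => hy s hs

/-! ### Energy density and pressure along the solution -/

/-- The integrand `β² |y|² / y⁰` of (three times) the pressure. -/
def flux (β : ℝ) (y : Mom) : ℝ := β ^ 2 * ‖y‖ ^ 2 / energy β y

/-- The energy density when the expansion factor is `α`. -/
def energyDensity (a₀ : ℝ) (F : ℝ → Mom → ℝ) (α : ℝ) : ℝ :=
  (a₀ ^ 2 / α) ^ 3 * ∫ y, energy (a₀ ^ 2 / α) y * F α y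

/-- The pressure when the expansion factor is `α`. -/
def pressure (a₀ : ℝ) (F : ℝ → Mom → ℝ) (α : ℝ) : ℝ :=
  (a₀ ^ 2 / α) ^ 3 * (∫ y, flux (a₀ ^ 2 / α) y * F α y) / 3

lemma flux_nonneg (β : ℝ) (y : Mom) : 0 ≤ flux β y :=
  div_nonneg (by positivity) (energy_pos _ _).le

lemma flux_le_energy (β : ℝ) (y : Mom) : flux β y ≤ energy β y := by
  rw [flux, div_le_iff₀ (energy_pos _ _), ← sq, energy_sq]
  linarith

lemma measurable_flux (β : ℝ) : Measurable (flux β) := by unfold flux; fun_prop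

lemma abs_energy_sub_energy_le (β γ : ℝ) (y : Mom) :
    |energy β y - energy γ y| ≤ |β - γ| * ‖y‖ := by
  have h1 : (energy β y - energy γ y) * (energy β y + energy γ y) =
      ((β - γ) * ‖y‖) * ((β + γ) * ‖y‖) := by
    linear_combination energy_sq β y - energy_sq γ y
  have hb (β : ℝ) : |β| * ‖y‖ ≤ energy β y := by
    refine Real.le_sqrt_of_sq_le ?_
    rw [mul_pow, sq_abs]; linarith
  have hpos : 0 < energy β y + energy γ y := add_pos (energy_pos _ _) (energy_pos _ _)
  have h2 : |(β + γ) * ‖y‖| ≤ energy β y + energy γ y := by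
    rw [abs_mul, abs_norm]
    calc |β + γ| * ‖y‖ ≤ (|β| + |γ|) * ‖y‖ := by gcongr; exact abs_add_le _ _
      _ ≤ _ := by rw [add_mul]; exact add_le_add (hb β) (hb γ)
  have h3 : |energy β y - energy γ y| * (energy β y + energy γ y) ≤
      |β - γ| * ‖y‖ * (energy β y + energy γ y) := by
    calc _ = |(energy β y - energy γ y) * (energy β y + energy γ y)| := by
          rw [abs_mul, abs_of_pos hpos]
      _ = |β - γ| * ‖y‖ * |(β + γ) * ‖y‖| := by rw [h1, abs_mul, abs_mul (β - γ), abs_norm]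
      _ ≤ _ := mul_le_mul_of_nonneg_left h2 (by positivity)
  exact le_of_mul_le_mul_right h3 hpos

lemma norm_le_wt (y : Mom) : ‖y‖ ≤ wt y := by
  refine Real.le_sqrt_of_sq_le ?_
  linarith

/-- The constant is 1 because a₀²/(rs) ≤ 1 and |y| is at most the weight. -/
lemma abs_energy_clock_sub_le {a₀ r s : ℝ} (ha₀ : 0 < a₀) (hr : a₀ ≤ r) (hs : a₀ ≤ s) (y : Mom) :
    |energy (a₀ ^ 2 / r) y - energy (a₀ ^ 2 / s) y| ≤ |r - s| * wt y := by
  refine (abs_energy_sub_energy_le _ _ y).trans ?_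
  have hr0 := ha₀.trans_le hr
  have hs0 := ha₀.trans_le hs
  have h : a₀ ^ 2 / r - a₀ ^ 2 / s = a₀ ^ 2 / (r * s) * (s - r) := by
    field_simp
  have h1 : a₀ ^ 2 / (r * s) ≤ 1 := by
    rw [div_le_one (by positivity), sq]
    gcongr
  refine mul_le_mul ?_ (norm_le_wt y) (norm_nonneg _) (abs_nonneg _)
  rw [h, abs_mul, abs_of_pos (by positivity), abs_sub_comm s]
  exact mul_le_of_le_one_left (abs_nonneg _) h1

lemma hasDerivAt_energy_clock (a₀ : ℝ) {α : ℝ} (hα : α ≠ 0) (y : Mom) :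
    HasDerivAt (fun α => energy (a₀ ^ 2 / α) y) (-(flux (a₀ ^ 2 / α) y / α)) α := by
  have h1 : HasDerivAt (fun α : ℝ => a₀ ^ 2 / α) (-(a₀ ^ 2 / α) / α) α := by
    have := (hasDerivAt_inv hα).const_mul (a₀ ^ 2)
    refine this.congr_deriv ?_
    field_simp
  have h2 : HasDerivAt (fun α : ℝ => 1 + (a₀ ^ 2 / α) ^ 2 * ‖y‖ ^ 2)
      (2 * (a₀ ^ 2 / α) * (-(a₀ ^ 2 / α) / α) * ‖y‖ ^ 2) α := by
    have := ((h1.pow 2).mul_const (‖y‖ ^ 2)).const_add 1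
    refine this.congr_deriv ?_
    norm_num
  have h3 := h2.sqrt (by positivity)
  refine h3.congr_deriv ?_
  have hE := energy_pos (a₀ ^ 2 / α) y
  rw [flux, ← energy]
  field_simp

/-! ### Differentiability of the energy density -/

section Density

variable {A : Kernel} {a₀ Λ : ℝ} {u₀ : Mom → ℝ} {F : ℝ → Mom → ℝ}

lemma abs_flux_clock_le (ha₀ : 0 < a₀) {α : ℝ} (hα : a₀ ≤ α) (y : Mom) :
    |flux (a₀ ^ 2 / α) y| ≤ (1 + a₀) * wt y := by
  rw [abs_of_nonneg (flux_nonneg _ _)]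
  exact (flux_le_energy _ _).trans ((le_abs_self _).trans (energy_le_of_param_le ha₀ hα y))

/-- Moments of the solution are continuous. -/
lemma IsComovingSolution.continuousOn_moment (hF : IsComovingSolution A a₀ Λ u₀ F)
    {φ : ℝ → Mom → ℝ} (hφm : ∀ α, Measurable (φ α)) {c : ℝ}
    (hφ : ∀ α, a₀ ≤ α → ∀ y, |φ α y| ≤ c * wt y)
    (hφc : ∀ y, ContinuousOn (fun α => φ α y) (Ici a₀)) :
    ContinuousOn (fun α => ∫ y, φ α y * F α y) (Ici a₀) := by
  intro α hα
  obtain ⟨B, hB, hL⟩ := hF.lipschitz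
  have hc : 0 ≤ c := by
    have := (abs_nonneg _).trans (hφ a₀ le_rfl 0)
    exact nonneg_of_mul_nonneg_left this (wt_pos 0)
  -- With the distribution frozen at α, the varying weight is handled by dominated convergence.
  -- Replacing F α by F s then costs at most cB|s - α|.
  have h1 : Tendsto (fun s => ∫ y, φ s y * F α y) (𝓝[Ici a₀] α) (𝓝 (∫ y, φ α y * F α y)) := by
    refine tendsto_integral_filter_of_dominated_convergence (fun y => c * (wt y * |F α y|))
      (Eventually.of_forall fun s => ?_) ?_ ((hF.mem α hα).weighted.const_mul c)
      (Eventually.of_forall fun y => ((hφc y) α hα).mul tendsto_const_nhds)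
    · exact (hφm s).aestronglyMeasurable.mul (hF.mem α hα).1.aestronglyMeasurable
    · filter_upwards [self_mem_nhdsWithin] with s hs
      refine Eventually.of_forall fun y => ?_
      rw [Real.norm_eq_abs, abs_mul, ← mul_assoc]
      exact mul_le_mul_of_nonneg_right (hφ s hs y) (abs_nonneg _)
  have h2 : Tendsto (fun s => ∫ y, φ s y * (F s y - F α y)) (𝓝[Ici a₀] α) (𝓝 0) := by
    have h3 : Tendsto (fun s => c * (B * |s - α|)) (𝓝[Ici a₀] α) (𝓝 0) := by
      have : ContinuousAt (fun s => c * (B * |s - α|)) α := by fun_prop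
      have h := this.tendsto
      simp only [sub_self, abs_zero, mul_zero] at h
      exact h.mono_left nhdsWithin_le_nhds
    refine squeeze_zero_norm' ?_ h3
    filter_upwards [self_mem_nhdsWithin] with s hs
    refine (((hF.mem s hs).sub (hF.mem α hα)).integrable_mul (hφm s) (hφ s hs)).2.trans ?_
    refine mul_le_mul_of_nonneg_left ?_ hc
    rcases le_total α s with h | h
    · rw [abs_of_nonneg (sub_nonneg.2 h)]
      exact hL α s hα h
    · rw [abs_sub_comm, abs_of_nonneg (sub_nonneg.2 h)]
      have := hL s α hs h
      refine le_trans (le_of_eq ?_) this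
      rw [normL12, normL12]
      simp only [abs_sub_comm]
  have h4 := h1.add h2
  rw [add_zero] at h4
  refine h4.congr' ?_
  filter_upwards [self_mem_nhdsWithin] with s hs
  have i1 := ((hF.mem α hα).integrable_mul (hφm s) (hφ s hs)).1
  have i2 := (((hF.mem s hs).sub (hF.mem α hα)).integrable_mul (hφm s) (hφ s hs)).1
  rw [← integral_add i1 i2]
  congr 1; ext y; ring

lemma continuousOn_clock_param (ha₀ : 0 < a₀) :
    ContinuousOn (fun α : ℝ => a₀ ^ 2 / α) (Ici a₀) :=
  continuousOn_const.div continuousOn_id fun _ hα => (ha₀.trans_le hα).ne'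

lemma IsComovingSolution.continuousOn_pressure (hF : IsComovingSolution A a₀ Λ u₀ F)
    (ha₀ : 0 < a₀) : ContinuousOn (pressure a₀ F) (Ici a₀) := by
  have hβ := continuousOn_clock_param ha₀
  refine ContinuousOn.div_const ((hβ.pow 3).mul
    (hF.continuousOn_moment (φ := fun α => flux (a₀ ^ 2 / α)) (fun _ => measurable_flux _)
    (fun _ hα => abs_flux_clock_le ha₀ hα) fun y => ?_)) 3
  unfold flux energy
  refine ((hβ.pow 2).mul continuousOn_const).div
    (continuousOn_const.add ((hβ.pow 2).mul continuousOn_const)).sqrt fun α _ => ?_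
  exact (energy_pos (a₀ ^ 2 / α) y).ne'

lemma IsComovingSolution.exists_rhs_bound (hF : IsComovingSolution A a₀ Λ u₀ F)
    (hA : IsCollisionKernel A) (ha₀ : 0 < a₀) (hΛ : 0 < Λ) :
    ∃ M, ∀ r, a₀ ≤ r → MemL12 (comovingRHS A a₀ Λ r (F r)) ∧
      ∫ y, energy (a₀ ^ 2 / r) y * comovingRHS A a₀ Λ r (F r) y = 0 ∧
      normL12 (comovingRHS A a₀ Λ r (F r)) ≤ M := by
  obtain ⟨⟨C, hκ⟩, -⟩ := hA.exists_isCrossSection a₀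
  obtain ⟨R, hR⟩ := hF.bounded
  have hC := (hκ 0).const_nonneg
  refine ⟨4 * a₀ ^ 6 * C * sphMeas.real univ * (√(Λ / 3))⁻¹ * a₀ ^ (-4 : ℤ) * (R * R),
    fun r hr => ?_⟩
  have hFm : Measurable (F r) := hF.measurable.of_uncurry_left
  obtain ⟨h1, -, h3, h4⟩ := comovingRHS_bounds (Λ := Λ) hκ ha₀ hΛ hr hFm (hF.mem r hr)
    (hF.nonneg.mono fun y hy => hy r hr)
  refine ⟨h1, h3, h4.trans ?_⟩
  have b1 := hR r hr
  have b2 := (normL1_le_normL12 (hF.mem r hr)).trans b1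
  have b3 := normL12_nonneg (F r)
  have b4 := normL1_nonneg (F r)
  have b5 : r ^ (-4 : ℤ) ≤ a₀ ^ (-4 : ℤ) := by
    rw [zpow_neg, zpow_neg, zpow_ofNat, zpow_ofNat]
    gcongr
  have b6 : 0 ≤ r ^ (-4 : ℤ) := zpow_nonneg (ha₀.le.trans hr) _
  have b7 : normL12 (F r) * normL1 (F r) ≤ R * R := mul_le_mul b1 b2 b4 (b3.trans b1)
  have b8 : 0 ≤ 4 * a₀ ^ 6 * C * sphMeas.real univ * (√(Λ / 3))⁻¹ := by positivity
  exact mul_le_mul (mul_le_mul_of_nonneg_left b5 b8) b7 (mul_nonneg b3 b4)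
    (mul_nonneg b8 (b6.trans b5))

/-- Conservation of energy in collisions: the increments of the solution contribute to the
energy at second order only. -/
lemma IsComovingSolution.abs_integral_energy_increment_le (hF : IsComovingSolution A a₀ Λ u₀ F)
    (ha₀ : 0 < a₀) {M : ℝ} (hM : ∀ r, a₀ ≤ r → MemL12 (comovingRHS A a₀ Λ r (F r)) ∧
      ∫ y, energy (a₀ ^ 2 / r) y * comovingRHS A a₀ Λ r (F r) y = 0 ∧
      normL12 (comovingRHS A a₀ Λ r (F r)) ≤ M) {s t x : ℝ} (hs : a₀ ≤ s) (hst : s ≤ t)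
    (hx : x ∈ Icc s t) :
    |∫ y, energy (a₀ ^ 2 / x) y * (F t y - F s y)| ≤ M * (t - s) * (t - s) := by
  have hxa : a₀ ≤ x := hs.trans hx.1
  rw [hF.weak (energy (a₀ ^ 2 / x)) (by fun_prop) _ (energy_le_of_param_le ha₀ hxa) s t hs hst]
  have hb : ∀ r ∈ Ioc s t, ‖∫ y, energy (a₀ ^ 2 / x) y * comovingRHS A a₀ Λ r (F r) y‖ ≤
      M * (t - s) := by
    intro r hr
    have hra : a₀ ≤ r := hs.trans hr.1.le
    obtain ⟨h1, h2, h3⟩ := hM r hra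
    have i1 := (h1.integrable_mul (φ := energy (a₀ ^ 2 / x)) (by fun_prop)
      (energy_le_of_param_le ha₀ hxa)).1
    have i2 := (h1.integrable_mul (φ := energy (a₀ ^ 2 / r)) (by fun_prop)
      (energy_le_of_param_le ha₀ hra)).1
    -- The energy belonging to the clock value r integrates to zero against the right-hand side at
    -- r. Only the difference of two energies survives, and it is of order t - s.
    have e : ∫ y, energy (a₀ ^ 2 / x) y * comovingRHS A a₀ Λ r (F r) y =
        ∫ y, (energy (a₀ ^ 2 / x) y - energy (a₀ ^ 2 / r) y) *
          comovingRHS A a₀ Λ r (F r) y := by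
      simp_rw [sub_mul]
      rw [integral_sub i1 i2, h2, sub_zero]
    rw [e]
    refine (h1.integrable_mul (by fun_prop) (abs_energy_clock_sub_le ha₀ hxa hra)).2.trans ?_
    rw [mul_comm M]
    refine mul_le_mul (abs_le.2 ⟨?_, ?_⟩) h3 (normL12_nonneg _) (by linarith)
    · linarith [hx.1, hr.2]
    · linarith [hx.2, hr.1]
  have := norm_setIntegral_le_of_norm_le_const (μ := volume) (s := Ioc s t) (by simp) hb
  rwa [Real.volume_real_Ioc_of_le hst, Real.norm_eq_abs] at this

/-- F itself is only known to be Lipschitz in α. Its increments enter at second order by energy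
conservation, so only the explicit dependence of the particle energy on α contributes to the
derivative. -/
lemma IsComovingSolution.hasDerivWithinAt_energy (hF : IsComovingSolution A a₀ Λ u₀ F)
    (hA : IsCollisionKernel A) (ha₀ : 0 < a₀) (hΛ : 0 < Λ) {α : ℝ} (hα : a₀ ≤ α) :
    HasDerivWithinAt (fun α => ∫ y, energy (a₀ ^ 2 / α) y * F α y)
      (-((∫ y, flux (a₀ ^ 2 / α) y * F α y) / α)) (Ici a₀) α := by
  obtain ⟨M, hM⟩ := hF.exists_rhs_bound hA ha₀ hΛ
  have hα0 := ha₀.trans_le hα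
  have hem (β : ℝ) : Measurable (energy β) := by fun_prop
  have hmem := hF.mem α hα
  have h1 : HasDerivAt (fun s => ∫ y, energy (a₀ ^ 2 / s) y * F α y)
      (∫ y, -(flux (a₀ ^ 2 / α) y / α) * F α y) α := by
    -- Above α/2 the clock stays away from zero, so the derivative of the energy is bounded by a
    -- fixed multiple of the weight.
    refine (hasDerivAt_integral_of_dominated_loc_of_deriv_le (s := Ioi (α / 2))
      (bound := fun y => (1 + a₀ ^ 2 / (α / 2)) / (α / 2) * (wt y * |F α y|))
      (F' := fun s y => -(flux (a₀ ^ 2 / s) y / s) * F α y)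
      (Ioi_mem_nhds (by linarith)) (Eventually.of_forall fun s => ?_) ?_ ?_ ?_
      (hmem.weighted.const_mul _) ?_).2
    · exact (hem _).aestronglyMeasurable.mul hmem.1.aestronglyMeasurable
    · exact (hmem.integrable_mul (hem _) (energy_le_of_param_le ha₀ hα)).1
    · exact ((measurable_flux _).div_const _).neg.aestronglyMeasurable.mul
        hmem.1.aestronglyMeasurable
    · refine Eventually.of_forall fun y s hs => ?_
      have hs : α / 2 < s := hs
      have hs0 : 0 < s := lt_trans (by positivity) hs
      rw [Real.norm_eq_abs, abs_mul, ← mul_assoc, abs_neg,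
        abs_of_nonneg (div_nonneg (flux_nonneg _ _) hs0.le)]
      refine mul_le_mul_of_nonneg_right ?_ (abs_nonneg _)
      have k1 := (flux_le_energy (a₀ ^ 2 / s) y).trans
        ((le_abs_self _).trans (energy_le_wt (α := a₀ ^ 2 / s) (by positivity) y))
      have hw := wt_pos y
      calc flux (a₀ ^ 2 / s) y / s ≤ (1 + a₀ ^ 2 / s) * wt y / s := by gcongr
        _ ≤ (1 + a₀ ^ 2 / (α / 2)) * wt y / (α / 2) := by gcongr
        _ = _ := by ring
    · refine Eventually.of_forall fun y s hs => ?_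
      have hs0 : 0 < s := lt_trans (by positivity) (show α / 2 < s from hs)
      exact (hasDerivAt_energy_clock a₀ hs0.ne' y).mul_const _
  have h2 : HasDerivWithinAt (fun s => ∫ y, energy (a₀ ^ 2 / s) y * (F s y - F α y)) 0
      (Ici a₀) α := by
    rw [hasDerivWithinAt_iff_isLittleO]
    have hO : (fun s => ∫ y, energy (a₀ ^ 2 / s) y * (F s y - F α y)) =O[𝓝[Ici a₀] α]
        fun s => ‖s - α‖ ^ 2 := by
      refine Asymptotics.IsBigO.of_bound M ?_
      filter_upwards [self_mem_nhdsWithin] with s hs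
      rw [Real.norm_eq_abs, norm_pow, norm_norm, Real.norm_eq_abs, sq_abs]
      rcases le_total α s with h | h
      · have := hF.abs_integral_energy_increment_le ha₀ hM hα h ⟨h, le_rfl⟩
        linarith [mul_assoc M (s - α) (s - α), sq (s - α)]
      · have := hF.abs_integral_energy_increment_le ha₀ hM hs h ⟨le_rfl, h⟩
        have e : ∫ y, energy (a₀ ^ 2 / s) y * (F s y - F α y) =
            -∫ y, energy (a₀ ^ 2 / s) y * (F α y - F s y) := by
          rw [← integral_neg]; congr 1; ext y; ring
        rw [e, abs_neg]
        refine this.trans (le_of_eq (by ring))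
    have ho : (fun s : ℝ => ‖s - α‖ ^ 2) =o[𝓝[Ici a₀] α] fun s => s - α := by
      refine (Asymptotics.isLittleO_pow_sub_sub α one_lt_two).mono nhdsWithin_le_nhds
    simpa using hO.trans_isLittleO ho
  have h3 := (h1.hasDerivWithinAt (s := Ici a₀)).add h2
  refine (h3.congr_of_mem ?_ hα).congr_deriv ?_
  · intro s hs
    have i1 := (hmem.integrable_mul (hem (a₀ ^ 2 / s)) (energy_le_of_param_le ha₀ hs)).1
    have i2 := (((hF.mem s hs).sub hmem).integrable_mul (hem (a₀ ^ 2 / s))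
      (energy_le_of_param_le ha₀ hs)).1
    rw [Pi.add_apply, ← integral_add i1 i2]
    congr 1; ext y; ring
  · rw [add_zero, ← integral_div, ← integral_neg]
    congr 1; ext y; ring

/-- Energy balance. -/
lemma IsComovingSolution.hasDerivWithinAt_energyDensity (hF : IsComovingSolution A a₀ Λ u₀ F)
    (hA : IsCollisionKernel A) (ha₀ : 0 < a₀) (hΛ : 0 < Λ) {α : ℝ} (hα : a₀ ≤ α) :
    HasDerivWithinAt (energyDensity a₀ F) (-(3 / α * (energyDensity a₀ F α + pressure a₀ F α)))
      (Ici a₀) α := by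
  have hα0 := (ha₀.trans_le hα).ne'
  have h1 : HasDerivAt (fun α : ℝ => a₀ ^ 2 / α) (-(a₀ ^ 2 / α) / α) α := by
    have := (hasDerivAt_inv hα0).const_mul (a₀ ^ 2)
    refine this.congr_deriv ?_
    field_simp
  have h2 := ((h1.pow 3).hasDerivWithinAt (s := Ici a₀)).mul
    (hF.hasDerivWithinAt_energy hA ha₀ hΛ hα)
  refine h2.congr_deriv ?_
  rw [energyDensity, pressure]
  simp only [Pi.pow_apply]
  generalize (∫ y, energy (a₀ ^ 2 / α) y * F α y) = I
  generalize (∫ y, flux (a₀ ^ 2 / α) y * F α y) = J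
  push_cast
  field_simp
  ring

lemma IsComovingSolution.energyDensity_nonneg (hF : IsComovingSolution A a₀ Λ u₀ F)
    (ha₀ : 0 < a₀) {α : ℝ} (hα : a₀ ≤ α) : 0 ≤ energyDensity a₀ F α := by
  have := (clock_param_le ha₀ hα).1
  refine mul_nonneg (by positivity) (integral_nonneg_of_ae ?_)
  filter_upwards [hF.nonneg] with y hy
  exact mul_nonneg (energy_pos _ _).le (hy α hα)

lemma IsComovingSolution.exists_energyDensity_le (hF : IsComovingSolution A a₀ Λ u₀ F)
    (ha₀ : 0 < a₀) : ∃ ρ, ∀ α, a₀ ≤ α → energyDensity a₀ F α ≤ ρ := by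
  obtain ⟨R, hR⟩ := hF.bounded
  refine ⟨a₀ ^ 3 * ((1 + a₀) * R), fun α hα => ?_⟩
  obtain ⟨h1, h2⟩ := clock_param_le ha₀ hα
  have h3 := ((hF.mem α hα).integrable_mul (φ := energy (a₀ ^ 2 / α)) (by fun_prop)
    (energy_le_of_param_le ha₀ hα)).2
  have h4 : |∫ y, energy (a₀ ^ 2 / α) y * F α y| ≤ (1 + a₀) * R :=
    h3.trans (mul_le_mul_of_nonneg_left (hR α hα) (by positivity))
  calc energyDensity a₀ F α ≤ (a₀ ^ 2 / α) ^ 3 * |∫ y, energy (a₀ ^ 2 / α) y * F α y| :=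
        mul_le_mul_of_nonneg_left (le_abs_self _) (by positivity)
    _ ≤ _ := by
        gcongr

end Density

/-! ### The scale factor as a function of time -/

/-- Global solutions of a scalar autonomous equation with a continuous right-hand side which is
bounded and bounded away from zero. -/
lemma exists_autonomous_solution {v : ℝ → ℝ} (hv : Continuous v) {m M : ℝ} (hm : 0 < m)
    (hmv : ∀ x, m ≤ v x) (hvM : ∀ x, v x ≤ M) (x₀ : ℝ) :
    ∃ τ : ℝ → ℝ, τ 0 = x₀ ∧ ∀ t, HasDerivAt τ (v (τ t)) t := by
  have hv0 (x : ℝ) : 0 < v x := hm.trans_le (hmv x)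
  have hM : 0 < M := (hv0 0).trans_le (hvM 0)
  have hw : Continuous fun x => (v x)⁻¹ := hv.inv₀ fun x => (hv0 x).ne'
  -- Separation of variables: T(x) is the time needed to reach x from x₀, and the solution is its
  -- inverse. Continuity of v suffices.
  set T : ℝ → ℝ := fun x => ∫ r in x₀..x, (v r)⁻¹ with hT
  have hd (x : ℝ) : HasDerivAt T (v x)⁻¹ x :=
    intervalIntegral.integral_hasDerivAt_right (hw.intervalIntegrable _ _)
      (hw.stronglyMeasurableAtFilter _ _) hw.continuousAt
  have hTc : Continuous T := continuous_iff_continuousAt.2 fun x => (hd x).continuousAt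
  have hmono : StrictMono T := strictMono_of_deriv_pos fun x => by
    rw [(hd x).deriv]; exact inv_pos.2 (hv0 x)
  -- The upper bound on v makes T grow at least linearly, so T is onto and the solution exists for
  -- all times.
  have hgrow : Monotone fun x => T x - M⁻¹ * x := by
    refine monotone_of_deriv_nonneg (fun x => ((hd x).sub
      ((hasDerivAt_id x).const_mul M⁻¹)).differentiableAt) fun x => ?_
    have := ((hd x).sub ((hasDerivAt_id x).const_mul M⁻¹)).deriv
    have e : deriv (fun x => T x - M⁻¹ * x) x = (v x)⁻¹ - M⁻¹ * 1 := this
    rw [e, mul_one, sub_nonneg]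
    exact inv_anti₀ (hv0 x) (hvM x)
  have hsurj : Function.Surjective T := by
    refine hTc.surjective ?_ ?_
    · refine tendsto_atTop_mono' atTop (f₁ := fun x => M⁻¹ * x + (T 0 - M⁻¹ * 0)) ?_ ?_
      · filter_upwards [eventually_ge_atTop 0] with x hx
        have := hgrow hx
        beta_reduce at this
        linarith
      · exact tendsto_atTop_add_const_right _ _ (tendsto_id.const_mul_atTop (inv_pos.2 hM))
    · refine tendsto_atBot_mono' atBot (f₁ := fun x => M⁻¹ * x + (T 0 - M⁻¹ * 0)) ?_ ?_
      · filter_upwards [eventually_le_atBot 0] with x hx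
        have := hgrow hx
        beta_reduce at this
        linarith
      · exact tendsto_atBot_add_const_right _ _ (tendsto_id.const_mul_atBot (inv_pos.2 hM))
  set e := hmono.orderIsoOfSurjective T hsurj with he
  have heT (x : ℝ) : T (e.symm x) = x := hmono.orderIsoOfSurjective_self_symm_apply T hsurj x
  refine ⟨e.symm, ?_, fun t => ?_⟩
  · refine hmono.injective ?_
    rw [heT]
    simp [hT]
  · have := HasDerivAt.of_local_left_inverse (f := T) (g := e.symm) (a := t)
      e.symm.continuous.continuousAt (hd (e.symm t)) (inv_pos.2 (hv0 _)).ne'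
      (Eventually.of_forall heT)
    rwa [inv_inv] at this

/-- The equation `ȧ = a H(a)` for the scale factor. -/
lemma exists_scale_factor {a₀ h M : ℝ} (ha₀ : 0 < a₀) (hh : 0 < h) {H H' : ℝ → ℝ}
    (hH : ∀ α, a₀ ≤ α → HasDerivWithinAt H (H' α) (Ici a₀) α) (hH' : ContinuousOn H' (Ici a₀))
    (hle : ∀ α, a₀ ≤ α → h ≤ H α) (hM : ∀ α, a₀ ≤ α → H α ≤ M) :
    ∃ a : ℝ → ℝ, a 0 = a₀ ∧ (∀ t, 0 < a t) ∧ Continuous a ∧ StrictMono a ∧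
      (∀ t, 0 ≤ t → a₀ ≤ a t) ∧ (∀ t, 0 ≤ t → HasDerivAt a (a t * H (a t)) t) ∧
      (∀ t, 0 ≤ t → HasDerivWithinAt (fun t => H (a t)) (H' (a t) * (a t * H (a t))) (Ici 0) t) ∧
      ContDiffOn ℝ 2 a (Ici 0) := by
  have hHc : ContinuousOn H (Ici a₀) := fun α hα => (hH α hα).continuousWithinAt
  -- For τ = log a the equation becomes τ̇ = H(exp τ), whose right-hand side is bounded. The maximum
  -- extends H below a₀, a region not visited for t ≥ 0.
  set v : ℝ → ℝ := fun x => H (max a₀ (Real.exp x)) with hv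
  have hmax (x : ℝ) : a₀ ≤ max a₀ (Real.exp x) := le_max_left _ _
  have hvc : Continuous v :=
    hHc.comp_continuous (continuous_const.max Real.continuous_exp) hmax
  obtain ⟨τ, hτ0, hτ⟩ := exists_autonomous_solution hvc hh (fun x => hle _ (hmax x))
    (fun x => hM _ (hmax x)) (Real.log a₀)
  have hv0 (x : ℝ) : 0 < v x := hh.trans_le (hle _ (hmax x))
  set a : ℝ → ℝ := fun t => Real.exp (τ t) with ha
  have had (t : ℝ) : HasDerivAt a (a t * v (τ t)) t := (hτ t).exp
  have ha0 : a 0 = a₀ := by rw [ha]; beta_reduce; rw [hτ0, Real.exp_log ha₀]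
  have hpos (t : ℝ) : 0 < a t := Real.exp_pos _
  have hac : Continuous a := continuous_iff_continuousAt.2 fun t => (had t).continuousAt
  have hmono : StrictMono a := strictMono_of_deriv_pos fun t => by
    rw [(had t).deriv]; exact mul_pos (hpos t) (hv0 _)
  have hge (t : ℝ) (ht : 0 ≤ t) : a₀ ≤ a t := ha0 ▸ hmono.monotone ht
  have had' (t : ℝ) (ht : 0 ≤ t) : HasDerivAt a (a t * H (a t)) t := by
    have := had t
    simp only [hv] at this
    rwa [show max a₀ (Real.exp (τ t)) = a t from max_eq_right (hge t ht)] at this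
  have hHa (t : ℝ) (ht : 0 ≤ t) :
      HasDerivWithinAt (fun t => H (a t)) (H' (a t) * (a t * H (a t))) (Ici 0) t :=
    (hH (a t) (hge t ht)).comp t (had' t ht).hasDerivWithinAt fun s hs => hge s hs
  refine ⟨a, ha0, hpos, hac, hmono, hge, had', hHa, ?_⟩
  have hu := uniqueDiffOn_Ici (0 : ℝ)
  have hmaps : MapsTo a (Ici 0) (Ici a₀) := fun t ht => hge t ht
  have hHac : ContinuousOn (fun t => H (a t)) (Ici 0) := hHc.comp hac.continuousOn hmaps
  have hd1 : ∀ t ∈ Ici (0 : ℝ), derivWithin a (Ici 0) t = a t * H (a t) := fun t ht =>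
    (had' t ht).hasDerivWithinAt.derivWithin (hu t ht)
  have hd2 : ∀ t ∈ Ici (0 : ℝ), HasDerivWithinAt (fun t => a t * H (a t))
      (a t * H (a t) * H (a t) + a t * (H' (a t) * (a t * H (a t)))) (Ici 0) t := fun t ht =>
    (had' t ht).hasDerivWithinAt.mul (hHa t ht)
  rw [show (2 : WithTop ℕ∞) = 1 + 1 by norm_num, contDiffOn_succ_iff_derivWithin hu]
  refine ⟨fun t ht => (had' t ht).differentiableAt.differentiableWithinAt, by simp, ?_⟩
  refine ContDiffOn.congr ?_ hd1
  rw [contDiffOn_one_iff_derivWithin hu]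
  refine ⟨fun t ht => (hd2 t ht).differentiableWithinAt, ?_⟩
  refine ContinuousOn.congr ?_ fun t ht => (hd2 t ht).derivWithin (hu t ht)
  exact ((hac.continuousOn.mul hHac).mul hHac).add
    (hac.continuousOn.mul ((hH'.comp hac.continuousOn hmaps).mul (hac.continuousOn.mul hHac)))

/-! ### The Einstein tensor of the Robertson-Walker metric -/

section Geometry

variable {a H H' : ℝ → ℝ} {t : ℝ}

/-- The Christoffel symbols of the Robertson-Walker metric in terms of `H = ȧ / a`. -/
def rwChristoffel (a H : ℝ → ℝ) (l i j : Fin 4) (t : ℝ) : ℝ :=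
  if l = 0 then (if i = j ∧ i ≠ 0 then a t ^ 2 * H t else 0)
  else if (i = 0 ∧ j = l) ∨ (j = 0 ∧ i = l) then H t else 0

lemma inv_rwMetric (ht : a t ≠ 0) :
    (rwMetric a t)⁻¹ = Matrix.diagonal ![-1, (a t ^ 2)⁻¹, (a t ^ 2)⁻¹, (a t ^ 2)⁻¹] := by
  refine Matrix.inv_eq_right_inv ?_
  rw [rwMetric, Matrix.diagonal_mul_diagonal, ← Matrix.diagonal_one]
  congr 1
  ext i
  fin_cases i <;> simp [ht]

lemma pd_rwMetric (ha : HasDerivWithinAt a (a t * H t) (Ici 0) t) (ht : 0 ≤ t) (i m j : Fin 4) :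
    pd i (fun s => rwMetric a s m j) t =
      if i = 0 ∧ m = j ∧ m ≠ 0 then 2 * a t ^ 2 * H t else 0 := by
  have hu := uniqueDiffOn_Ici (0 : ℝ) t ht
  have h2 : derivWithin (fun s => a s ^ 2) (Ici 0) t = 2 * a t ^ 2 * H t := by
    refine Eq.trans ((ha.pow 2).derivWithin hu) ?_
    push_cast; ring
  rw [pd]
  by_cases hi : i = 0
  · simp only [hi, if_true, true_and]
    by_cases hmj : m = j
    · subst hmj
      fin_cases m <;> simp [rwMetric, h2]
    · have : (fun s => rwMetric a s m j) = fun _ => 0 := by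
        ext s; exact Matrix.diagonal_apply_ne _ hmj
      simp [this, hmj]
  · simp [hi]

lemma christoffel_rwMetric (h0 : a t ≠ 0) (ha : HasDerivWithinAt a (a t * H t) (Ici 0) t)
    (ht : 0 ≤ t) (l i j : Fin 4) :
    christoffel (rwMetric a) l i j t = rwChristoffel a H l i j t := by
  rw [christoffel, inv_rwMetric h0]
  simp only [pd_rwMetric ha ht, rwChristoffel, Matrix.diagonal_apply, ite_mul, zero_mul,
    Finset.sum_ite_eq, Finset.mem_univ, if_true]
  fin_cases l <;> fin_cases i <;> fin_cases j <;> simp <;> field_simp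

variable (h0 : ∀ t, 0 ≤ t → a t ≠ 0)
  (ha : ∀ t, 0 ≤ t → HasDerivWithinAt a (a t * H t) (Ici 0) t)
  (hH : ∀ t, 0 ≤ t → HasDerivWithinAt H (H' t) (Ici 0) t)

include h0 ha hH

lemma pd_christoffel_rwMetric (ht : 0 ≤ t) (i l m j : Fin 4) :
    pd i (christoffel (rwMetric a) l m j) t =
      if i = 0 then (if l = 0 then
        (if m = j ∧ m ≠ 0 then a t ^ 2 * (H' t + 2 * H t ^ 2) else 0)
        else if (m = 0 ∧ j = l) ∨ (j = 0 ∧ m = l) then H' t else 0) else 0 := by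
  have hu := uniqueDiffOn_Ici (0 : ℝ) t ht
  have h2 : derivWithin (fun s => a s ^ 2 * H s) (Ici 0) t = a t ^ 2 * (H' t + 2 * H t ^ 2) := by
    have := (((ha t ht).pow 2).mul (hH t ht)).derivWithin hu
    refine Eq.trans this ?_
    simp only [Pi.pow_apply]
    push_cast; ring
  have h1 : derivWithin (fun s => H s) (Ici 0) t = H' t := (hH t ht).derivWithin hu
  rw [pd]
  refine if_congr Iff.rfl ?_ rfl
  -- The formula is known for t ≥ 0 only, which is enough for a derivative within that half-line.
  have hc : EqOn (christoffel (rwMetric a) l m j) (rwChristoffel a H l m j) (Ici 0) :=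
    fun s hs => christoffel_rwMetric (h0 s hs) (ha s hs) hs l m j
  rw [derivWithin_congr hc (hc ht)]
  unfold rwChristoffel
  split_ifs
  · exact h2
  · simp
  · exact h1
  · simp

lemma ricci_rwMetric (ht : 0 ≤ t) (i j : Fin 4) :
    ricci (rwMetric a) i j t = Matrix.diagonal ![-3 * (H' t + H t ^ 2),
      a t ^ 2 * (H' t + 3 * H t ^ 2), a t ^ 2 * (H' t + 3 * H t ^ 2),
      a t ^ 2 * (H' t + 3 * H t ^ 2)] i j := by
  simp only [ricci, riemann, pd_christoffel_rwMetric h0 ha hH ht,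
    christoffel_rwMetric (h0 t ht) (ha t ht) ht, rwChristoffel, Fin.sum_univ_four]
  fin_cases i <;> fin_cases j <;> simp <;> ring

lemma scalarCurv_rwMetric (ht : 0 ≤ t) :
    scalarCurv (rwMetric a) t = 6 * H' t + 12 * H t ^ 2 := by
  have := h0 t ht
  simp only [scalarCurv, ricci_rwMetric h0 ha hH ht, inv_rwMetric this, Fin.sum_univ_four]
  simp
  field_simp
  ring

/-- The Einstein equations reduce to the Friedmann equations. -/
lemma solvesEinstein_of_friedmann {Λ : ℝ} {f : ℝ → Mom → ℝ} {ρ P : ℝ → ℝ}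
    (hT : ∀ t, 0 ≤ t → ∀ i j, stressUp a f i j t =
      Matrix.diagonal ![ρ t, P t / a t ^ 2, P t / a t ^ 2, P t / a t ^ 2] i j)
    (h1 : ∀ t, 0 ≤ t → 3 * H t ^ 2 = 8 * Real.pi * ρ t + Λ)
    (h2 : ∀ t, 0 ≤ t → -2 * H' t = 8 * Real.pi * (ρ t + P t)) : SolvesEinstein Λ a f := by
  intro t ht i j
  have hne := h0 t ht
  have e1 := h1 t ht
  have e2 := h2 t ht
  simp only [ricci_rwMetric h0 ha hH ht, scalarCurv_rwMetric h0 ha hH ht, stressDown, hT t ht,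
    rwMetric, Fin.sum_univ_four]
  fin_cases i <;> fin_cases j <;> simp
  -- The (0,0) equation is the constraint.
  · linear_combination e1
  all_goals
    field_simp
    -- Each spatial equation is -2Ḣ - 3H² + Λ = 8πP times a², the difference of the two Friedmann
    -- equations.
    linear_combination 2 * (e2 - e1)

end Geometry

/-! ### Second moments of rotation invariant distribution functions -/

section Moments

variable {h : Mom → ℝ}

lemma RotInvariant.integral_mul (hh : RotInvariant h) {M : Matrix (Fin 3) (Fin 3) ℝ}
    (hM : M ∈ Matrix.specialOrthogonalGroup (Fin 3) ℝ) (Φ : Mom → ℝ) :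
    ∫ p, Φ (act M p) * h p = ∫ p, Φ p * h p := by
  obtain ⟨L, hL⟩ := exists_isometry_act hM
  rw [← integral_isometry L fun p => Φ p * h p]
  refine integral_congr_ae ?_
  filter_upwards [hh M hM] with p hp
  simp only [hL, hp]

lemma energy_act (α : ℝ) {M : Matrix (Fin 3) (Fin 3) ℝ}
    (hM : M ∈ Matrix.specialOrthogonalGroup (Fin 3) ℝ) (p : Mom) :
    energy α (act M p) = energy α p := by
  obtain ⟨L, hL⟩ := exists_isometry_act hM
  rw [← hL, energy_isometry]

/-- The rotation by `π` about a coordinate axis. -/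
def halfTurn (s₀ s₁ s₂ : ℝ) : Matrix (Fin 3) (Fin 3) ℝ := Matrix.diagonal ![s₀, s₁, s₂]

lemma halfTurn_mem {s₀ s₁ s₂ : ℝ} (h₀ : s₀ * s₀ = 1) (h₁ : s₁ * s₁ = 1) (h₂ : s₂ * s₂ = 1)
    (hd : s₀ * s₁ * s₂ = 1) : halfTurn s₀ s₁ s₂ ∈ Matrix.specialOrthogonalGroup (Fin 3) ℝ := by
  rw [Matrix.mem_specialOrthogonalGroup_iff, Matrix.mem_orthogonalGroup_iff, halfTurn,
    Matrix.diagonal_transpose, Matrix.diagonal_mul_diagonal, Matrix.det_diagonal,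
    ← Matrix.diagonal_one]
  refine ⟨?_, by simpa [Fin.prod_univ_three] using hd⟩
  congr 1
  ext i
  fin_cases i <;> simp [h₀, h₁, h₂]

lemma fourMom_halfTurn (α : ℝ) {s₀ s₁ s₂ : ℝ}
    (hs : halfTurn s₀ s₁ s₂ ∈ Matrix.specialOrthogonalGroup (Fin 3) ℝ) (p : Mom) (i : Fin 4) :
    fourMom α (act (halfTurn s₀ s₁ s₂) p) i = ![1, s₀, s₁, s₂] i * fourMom α p i := by
  rw [fourMom, fourMom, energy_act α hs]
  fin_cases i <;> simp [act, halfTurn, Matrix.mulVec_diagonal]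

/-- The rotation permuting the coordinates cyclically. -/
def cyclicRotation : Matrix (Fin 3) (Fin 3) ℝ := !![0, 1, 0; 0, 0, 1; 1, 0, 0]

lemma cyclicRotation_mem : cyclicRotation ∈ Matrix.specialOrthogonalGroup (Fin 3) ℝ := by
  rw [Matrix.mem_specialOrthogonalGroup_iff, Matrix.mem_orthogonalGroup_iff]
  constructor
  · ext i j
    fin_cases i <;> fin_cases j <;>
      simp [cyclicRotation, Matrix.mul_apply, Fin.sum_univ_three]
  · simp [cyclicRotation, Matrix.det_fin_three]

lemma act_cyclicRotation (p : Mom) (i : Fin 3) : act cyclicRotation p i = p (i + 1) := by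
  fin_cases i <;> simp [act, cyclicRotation, dotProduct, Fin.sum_univ_three]

/-- For any two distinct indices some half turn about a coordinate axis reverses exactly one of the
two components, so the moment equals its negative. -/
lemma RotInvariant.moment_eq_zero (hh : RotInvariant h) (α : ℝ) {i j : Fin 4} (hij : i ≠ j) :
    ∫ p, fourMom α p i * fourMom α p j / energy α p * h p = 0 := by
  have key (s₀ s₁ s₂ : ℝ)
      (hs : halfTurn s₀ s₁ s₂ ∈ Matrix.specialOrthogonalGroup (Fin 3) ℝ)
      (hsign : (![1, s₀, s₁, s₂] : Fin 4 → ℝ) i * (![1, s₀, s₁, s₂] : Fin 4 → ℝ) j = -1) :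
      ∫ p, fourMom α p i * fourMom α p j / energy α p * h p = 0 := by
    have := hh.integral_mul hs fun p => fourMom α p i * fourMom α p j / energy α p
    have e : ∀ p, fourMom α (act (halfTurn s₀ s₁ s₂) p) i *
        fourMom α (act (halfTurn s₀ s₁ s₂) p) j / energy α (act (halfTurn s₀ s₁ s₂) p) * h p =
        -(fourMom α p i * fourMom α p j / energy α p * h p) := fun p => by
      rw [fourMom_halfTurn α hs, fourMom_halfTurn α hs, energy_act α hs]
      linear_combination (fourMom α p i * fourMom α p j / energy α p * h p) * hsign
    simp only [e, integral_neg] at this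
    linarith
  have m₀ := halfTurn_mem (s₀ := 1) (s₁ := -1) (s₂ := -1) (by simp) (by simp) (by simp) (by simp)
  have m₁ := halfTurn_mem (s₀ := -1) (s₁ := 1) (s₂ := -1) (by simp) (by simp) (by simp) (by simp)
  -- The half turn about the first axis separates {0, 1} from {2, 3}; the one about the second axis
  -- separates the two indices inside each of these pairs.
  by_cases hs : (![1, 1, -1, -1] : Fin 4 → ℝ) i * (![1, 1, -1, -1] : Fin 4 → ℝ) j = -1
  · exact key _ _ _ m₀ hs
  · refine key _ _ _ m₁ ?_
    revert hij hs
    fin_cases i <;> fin_cases j <;> simp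

lemma abs_sq_div_energy_le {α : ℝ} (hα : 0 < α) (p : Mom) (k : Fin 3) :
    |p k ^ 2 / energy α p| ≤ (1 + α) / α ^ 2 * wt p := by
  have hE := energy_pos α p
  rw [abs_of_nonneg (by positivity)]
  have h1 : p k ^ 2 ≤ ‖p‖ ^ 2 := by
    have := PiLp.norm_apply_le p k
    rw [← sq_abs, ← Real.norm_eq_abs]
    gcongr
  have h2 := (flux_le_energy α p).trans ((le_abs_self _).trans (energy_le_wt hα.le p))
  have h3 : p k ^ 2 / energy α p ≤ flux α p / α ^ 2 := by
    rw [flux, div_right_comm, mul_div_cancel_left₀ _ (by positivity)]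
    gcongr
  refine h3.trans ?_
  rw [div_mul_eq_mul_div]
  gcongr

/-- The cyclic permutation of the axes is a rotation, so the three moments coincide and each is a
third of their sum. -/
lemma RotInvariant.moment_diag (hh : RotInvariant h) (hm : MemL12 h) {α : ℝ} (hα : 0 < α)
    (k : Fin 3) :
    ∫ p, p k ^ 2 / energy α p * h p = (∫ p, ‖p‖ ^ 2 / energy α p * h p) / 3 := by
  have hstep (k : Fin 3) : ∫ p, p (k + 1) ^ 2 / energy α p * h p =
      ∫ p, p k ^ 2 / energy α p * h p := by
    rw [← hh.integral_mul cyclicRotation_mem fun p => p k ^ 2 / energy α p]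
    simp only [act_cyclicRotation, energy_act α cyclicRotation_mem]
  have hmeas (k : Fin 3) : Measurable fun p : Mom => p k ^ 2 / energy α p := by fun_prop
  have hi (k : Fin 3) := (hm.integrable_mul (hmeas k) fun p => abs_sq_div_energy_le hα p k).1
  have hsum : ∫ p, ‖p‖ ^ 2 / energy α p * h p =
      ∑ k : Fin 3, ∫ p, p k ^ 2 / energy α p * h p := by
    rw [← integral_finsetSum _ fun k _ => hi k]
    congr 1; ext p
    rw [EuclideanSpace.norm_sq_eq, Finset.sum_div, Finset.sum_mul]
    simp only [Real.norm_eq_abs, sq_abs]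
  have e0 := hstep 0
  have e1 := hstep 1
  rw [hsum, Fin.sum_univ_three]
  simp only [Fin.reduceAdd] at e0 e1
  fin_cases k <;> simp <;> linarith

/-- The stress-matter tensor of a rotation invariant distribution function. -/
lemma stressUp_eq_diagonal {a : ℝ → ℝ} {f : ℝ → Mom → ℝ} {t : ℝ} (hh : RotInvariant (f t))
    (hm : MemL12 (f t)) (ha : 0 < a t) (i j : Fin 4) :
    stressUp a f i j t = Matrix.diagonal
      ![a t ^ 3 * ∫ p, energy (a t) p * f t p,
        a t ^ 3 * ((∫ p, ‖p‖ ^ 2 / energy (a t) p * f t p) / 3),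
        a t ^ 3 * ((∫ p, ‖p‖ ^ 2 / energy (a t) p * f t p) / 3),
        a t ^ 3 * ((∫ p, ‖p‖ ^ 2 / energy (a t) p * f t p) / 3)] i j := by
  have e : stressUp a f i j t =
      a t ^ 3 * ∫ p, fourMom (a t) p i * fourMom (a t) p j / energy (a t) p * f t p := by
    rw [stressUp, ← integral_const_mul]
    congr 1; ext p; ring
  rw [e]
  by_cases hij : i = j
  · subst hij
    rw [Matrix.diagonal_apply_eq]
    have hd := hh.moment_diag hm ha
    have h0 : ∀ p, energy (a t) p * energy (a t) p / energy (a t) p = energy (a t) p :=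
      fun p => mul_div_cancel_right₀ _ (energy_pos _ _).ne'
    fin_cases i
    · simp [fourMom, h0]
    · simp [fourMom, ← sq, hd]
    · simp [fourMom, ← sq, hd]
    · simp [fourMom, ← sq, hd]
  · rw [Matrix.diagonal_apply_ne _ hij, hh.moment_eq_zero _ hij, mul_zero]

end Moments

/-! ### Dilations of distribution functions -/

section Dilation

variable {u : Mom → ℝ} {c : ℝ}

lemma wt_smul_le (hc : 0 < c) (hc1 : c ≤ 1) (p : Mom) : wt (c • p) ≤ wt p := by
  refine Real.sqrt_le_sqrt ?_
  rw [norm_smul, Real.norm_eq_abs, abs_of_pos hc]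
  gcongr
  exact mul_le_of_le_one_left (norm_nonneg _) hc1

lemma MemL12.dilation (hu : MemL12 u) (hm : Measurable u) (hc : 0 < c) :
    MemL12 fun p => u (c⁻¹ • p) := by
  have hm' : Measurable fun p => u (c⁻¹ • p) := hm.comp (measurable_const_smul _)
  refine memL12_of_measurable hm' ?_
  have h1 : Integrable fun p => wt (c⁻¹ • p) * |u (c⁻¹ • p)| :=
    hu.weighted.comp_smul (inv_ne_zero hc.ne')
  refine (h1.const_mul (1 + c)).mono'
    (continuous_wt.measurable.mul hm'.abs).aestronglyMeasurable (Eventually.of_forall fun p => ?_)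
  rw [Real.norm_eq_abs, abs_mul, abs_abs, abs_of_pos (wt_pos p), ← mul_assoc]
  refine mul_le_mul_of_nonneg_right ?_ (abs_nonneg _)
  -- The weight at p is an energy at the dilated point, so the comparison of energy with weight
  -- applies.
  have e : wt p = energy c (c⁻¹ • p) := by
    rw [energy_smul, inv_mul_cancel₀ hc.ne', wt, energy]
    norm_num
  rw [e]
  exact (le_abs_self _).trans (energy_le_wt hc.le _)

/-- For c ≤ 1 both the Jacobian c³ and the change of the weight are at most 1. Expansion thus makes
dilations contractions. -/
lemma normL12_dilation_le (hu : MemL12 u) (hm : Measurable u) (hc : 0 < c) (hc1 : c ≤ 1) :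
    normL12 (fun p => u (c⁻¹ • p)) ≤ normL12 u := by
  rw [normL12_def, integral_mom_smul hc]
  simp only [inv_smul_smul₀ hc.ne']
  have h1 : ∫ q, wt (c • q) * |u q| ≤ normL12 u := by
    have hle (q : Mom) : wt (c • q) * |u q| ≤ wt q * |u q| :=
      mul_le_mul_of_nonneg_right (wt_smul_le hc hc1 q) (abs_nonneg _)
    have hw : Measurable fun q : Mom => wt (c • q) :=
      continuous_wt.measurable.comp (measurable_const_smul _)
    refine integral_mono (hu.weighted.mono' (hw.mul hm.abs).aestronglyMeasurable
      (Eventually.of_forall fun q => ?_)) hu.weighted hle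
    rw [Real.norm_eq_abs, abs_of_nonneg (mul_nonneg (wt_pos _).le (abs_nonneg _))]
    exact hle q
  have h2 : 0 ≤ ∫ q, wt (c • q) * |u q| :=
    integral_nonneg fun q => mul_nonneg (wt_pos _).le (abs_nonneg _)
  exact (mul_le_of_le_one_left h2 (pow_le_one₀ hc.le hc1)).trans h1

variable {ι : Type*} {l : Filter ι} [l.IsCountablyGenerated] {γ : ι → ℝ}

/-- Factors at most 1 keep all the dilated supports in one ball, which supplies the dominating
function. -/
lemma tendsto_normL12_dilation_of_hasCompactSupport (hu : Continuous u) (hs : HasCompactSupport u)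
    (hc : 0 < c) (hc1 : c ≤ 1) (hγ : Tendsto γ l (𝓝 c)) (hγ1 : ∀ᶠ i in l, 0 < γ i ∧ γ i ≤ 1) :
    Tendsto (fun i => normL12 fun p => u ((γ i)⁻¹ • p) - u (c⁻¹ • p)) l (𝓝 0) := by
  obtain ⟨R, hR⟩ := hs.isCompact.isBounded.subset_closedBall 0
  obtain ⟨M, hM⟩ := hs.exists_bound_of_continuous hu
  have hM0 : 0 ≤ M := (norm_nonneg _).trans (hM 0)
  have hbd {x : ℝ} (hx : 0 < x) (hx1 : x ≤ 1) (p : Mom) :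
      |u (x⁻¹ • p)| ≤ (Metric.closedBall (0 : Mom) R).indicator (fun _ => M) p := by
    by_cases hp : p ∈ Metric.closedBall (0 : Mom) R
    · rw [indicator_of_mem hp]; exact hM _
    · rw [indicator_of_notMem hp]
      have : x⁻¹ • p ∉ tsupport u := fun hmem => hp (by
        have := hR hmem
        rw [mem_closedBall_zero_iff, norm_smul, norm_inv, Real.norm_eq_abs, abs_of_pos hx,
          inv_mul_le_iff₀ hx] at this
        rw [mem_closedBall_zero_iff]
        have hR0 : 0 ≤ R := by
          by_contra hneg
          have h2 : 0 ≤ x * R := (norm_nonneg p).trans this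
          nlinarith
        exact this.trans (mul_le_of_le_one_left hR0 hx1))
      rw [image_eq_zero_of_notMem_tsupport this, abs_zero]
  have hlim : Tendsto (fun i => ∫ p, wt p * |u ((γ i)⁻¹ • p) - u (c⁻¹ • p)|) l
      (𝓝 (∫ _ : Mom, (0 : ℝ))) := by
    refine tendsto_integral_filter_of_dominated_convergence
      ((Metric.closedBall (0 : Mom) R).indicator fun p => wt p * (M + M))
      (Eventually.of_forall fun i => ?_) ?_ ?_ (Eventually.of_forall fun p => ?_)
    · exact (continuous_wt.mul ((hu.comp (continuous_const_smul _)).sub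
        (hu.comp (continuous_const_smul _))).abs).aestronglyMeasurable
    · filter_upwards [hγ1] with i hi
      refine Eventually.of_forall fun p => ?_
      rw [Real.norm_eq_abs, abs_mul, abs_abs, abs_of_pos (wt_pos p)]
      have h1 := hbd hi.1 hi.2 p
      have h2 := hbd hc hc1 p
      have h3 := (abs_sub (u ((γ i)⁻¹ • p)) (u (c⁻¹ • p))).trans (add_le_add h1 h2)
      by_cases hp : p ∈ Metric.closedBall (0 : Mom) R
      · rw [indicator_of_mem hp] at h3 ⊢
        exact mul_le_mul_of_nonneg_left h3 (wt_pos p).le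
      · rw [indicator_of_notMem hp] at h3 ⊢
        rw [add_zero] at h3
        exact mul_nonpos_of_nonneg_of_nonpos (wt_pos p).le h3
    · rw [integrable_indicator_iff Metric.isClosed_closedBall.measurableSet]
      exact (continuous_wt.mul continuous_const).continuousOn.integrableOn_compact
        (isCompact_closedBall _ _)
    · have h1 : Tendsto (fun i => (γ i)⁻¹ • p) l (𝓝 (c⁻¹ • p)) :=
        (hγ.inv₀ hc.ne').smul_const p
      have h2 := ((hu.tendsto _).comp h1).sub_const (u (c⁻¹ • p))
      have h3 := (h2.abs).const_mul (wt p)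
      simpa using h3
  rw [integral_zero] at hlim
  exact hlim

/-- Continuity of dilations in the weighted space. -/
lemma tendsto_normL12_dilation (hu : MemL12 u) (hm : Measurable u) (hc : 0 < c) (hc1 : c ≤ 1)
    (hγ : Tendsto γ l (𝓝 c)) (hγ1 : ∀ᶠ i in l, 0 < γ i ∧ γ i ≤ 1) :
    Tendsto (fun i => normL12 fun p => u ((γ i)⁻¹ • p) - u (c⁻¹ • p)) l (𝓝 0) := by
  rw [Metric.tendsto_nhds]
  intro ε hε
  have hwu : Integrable fun p => wt p * u p :=
    hu.weighted.mono' (by fun_prop) (Eventually.of_forall fun p => by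
      rw [Real.norm_eq_abs, abs_mul, abs_of_pos (wt_pos p)])
  -- Approximating w·u in plain L¹ and dividing by w gives a compactly supported approximation G of
  -- u in the weighted norm. Since dilations are contractions, the approximation error stays below
  -- ε/4 for each.
  obtain ⟨g, hgs, hgle, hgc, -⟩ :=
    hwu.exists_hasCompactSupport_integral_sub_le (ε := ε / 4) (by positivity)
  set G : Mom → ℝ := fun p => g p * (wt p)⁻¹ with hG
  have hGc : Continuous G := hgc.mul (continuous_wt.inv₀ fun p => (wt_pos p).ne')
  have hGs : HasCompactSupport G := hgs.mul_right
  have hGm : Measurable G := hGc.measurable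
  have hGw : ∀ p, wt p * G p = g p := fun p => by
    rw [hG]; beta_reduce; rw [mul_left_comm, mul_inv_cancel₀ (wt_pos p).ne', mul_one]
  have hGmem : MemL12 G := memL12_of_measurable hGm
    ((continuous_wt.mul hGc.abs).integrable_of_hasCompactSupport hGs.abs.mul_left)
  have hd : normL12 (fun p => u p - G p) ≤ ε / 4 := by
    refine le_trans (le_of_eq ?_) hgle
    rw [normL12_def]
    congr 1; ext p
    rw [Real.norm_eq_abs, ← hGw, ← mul_sub, abs_mul, abs_of_pos (wt_pos p)]
  have hdm := hu.sub hGmem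
  have hdmeas : Measurable fun p => u p - G p := hm.sub hGm
  filter_upwards [Metric.tendsto_nhds.1
    (tendsto_normL12_dilation_of_hasCompactSupport hGc hGs hc hc1 hγ hγ1) (ε / 4) (by positivity),
    hγ1] with i hi hi1
  rw [Real.dist_eq, sub_zero, abs_of_nonneg (normL12_nonneg _)] at hi ⊢
  have n1 := (normL12_dilation_le hdm hdmeas hi1.1 hi1.2).trans hd
  have n2 := (normL12_dilation_le hdm hdmeas hc hc1).trans hd
  have m1 := hdm.dilation hdmeas hi1.1
  have m2 := hdm.dilation hdmeas hc
  have m3 := (hGmem.dilation hGm hi1.1).sub (hGmem.dilation hGm hc)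
  have m4 := (hu.dilation hm hi1.1).sub (hu.dilation hm hc)
  have k1 := normL12_add_le m1 m2 (m1.sub m2) fun p => abs_sub _ _
  have k2 := normL12_add_le (m1.sub m2) m3 m4 fun p => by
    refine le_trans (le_of_eq ?_) (abs_add_le _ _)
    congr 1; ring
  linarith

end Dilation

/-! ### The global solution -/

section Solution

variable {A : Kernel} {a₀ Λ : ℝ} {u₀ : Mom → ℝ} {F : ℝ → Mom → ℝ} {a : ℝ → ℝ}

/-- The distribution function at time `t`, in the momenta of the coordinate frame. -/
def physicalCurve (a₀ : ℝ) (a : ℝ → ℝ) (F : ℝ → Mom → ℝ) (t : ℝ) (p : Mom) : ℝ :=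
  F (a t) ((a₀ ^ 2 / a t ^ 2)⁻¹ • p)

lemma dilation_param (ha₀ : 0 < a₀) {α : ℝ} (hα : a₀ ≤ α) :
    0 < a₀ ^ 2 / α ^ 2 ∧ a₀ ^ 2 / α ^ 2 ≤ 1 ∧ a₀ ^ 2 / α ^ 2 * α = a₀ ^ 2 / α := by
  have h0 := ha₀.trans_le hα
  refine ⟨by positivity, (div_le_one (by positivity)).2 (by gcongr), ?_⟩
  field_simp

lemma ae_dilation {P : Mom → Prop} {c : ℝ} (hc : c ≠ 0) (h : ∀ᵐ p, P p) : ∀ᵐ p : Mom, P (c • p) :=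
  (Measure.quasiMeasurePreserving_smul (volume : Measure Mom) hc).ae h

lemma IsComovingSolution.rotInvariant (hF : IsComovingSolution A a₀ Λ u₀ F)
    (hA : IsCollisionKernel A) (hu₀ : RotInvariant u₀) {s : ℝ} (hs : a₀ ≤ s) :
    RotInvariant (F s) := by
  intro M hM
  obtain ⟨L, hL⟩ := exists_isometry_act hM
  have := hF.rotation L (fun α hα p q p' q' => by
    simp only [hL]; exact hA.rotInvariant α hα M hM p q p' q')
    (by simpa only [hL, EventuallyEq] using hu₀ M hM) s hs
  simpa only [hL, EventuallyEq] using this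

lemma RotInvariant.dilation {h : Mom → ℝ} (hh : RotInvariant h) {c : ℝ} (hc : c ≠ 0) :
    RotInvariant fun p => h (c • p) := by
  intro M hM
  have e (p : Mom) : c • act M p = act M (c • p) := by
    simp only [act, WithLp.ofLp_smul, Matrix.mulVec_smul, WithLp.toLp_smul]
  simp only [e]
  exact ae_dilation hc (hh M hM)

lemma continuousAt_dilation_param (ha : Continuous a) {t : ℝ} (ht : a t ≠ 0) :
    ContinuousAt (fun s => a₀ ^ 2 / a s ^ 2) t :=
  continuousAt_const.div (ha.continuousAt.pow 2) (pow_ne_zero 2 ht)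

/-- Continuity combines two effects: the change of F between clock values, where dilations do not
increase the norm, and the change of the dilation applied to a fixed function. -/
lemma IsComovingSolution.isDistributionCurve (hF : IsComovingSolution A a₀ Λ u₀ F)
    (ha₀ : 0 < a₀) (ha : Continuous a) (hge : ∀ t, 0 ≤ t → a₀ ≤ a t) :
    IsDistributionCurve (physicalCurve a₀ a F) := by
  have hFm (s : ℝ) : Measurable (F s) := hF.measurable.of_uncurry_left
  have hmem (t : ℝ) (ht : 0 ≤ t) : MemL12 (physicalCurve a₀ a F t) :=
    (hF.mem _ (hge t ht)).dilation (hFm _) (dilation_param ha₀ (hge t ht)).1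
  obtain ⟨R, hR⟩ := hF.bounded
  obtain ⟨B, hB, hL⟩ := hF.lipschitz
  refine ⟨?_, hmem, fun t ht => ?_, fun t ht => ?_, R, fun t ht => ?_⟩
  · have ham := ha.measurable
    have h1 : Measurable fun z : ℝ × Mom => (a z.1, (a₀ ^ 2 / a z.1 ^ 2)⁻¹ • z.2) := by fun_prop
    exact hF.measurable.comp h1
  · have hc := (dilation_param ha₀ (hge t ht)).1
    have h1 : ∀ᵐ y, 0 ≤ F (a t) y := hF.nonneg.mono fun y hy => hy _ (hge t ht)
    exact ae_dilation (inv_ne_zero hc.ne') h1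
  · obtain ⟨hc, hc1, -⟩ := dilation_param ha₀ (hge t ht)
    have hg (s : ℝ) (hs : s ∈ Ici (0 : ℝ)) := dilation_param ha₀ (hge s hs)
    have h1 := tendsto_normL12_dilation (l := 𝓝[Ici 0] t) (hF.mem _ (hge t ht)) (hFm _) hc hc1
      ((continuousAt_dilation_param (a₀ := a₀) ha
        (ha₀.trans_le (hge t ht)).ne').tendsto.mono_left nhdsWithin_le_nhds)
      (eventually_mem_nhdsWithin.mono fun s hs => ⟨(hg s hs).1, (hg s hs).2.1⟩)
    have h2 : Tendsto (fun s => B * |a s - a t|) (𝓝[Ici 0] t) (𝓝 0) := by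
      have : ContinuousAt (fun s => B * |a s - a t|) t := by fun_prop
      have h := this.tendsto
      simp only [sub_self, abs_zero, mul_zero] at h
      exact h.mono_left nhdsWithin_le_nhds
    have h3 := h2.add h1
    rw [add_zero] at h3
    refine squeeze_zero' (Eventually.of_forall fun _ => normL12_nonneg _) ?_ h3
    filter_upwards [self_mem_nhdsWithin] with s hs
    have hd := (hF.mem _ (hge s hs)).sub (hF.mem _ (hge t ht))
    have hdm : Measurable fun y => F (a s) y - F (a t) y := (hFm _).sub (hFm _)
    have m1 := hd.dilation hdm (hg s hs).1
    have m2 := ((hF.mem _ (hge t ht)).dilation (hFm _) (hg s hs).1).sub (hmem t ht)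
    have k1 := normL12_add_le m1 m2 ((hmem s hs).sub (hmem t ht)) fun p => by
      refine le_trans (le_of_eq ?_) (abs_add_le _ _)
      congr 1; simp only [physicalCurve]; ring
    refine k1.trans (add_le_add ?_ le_rfl)
    refine (normL12_dilation_le hd hdm (hg s hs).1 (hg s hs).2.1).trans ?_
    rcases le_total (a t) (a s) with h | h
    · rw [abs_of_nonneg (sub_nonneg.2 h)]
      exact hL _ _ (hge t ht) h
    · rw [abs_sub_comm, abs_of_nonneg (sub_nonneg.2 h)]
      refine le_trans (le_of_eq ?_) (hL _ _ (hge s hs) h)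
      rw [normL12, normL12]
      simp only [abs_sub_comm]
  · obtain ⟨hc, hc1, -⟩ := dilation_param ha₀ (hge t ht)
    exact (normL12_dilation_le (hF.mem _ (hge t ht)) (hFm _) hc hc1).trans (hR _ (hge t ht))

/-- The stress-matter tensor of the solution. -/
lemma IsComovingSolution.stressUp_eq (hF : IsComovingSolution A a₀ Λ u₀ F)
    (hA : IsCollisionKernel A) (hu₀ : RotInvariant u₀) (ha₀ : 0 < a₀) {t : ℝ} (ht : a₀ ≤ a t)
    (i j : Fin 4) :
    stressUp a (physicalCurve a₀ a F) i j t = Matrix.diagonal ![energyDensity a₀ F (a t),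
      pressure a₀ F (a t) / a t ^ 2, pressure a₀ F (a t) / a t ^ 2,
      pressure a₀ F (a t) / a t ^ 2] i j := by
  obtain ⟨hc, -, hβ⟩ := dilation_param ha₀ ht
  have hα := ha₀.trans_le ht
  have hFm : Measurable (F (a t)) := hF.measurable.of_uncurry_left
  have hrot := (hF.rotInvariant hA hu₀ ht).dilation (inv_ne_zero hc.ne')
  rw [stressUp_eq_diagonal (f := physicalCurve a₀ a F) hrot
    ((hF.mem _ ht).dilation hFm hc) hα]
  have e1 : a t ^ 3 * ∫ p, energy (a t) p * physicalCurve a₀ a F t p =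
      energyDensity a₀ F (a t) := by
    rw [integral_mom_smul hc, energyDensity]
    simp only [physicalCurve, inv_smul_smul₀ hc.ne', energy_smul, hβ]
    rw [← mul_assoc, ← mul_pow, mul_comm (a t), hβ]
  have e2 : a t ^ 3 * ((∫ p, ‖p‖ ^ 2 / energy (a t) p * physicalCurve a₀ a F t p) / 3) =
      pressure a₀ F (a t) / a t ^ 2 := by
    rw [integral_mom_smul hc, pressure]
    simp only [physicalCurve, inv_smul_smul₀ hc.ne', energy_smul, hβ]
    have e3 : ∀ q : Mom, ‖(a₀ ^ 2 / a t ^ 2) • q‖ ^ 2 / energy (a₀ ^ 2 / a t) q * F (a t) q =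
        (a t ^ 2)⁻¹ * (flux (a₀ ^ 2 / a t) q * F (a t) q) := fun q => by
      rw [norm_smul, Real.norm_eq_abs, abs_of_pos hc, flux]
      have := energy_pos (a₀ ^ 2 / a t) q
      field_simp
    simp only [e3]
    rw [integral_const_mul]
    generalize (∫ q, flux (a₀ ^ 2 / a t) q * F (a t) q) = J
    field_simp
  rw [e1, e2]

lemma hubble_eq (a₀ Λ : ℝ) (F : ℝ → Mom → ℝ) (α : ℝ) :
    hubble a₀ Λ α (F α) = √(8 * Real.pi / 3 * energyDensity a₀ F α + Λ / 3) := rfl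

/-- The right-hand side of the Boltzmann equation along the characteristics. -/
lemma collision_physicalCurve (ha₀ : 0 < a₀) (ha0 : a 0 = a₀) {s : ℝ} (hs : a₀ ≤ a s)
    (hH : hubble a₀ Λ (a s) (F (a s)) ≠ 0) (y : Mom) :
    collision A (a s) (physicalCurve a₀ a F s) (physicalCurve a₀ a F s) (characteristic a s y) /
      energy (a s) (characteristic a s y) =
    a s * hubble a₀ Λ (a s) (F (a s)) * comovingRHS A a₀ Λ (a s) (F (a s)) y := by
  obtain ⟨hc, -, hβ⟩ := dilation_param ha₀ hs
  have hα := ha₀.trans_le hs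
  -- The factor aH = ȧ undoes the change of clock.
  rw [comovingRHS, mul_inv_cancel_left₀ (mul_ne_zero hα.ne' hH), source, characteristic, ha0]
  have h1 := collision_smul A (α := a s) hc (F (a s)) y
  rw [hβ] at h1
  have h2 : comovingKernel A a₀ (a s) = fun p q p' q' => A (a s) ((a₀ ^ 2 / a s ^ 2) • p)
      ((a₀ ^ 2 / a s ^ 2) • q) ((a₀ ^ 2 / a s ^ 2) • p') ((a₀ ^ 2 / a s ^ 2) • q') := by
    funext p q p' q'
    rw [comovingKernel, if_pos hα]
  rw [h2, ← h1, energy_smul, hβ]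
  rfl

/-- The integrated equation in the clock is pulled back by the substitution r = a(s). The change of
variables for injective maps transports integrability as well as the integral. -/
lemma IsComovingSolution.solvesBoltzmann (hF : IsComovingSolution A a₀ Λ u₀ F) (ha₀ : 0 < a₀)
    (ha : Continuous a) (ha0 : a 0 = a₀) (hmono : StrictMono a)
    (hH : ∀ t, 0 ≤ t → 0 < hubble a₀ Λ (a t) (F (a t)))
    (had : ∀ t, 0 ≤ t → HasDerivAt a (a t * hubble a₀ Λ (a t) (F (a t))) t) {f₀ : Mom → ℝ}
    (hf₀ : u₀ =ᵐ[volume] f₀) : SolvesBoltzmann A a f₀ (physicalCurve a₀ a F) := by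
  have hge (t : ℝ) (ht : 0 ≤ t) : a₀ ≤ a t := ha0 ▸ hmono.monotone ht
  filter_upwards [hF.eq, hf₀] with y hy hy0 t ht
  obtain ⟨h1, h2⟩ := hy (a t) (hge t ht)
  have himg : a '' Ioc 0 t = Ioc a₀ (a t) := by
    ext x
    constructor
    · rintro ⟨s, hs, rfl⟩
      exact ⟨ha0 ▸ hmono hs.1, hmono.monotone hs.2⟩
    · intro hx
      obtain ⟨s, hs, rfl⟩ := intermediate_value_Icc ht ha.continuousOn
        (show x ∈ Icc (a 0) (a t) from ⟨ha0 ▸ hx.1.le, hx.2⟩)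
      refine ⟨s, ⟨hs.1.lt_of_ne fun h => ?_, hs.2⟩, rfl⟩
      subst h
      exact absurd hx.1 (by rw [ha0]; exact lt_irrefl _)
  have hd : ∀ s ∈ Ioc 0 t, HasDerivWithinAt a (a s * hubble a₀ Λ (a s) (F (a s))) (Ioc 0 t) s :=
    fun s hs => (had s hs.1.le).hasDerivWithinAt
  have hcongr : ∀ s ∈ Ioc 0 t, |a s * hubble a₀ Λ (a s) (F (a s))| •
      comovingRHS A a₀ Λ (a s) (F (a s)) y =
      collision A (a s) (physicalCurve a₀ a F s) (physicalCurve a₀ a F s) (characteristic a s y) /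
        energy (a s) (characteristic a s y) := fun s hs => by
    have hs' := hge s hs.1.le
    rw [collision_physicalCurve (Λ := Λ) ha₀ ha0 hs' (hH s hs.1.le).ne', smul_eq_mul,
      abs_of_pos (mul_pos (ha₀.trans_le hs') (hH s hs.1.le))]
  constructor
  · rw [intervalIntegrable_iff_integrableOn_Ioc_of_le ht]
    rw [← himg, integrableOn_image_iff_integrableOn_abs_deriv_smul measurableSet_Ioc hd
      hmono.injective.injOn] at h1
    exact h1.congr_fun hcongr measurableSet_Ioc
  · obtain ⟨hc, -, -⟩ := dilation_param ha₀ (hge t ht)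
    have e : physicalCurve a₀ a F t (characteristic a t y) = F (a t) y := by
      rw [physicalCurve, characteristic, ha0, inv_smul_smul₀ hc.ne']
    rw [e, h2, hy0, intervalIntegral.integral_of_le ht, ← himg,
      integral_image_eq_integral_abs_deriv_smul measurableSet_Ioc hd hmono.injective.injOn,
      setIntegral_congr_fun measurableSet_Ioc hcongr]

/-- Global existence, for measurable non-negative rotation invariant initial data. -/
theorem exists_isGlobalSolution (hA : IsCollisionKernel A) (hΛ : 0 < Λ) (ha₀ : 0 < a₀)
    (hu₀m : Measurable u₀) (hu₀ : MemL12 u₀) (hu₀0 : ∀ y, 0 ≤ u₀ y) (hrot : RotInvariant u₀)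
    {f₀ : Mom → ℝ} (hf₀ : u₀ =ᵐ[volume] f₀) :
    ∃ (a : ℝ → ℝ) (f : ℝ → Mom → ℝ),
      IsGlobalSolution A Λ a₀ (a₀ * hubble a₀ Λ a₀ f₀) f₀ a f := by
  obtain ⟨F, hF⟩ := exists_isComovingSolution hA ha₀ hΛ hu₀m hu₀ hu₀0
  obtain ⟨ρ, hρ⟩ := hF.exists_energyDensity_le ha₀
  have hπ := Real.pi_pos
  have hpos (α : ℝ) (hα : a₀ ≤ α) : 0 < 8 * Real.pi / 3 * energyDensity a₀ F α + Λ / 3 := by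
    have := hF.energyDensity_nonneg ha₀ hα
    positivity
  have hH0 (α : ℝ) (hα : a₀ ≤ α) : 0 < hubble a₀ Λ α (F α) := Real.sqrt_pos.2 (hpos α hα)
  have hh : 0 < √(Λ / 3) := Real.sqrt_pos.2 (by positivity)
  -- The derivative of the square root in the constraint, with dρ/dα taken from the energy balance.
  set H' : ℝ → ℝ := fun α => 8 * Real.pi / 3 *
    (-(3 / α * (energyDensity a₀ F α + pressure a₀ F α))) / (2 * hubble a₀ Λ α (F α)) with hH'
  have hHd (α : ℝ) (hα : a₀ ≤ α) :
      HasDerivWithinAt (fun α => hubble a₀ Λ α (F α)) (H' α) (Ici a₀) α :=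
    (((hF.hasDerivWithinAt_energyDensity hA ha₀ hΛ hα).const_mul _).add_const _).sqrt
      (hpos α hα).ne'
  have hHc : ContinuousOn (fun α => hubble a₀ Λ α (F α)) (Ici a₀) :=
    fun α hα => (hHd α hα).continuousWithinAt
  have hρc : ContinuousOn (energyDensity a₀ F) (Ici a₀) :=
    fun α hα => (hF.hasDerivWithinAt_energyDensity hA ha₀ hΛ hα).continuousWithinAt
  have hH'c : ContinuousOn H' (Ici a₀) := by
    refine ContinuousOn.div (continuousOn_const.mul (ContinuousOn.neg (ContinuousOn.mul
      (continuousOn_const.div continuousOn_id fun α hα => (ha₀.trans_le hα).ne')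
      (hρc.add (hF.continuousOn_pressure ha₀))))) (continuousOn_const.mul hHc) fun α hα => ?_
    exact mul_ne_zero two_ne_zero (hH0 α hα).ne'
  obtain ⟨a, ha0, hapos, hac, hmono, hge, had, hHa, hC2⟩ :=
    exists_scale_factor (M := √(8 * Real.pi / 3 * ρ + Λ / 3)) ha₀ hh hHd hH'c
      (fun α hα => sqrt_le_hubble ha₀ hα (hF.nonneg.mono fun y hy => hy α hα))
      (fun α hα => by
        rw [hubble_eq]
        refine Real.sqrt_le_sqrt ?_
        have := hρ α hα
        gcongr)
  have hF0 : F a₀ =ᵐ[volume] f₀ := by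
    filter_upwards [hF.eq, hf₀] with y h1 h2
    rw [(h1 a₀ le_rfl).2, h2]
    simp
  have hFf : hubble a₀ Λ a₀ (F a₀) = hubble a₀ Λ a₀ f₀ := by
    have : ∫ y, energy (a₀ ^ 2 / a₀) y * F a₀ y = ∫ y, energy (a₀ ^ 2 / a₀) y * f₀ y :=
      integral_congr_ae (hF0.mono fun y hy => by beta_reduce; rw [hy])
    rw [hubble, hubble, this]
  refine ⟨a, physicalCurve a₀ a F, fun t _ => hapos t, hC2, hF.isDistributionCurve ha₀ hac hge, ?_,
    hF.solvesBoltzmann ha₀ hac ha0 hmono (fun t ht => hH0 _ (hge t ht)) had hf₀, ha0, ?_, ?_⟩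
  · refine solvesEinstein_of_friedmann (fun t _ => (hapos t).ne')
      (fun t ht => (had t ht).hasDerivWithinAt) hHa
      (ρ := fun t => energyDensity a₀ F (a t)) (P := fun t => pressure a₀ F (a t))
      (fun t ht => hF.stressUp_eq hA hrot ha₀ (hge t ht)) (fun t ht => ?_) fun t ht => ?_
    · rw [hubble_eq, Real.sq_sqrt (hpos _ (hge t ht)).le]
      ring
    -- Along a, Ḣ = H'(a)·aH(a) = -4π(ρ + P): the H in the denominator cancels, which is the second
    -- Friedmann equation.
    · have h1 := (hH0 _ (hge t ht)).ne'
      have h2 := (hapos t).ne'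
      rw [hH']
      beta_reduce
      field_simp
  · have := (had 0 le_rfl).hasDerivWithinAt.derivWithin (uniqueDiffOn_Ici (0 : ℝ) 0 self_mem_Ici)
    rw [this, ha0, hFf]
  · filter_upwards [hF0] with p hp
    rw [physicalCurve, ha0, div_self (by positivity), inv_one, one_smul, hp]

lemma RotInvariant.congr {f g : Mom → ℝ} (hf : RotInvariant f) (h : f =ᵐ[volume] g) :
    RotInvariant g := by
  intro M hM
  obtain ⟨L, hL⟩ := exists_isometry_act hM
  filter_upwards [hf M hM, h, L.measurePreserving.quasiMeasurePreserving.ae h] with p h1 h2 h3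
  rw [← hL] at h1 ⊢
  rw [← h3, h1, h2]

/-- A non-negative element of the weighted space has a measurable non-negative representative. -/
lemma MemL12.exists_measurable_nonneg {f : Mom → ℝ} (hf : MemL12 f) (h0 : ∀ᵐ p, 0 ≤ f p) :
    ∃ u : Mom → ℝ, Measurable u ∧ MemL12 u ∧ (∀ p, 0 ≤ u p) ∧ u =ᵐ[volume] f := by
  have hmk := hf.1.aestronglyMeasurable.ae_eq_mk
  set g := hf.1.aestronglyMeasurable.mk f
  have hg : Measurable g := hf.1.aestronglyMeasurable.stronglyMeasurable_mk.measurable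
  have he : (fun p => max (g p) 0) =ᵐ[volume] f := by
    filter_upwards [hmk, h0] with p h1 h2
    rw [← h1, max_eq_left h2]
  refine ⟨fun p => max (g p) 0, hg.max measurable_const, ⟨hf.1.congr he.symm, ?_⟩,
    fun p => le_max_right _ _, he⟩
  exact hf.2.congr (he.mono fun p hp => by beta_reduce at hp ⊢; rw [hp])

end Solution

end

end EinsteinBoltzmann

/-- Global existence for the Einstein-Boltzmann system with cosmological constant `Λ > 0`, for
arbitrarily large data; `ȧ₀ > 0` is the one given by the Hamiltonian constraint. -/
theorem theorem6p1
    (A : EinsteinBoltzmann.Kernel) (hA : EinsteinBoltzmann.IsCollisionKernel A)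
    (Λ : ℝ) (hΛ : 0 < Λ)
    (a₀ : ℝ) (ha₀ : 3 / 2 ≤ a₀)
    (f₀ : EinsteinBoltzmann.Mom → ℝ) (hf₀ : EinsteinBoltzmann.MemL12 f₀)
    (hf₀_nonneg : ∀ᵐ p : EinsteinBoltzmann.Mom, 0 ≤ f₀ p)
    (hf₀_rot : EinsteinBoltzmann.RotInvariant f₀)
    (adot₀ : ℝ)
    (hadot₀ : adot₀ / a₀ =
      √(8 * Real.pi / 3 *
          (∫ p : EinsteinBoltzmann.Mom, a₀ ^ 3 * √(1 + a₀ ^ 2 * ‖p‖ ^ 2) * f₀ p) + Λ / 3)) :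
    ∃ (a : ℝ → ℝ) (f : ℝ → EinsteinBoltzmann.Mom → ℝ),
      EinsteinBoltzmann.IsGlobalSolution A Λ a₀ adot₀ f₀ a f := by
  have h0 : 0 < a₀ := by linarith
  obtain ⟨u₀, hm, hu, hu0, he⟩ := hf₀.exists_measurable_nonneg hf₀_nonneg
  obtain ⟨a, f, h⟩ := EinsteinBoltzmann.exists_isGlobalSolution hA hΛ h0 hm hu hu0
    (hf₀_rot.congr he.symm) he
  refine ⟨a, f, ?_⟩
  have hadot : adot₀ = a₀ * EinsteinBoltzmann.hubble a₀ Λ a₀ f₀ := by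
    have e : ∫ p : EinsteinBoltzmann.Mom, a₀ ^ 3 * √(1 + a₀ ^ 2 * ‖p‖ ^ 2) * f₀ p =
        a₀ ^ 3 * ∫ p : EinsteinBoltzmann.Mom, √(1 + a₀ ^ 2 * ‖p‖ ^ 2) * f₀ p := by
      rw [← MeasureTheory.integral_const_mul]
      simp only [mul_assoc]
    -- At the initial clock value the effective expansion factor a₀²/a₀ is a₀, so the comoving
    -- constraint is the prescribed one.
    rw [mul_comm a₀, ← div_eq_iff h0.ne', hadot₀, EinsteinBoltzmann.hubble, e,
      show a₀ ^ 2 / a₀ = a₀ by rw [sq, mul_self_div_self]]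
    rfl
  rwa [hadot]
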